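/- Let $n\ge 2$ and let $\epsilon_1,\dots,\epsilon_n$ be the standard basis of $\mathbb R^n$. Let $\widehat V=\mathbb R^n\oplus\mathbb R\delta$, with the form $\langle\cdot,\cdot\rangle$ extending the standard inner product and having $\delta$ in its radical; put $f^\vee=2f/\langle f,f\rangle$ and $s_f(g)=g-\langle g,f^\vee\rangle f$. Let $$S=\{\pm\epsilon_i+\tfrac m2\delta,\ \pm2\epsilon_i+m\delta\}\cup\{\pm\epsilon_i\pm\epsilon_j+m\delta : i<j\}\subset\widehat V\qquad (m\in\mathbb Z),$$ let $\mathcal W$ be the group generated by the $s_\beta$ ($\beta\in S$), and let $\mathbf t=(t_\beta)_{\beta\in S}$ be a $\mathcal W$-invariant function $S\to\mathbb C\setminus\{0\}$. Put $a_0=\delta-2\epsilon_1$, $a_i=\epsilon_i-\epsilon_{i+1}$ ($1\le i\le n-1$), $a_n=2\epsilon_n$, $t_i=t_{a_i}$, $t_i^\vee=t_{a_i^\vee}$; also write $t_f=1$ for $f\in\widehat V\setminus S$. Let $q\in\mathbb C\setminus\{0\}$ not be a root of unity, and fix a square root $q^{1/2}$. Let $\mathcal A=\mathbb C[x_1^{\pm1},\dots,x_n^{\pm1}]$,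 $x^{\mu+c\delta}=q^cx^\mu$ for $\mu\in\mathbb Z^n$, $c\in\frac12\mathbb Z$, and let $s_i=s_{a_i}$ act on $\mathcal A$ by $x^\mu\mapsto x^{s_i\mu}$. Define $T_i\in\mathrm{End}_{\mathbb C}(\mathcal A)$ for $i=0,\dots,n$ by $$T_i=t_i+t_i^{-1}v_{a_i}(x)(s_i-\mathrm{id}),\qquad v_\beta(x)=\frac{(1-t_\beta t_{\beta/2}x^{\beta/2})(1+t_\beta t_{\beta/2}^{-1}x^{\beta/2})}{1-x^\beta},$$ which reads $v_\beta=(1-t_\beta^2x^\beta)/(1-x^\beta)$ when $\beta/2\notin S$. Write $z^\lambda$ for multiplication by $x^\lambda$ and $z_i$ for multiplication by $x_i$. The double affine Hecke algebra $\mathcal H(S;\mathbf t;q)$ is the subalgebra of $\mathrm{End}_{\mathbb C}(\mathcal A)$ generated by $T_0,\dots,T_n$ and the multiplication operators by elements of $\mathcal A$. For parameters $k_0,\dots,k_n$, the Hecke relations for a tuple $(X_0,\dots,X_n)$ are: $(X_i-k_i)(X_i+k_i^{-1})=0$ for $0\le i\le n$; $X_iX_{i+1}X_iX_{i+1}=X_{i+1}X_iX_{i+1}X_i$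 for $i=0$ and $i=n-1$; $X_iX_{i+1}X_i=X_{i+1}X_iX_{i+1}$ for $1\le i\le n-2$; and $X_iX_j=X_jX_i$ for $|i-j|\ge2$. Theorem. Let $\mathcal F(\mathbf t;q)$ be the unital associative $\mathbb C$-algebra with generators $V_0^\vee,V_0,V_1,\dots,V_n,V_n^\vee$ and relations: 1. the Hecke relations with parameters $(t_0,\dots,t_n)$ for $(V_0,V_1,\dots,V_n)$; 2. the Hecke relations with parameters $(t_0^\vee,\dots,t_n^\vee)$ for $(V_0^\vee,V_1,\dots,V_{n-1},V_n^\vee)$; 3. $V_n^\vee V_nV_{n-1}\cdots V_1V_0V_0^\vee V_1V_2\cdots V_{n-1}=q^{-1/2}$ and $[V_0,V_n^\vee]=0=[V_0^\vee,V_n]$. Then $T_0$ and $T_n$ are invertible and there is an algebra isomorphism $\phi:\mathcal F(\mathbf t;q)\to\mathcal H(S;\mathbf t;q)$ with $\phi(V_i)=T_i$ for $i=0,\dots,n$, $\phi(V_0^\vee)=T_0^{-1}z^{-a_0^\vee}=q^{-1/2}T_0^{-1}z_1$ and $\phi(V_n^\vee)=z^{-a_n^\vee}T_n^{-1}=z_n^{-1}T_n^{-1}$.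 -/

import Mathlib

noncomputable section

namespace CCn

/-! ### The affine root system of type `C^∨C_n` -/

/-- The space `V̂ = V ⊕ ℝδ` of affine linear functions on `V = ℝⁿ`; the pair `(v, c)` is the
function `⟨v, ·⟩ + c`, so `δ = (0, 1)`. -/
abbrev VHat (n : ℕ) : Type := (Fin n → ℝ) × ℝ

/-- The positive semi-definite form on `V̂` with `δ` in its radical. -/
def form {n : ℕ} (f g : VHat n) : ℝ := f.1 ⬝ᵥ g.1

/-- The co-root `f^∨ = 2 f / ⟨f, f⟩`. -/
def coroot {n : ℕ} (f : VHat n) : VHat n := (2 / form f f) • f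

/-- The reflection `s_f(g) = g - ⟨g, f^∨⟩ f` (the identity if `f ∈ ℝδ`). -/
def reflection {n : ℕ} (f : VHat n) : VHat n ≃ₗ[ℝ] VHat n :=
  LinearEquiv.ofInvolutive
    { toFun := fun g => g - form g (coroot f) • f
      map_add' := fun g h => by
        simp only [form, Prod.fst_add, add_dotProduct, add_smul]; abel
      map_smul' := fun c g => by
        simp only [form, Prod.smul_fst, smul_dotProduct, smul_sub, smul_smul, smul_eq_mul,
          RingHom.id_apply] }
    (fun g => by
      by_cases h : form f f = 0
      · simp [form, coroot, show f.1 ⬝ᵥ f.1 = 0 from h]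
      · have h' : f.1 ⬝ᵥ f.1 ≠ 0 := h
        have key : form (g - form g (coroot f) • f) (coroot f) = - form g (coroot f) := by
          simp only [form, coroot, Prod.fst_sub, Prod.smul_fst, sub_dotProduct, smul_dotProduct,
            dotProduct_smul, smul_eq_mul]
          field_simp
          ring
        change (g - form g (coroot f) • f)
          - form (g - form g (coroot f) • f) (coroot f) • f = g
        rw [key, neg_smul, sub_neg_eq_add, sub_add_cancel])

/-- The basis vector `ε_j` of `Λ = ℤⁿ`, with `j = 1, …, n`. -/
def eps (n j : ℕ) : Fin n → ℤ := fun k => if (k : ℕ) + 1 = j then 1 else 0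

/-- The element `μ + (m/2) δ` of `V̂`, for `μ ∈ Λ` and `m ∈ ℤ`. -/
def toVHat {n : ℕ} (f : (Fin n → ℤ) × ℤ) : VHat n := (fun k => (f.1 k : ℝ), (f.2 : ℝ) / 2)

/-- The root system `S` of type `C^∨C_n`: the elements `±ε_i + (m/2)δ`, `±2ε_i + mδ` and
`±ε_i ± ε_j + mδ` (`i < j`), where `m ∈ ℤ`. -/
def S (n : ℕ) : Set (VHat n) :=
  {β | ∃ (i : ℕ) (e m : ℤ), 1 ≤ i ∧ i ≤ n ∧ (e = 1 ∨ e = -1) ∧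
      (β = toVHat (e • eps n i, m) ∨ β = toVHat ((2 * e) • eps n i, 2 * m))} ∪
  {β | ∃ (i j : ℕ) (e e' m : ℤ), 1 ≤ i ∧ i < j ∧ j ≤ n ∧ (e = 1 ∨ e = -1) ∧
      (e' = 1 ∨ e' = -1) ∧ β = toVHat (e • eps n i + e' • eps n j, 2 * m)}

/-- The affine Weyl group `𝒲` of `S`, as a subgroup of `GL(V̂)`. -/
def affineWeylGroup (n : ℕ) : Subgroup (VHat n ≃ₗ[ℝ] VHat n) :=
  Subgroup.closure (reflection '' S n)

/-- A multiplicity function of `S`: a `𝒲`-invariant map `S → ℂ ∖ {0}`, extended by `1` to `V̂`. -/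
structure Multiplicity (n : ℕ) where
  toFun : VHat n → ℂˣ
  invariant : ∀ w ∈ affineWeylGroup n, ∀ β ∈ S n, toFun (w β) = toFun β
  eq_one : ∀ f, f ∉ S n → toFun f = 1

/-- The simple roots `a_0 = δ - 2ε_1`, `a_i = ε_i - ε_{i+1}` (`0 < i < n`), `a_n = 2ε_n`,
as elements `(μ, m)` of `Λ ⊕ ℤ(δ/2)`. -/
def rootExp (n : ℕ) (i : Fin (n + 1)) : (Fin n → ℤ) × ℤ :=
  if (i : ℕ) = 0 then (-(2 : ℤ) • eps n 1, 2)
  else if (i : ℕ) = n then ((2 : ℤ) • eps n n, 0)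
  else (eps n i - eps n (i + 1), 0)

/-- The simple co-roots `a_0^∨ = a_0/2`, `a_i^∨ = a_i` (`0 < i < n`), `a_n^∨ = a_n/2`,
as elements `(μ, m)` of `Λ ⊕ ℤ(δ/2)`. -/
def corootExp (n : ℕ) (i : Fin (n + 1)) : (Fin n → ℤ) × ℤ :=
  if (i : ℕ) = 0 then (-eps n 1, 1)
  else if (i : ℕ) = n then (eps n n, 0)
  else (eps n i - eps n (i + 1), 0)

/-- The simple root `a_i` in `V̂`. -/
def simpleRoot (n : ℕ) (i : Fin (n + 1)) : VHat n := toVHat (rootExp n i)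

/-- The value `t_i = t_{a_i}`. -/
def Multiplicity.k {n : ℕ} (t : Multiplicity n) (i : Fin (n + 1)) : ℂˣ :=
  t.toFun (simpleRoot n i)

/-- The value `t_i^∨ = t_{a_i^∨}`. -/
def Multiplicity.kDual {n : ℕ} (t : Multiplicity n) (i : Fin (n + 1)) : ℂˣ :=
  t.toFun (coroot (simpleRoot n i))

/-- The value `t_{a_i/2}`. -/
def Multiplicity.kHalf {n : ℕ} (t : Multiplicity n) (i : Fin (n + 1)) : ℂˣ :=
  t.toFun ((1 / 2 : ℝ) • simpleRoot n i)

/-! ### The group algebra of `Λ` and the action of the simple reflections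

Throughout, `qh` is the fixed square root `q^{1/2}` of `q`. -/

/-- The group algebra `𝒜` of the weight lattice `Λ = ℤⁿ`, i.e. the Laurent polynomials in
`x_1, …, x_n`. -/
abbrev A (n : ℕ) : Type := AddMonoidAlgebra ℂ (Fin n → ℤ)

/-- The element `x^{μ + (m/2)δ} = q^{m/2} x^μ` of `𝒜`. -/
def xpow {n : ℕ} (qh : ℂˣ) (f : (Fin n → ℤ) × ℤ) : A n :=
  AddMonoidAlgebra.single f.1 ((qh ^ f.2 : ℂˣ) : ℂ)

/-- The integer `⟨μ, a_i^∨⟩`, for `μ ∈ Λ`. -/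
def pairing (n : ℕ) (i : Fin (n + 1)) (μ : Fin n → ℤ) : ℤ := μ ⬝ᵥ (corootExp n i).1

/-- The element `s_i(μ) = μ - ⟨μ, a_i^∨⟩ a_i` of `Λ ⊕ ℤδ`, for `μ ∈ Λ`. -/
def simpleReflExp (n : ℕ) (i : Fin (n + 1)) (μ : Fin n → ℤ) : (Fin n → ℤ) × ℤ :=
  (μ, 0) - pairing n i μ • rootExp n i

theorem xpow_add {n : ℕ} (qh : ℂˣ) (f g : (Fin n → ℤ) × ℤ) :
    xpow qh (f + g) = xpow qh f * xpow qh g := by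
  simp [xpow, AddMonoidAlgebra.single_mul_single, zpow_add]

theorem xpow_zero {n : ℕ} (qh : ℂˣ) : xpow qh (0 : (Fin n → ℤ) × ℤ) = 1 := by
  simp [xpow, AddMonoidAlgebra.one_def]

theorem simpleReflExp_add (n : ℕ) (i : Fin (n + 1)) (μ ν : Fin n → ℤ) :
    simpleReflExp n i (μ + ν) = simpleReflExp n i μ + simpleReflExp n i ν := by
  have h : ((μ + ν, 0) : (Fin n → ℤ) × ℤ) = (μ, 0) + (ν, 0) := by simp
  simp only [simpleReflExp, pairing, add_dotProduct, add_smul, h]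
  abel

theorem simpleReflExp_zero (n : ℕ) (i : Fin (n + 1)) : simpleReflExp n i 0 = 0 := by
  simp [simpleReflExp, pairing]

/-- The action `x^μ ↦ x^{s_i μ}` of the simple reflection `s_i` on `𝒜`. Explicitly,
`(s_0 f)(x) = f(q x_1⁻¹, x_2, …, x_n)`, while `s_i` (`0 < i < n`) interchanges `x_i` and
`x_{i+1}`, and `s_n` inverts `x_n`. -/
def sAct (n : ℕ) (qh : ℂˣ) (i : Fin (n + 1)) : A n →ₐ[ℂ] A n :=
  AddMonoidAlgebra.lift ℂ (A n) (Fin n → ℤ)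
    { toFun := fun μ => xpow qh (simpleReflExp n i μ.toAdd)
      map_one' := by simp [simpleReflExp_zero, xpow_zero]
      map_mul' := fun μ ν => by simp [simpleReflExp_add, xpow_add] }

theorem sAct_single (n : ℕ) (qh : ℂˣ) (i : Fin (n + 1)) (μ : Fin n → ℤ) (c : ℂ) :
    sAct n qh i (AddMonoidAlgebra.single μ c) = c • xpow qh (simpleReflExp n i μ) := by
  simp [sAct, AddMonoidAlgebra.lift_single]

/-! ### The difference-reflection operators -/

theorem rootExp_fst_ne_zero {n : ℕ} (hn : 2 ≤ n) (i : Fin (n + 1)) : (rootExp n i).1 ≠ 0 := by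
  intro h
  unfold rootExp at h
  split_ifs at h with h0 h1
  · have := congrFun h ⟨0, by omega⟩
    simp [eps] at this
  · have := congrFun h ⟨n - 1, by omega⟩
    simp [eps, show n - 1 + 1 = n by omega] at this
  · have := congrFun h ⟨i - 1, by omega⟩
    simp [eps, show (i : ℕ) - 1 + 1 = i by omega] at this

theorem one_sub_xpow_ne_zero {n : ℕ} (hn : 2 ≤ n) (qh : ℂˣ) (i : Fin (n + 1)) :
    1 - xpow qh (rootExp n i) ≠ 0 := by
  intro h
  have h1 := congrArg (fun f : A n => f.coeff (rootExp n i).1) h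
  simp [xpow, AddMonoidAlgebra.one_def, Ne.symm (rootExp_fst_ne_zero hn i)] at h1
  exact (qh ^ (rootExp n i).2).ne_zero (by simpa using h1)

theorem one_sub_dvd_xpow_zsmul {n : ℕ} (qh : ℂˣ) (f : (Fin n → ℤ) × ℤ) (k : ℤ) :
    1 - xpow qh f ∣ xpow qh (k • f) - 1 := by
  have hnat : ∀ m : ℕ, 1 - xpow qh f ∣ xpow qh ((m : ℤ) • f) - 1 := by
    intro m
    induction m with
    | zero => simp [xpow_zero]
    | succ m ih =>
      have : xpow qh (((m + 1 : ℕ) : ℤ) • f) - 1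
          = xpow qh f * (xpow qh ((m : ℤ) • f) - 1) - (1 - xpow qh f) := by
        rw [Nat.cast_succ, add_smul, one_smul, xpow_add]; ring
      rw [this]
      exact dvd_sub (ih.mul_left _) dvd_rfl
  obtain ⟨m, rfl | rfl⟩ := k.eq_nat_or_neg
  · exact hnat m
  · have h : xpow qh ((-(m : ℤ)) • f) - 1
        = - (xpow qh ((-(m : ℤ)) • f) * (xpow qh ((m : ℤ) • f) - 1)) := by
      have : xpow qh ((-(m : ℤ)) • f) * xpow qh ((m : ℤ) • f) = 1 := by
        rw [← xpow_add, ← add_smul, neg_add_cancel, zero_smul, xpow_zero]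
      rw [mul_sub, this]; ring
    rw [h]
    exact (dvd_neg).2 ((hnat m).mul_left _)

theorem exists_divDiff (n : ℕ) (qh : ℂˣ) (i : Fin (n + 1)) (f : A n) :
    ∃ g : A n, sAct n qh i f - f = (1 - xpow qh (rootExp n i)) * g := by
  change (1 - xpow qh (rootExp n i)) ∣ sAct n qh i f - f
  induction f using AddMonoidAlgebra.induction_linear with
  | zero => simp
  | add f g hf hg =>
    have : sAct n qh i (f + g) - (f + g) = (sAct n qh i f - f) + (sAct n qh i g - g) := by
      rw [map_add]; ring
    rw [this]
    exact dvd_add hf hg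
  | single μ c =>
    have : sAct n qh i (AddMonoidAlgebra.single μ c) - AddMonoidAlgebra.single μ c
        = AddMonoidAlgebra.single μ c
          * (xpow qh ((-pairing n i μ) • rootExp n i) - 1) := by
      have h1 : (AddMonoidAlgebra.single μ c : A n) = c • xpow qh (μ, 0) := by simp [xpow]
      rw [sAct_single, simpleReflExp, sub_eq_add_neg (μ, 0), ← neg_smul, xpow_add, h1, mul_sub,
        mul_one, smul_mul_assoc]
    rw [this]
    exact (one_sub_dvd_xpow_zsmul _ _ _).mul_left _

/-- The divided difference `f ↦ (s_i f - f) / (1 - x^{a_i})` on `𝒜`. -/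
def divDiff {n : ℕ} (hn : 2 ≤ n) (qh : ℂˣ) (i : Fin (n + 1)) : A n →ₗ[ℂ] A n where
  toFun f := (exists_divDiff n qh i f).choose
  map_add' f g := by
    apply mul_left_cancel₀ (one_sub_xpow_ne_zero hn qh i)
    rw [mul_add, ← (exists_divDiff n qh i (f + g)).choose_spec,
      ← (exists_divDiff n qh i f).choose_spec, ← (exists_divDiff n qh i g).choose_spec, map_add]
    ring
  map_smul' c f := by
    apply mul_left_cancel₀ (one_sub_xpow_ne_zero hn qh i)
    rw [RingHom.id_apply, mul_smul_comm, ← (exists_divDiff n qh i (c • f)).choose_spec,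
      ← (exists_divDiff n qh i f).choose_spec, map_smul, smul_sub]

theorem divDiff_spec {n : ℕ} (hn : 2 ≤ n) (qh : ℂˣ) (i : Fin (n + 1)) (f : A n) :
    (1 - xpow qh (rootExp n i)) * divDiff hn qh i f = sAct n qh i f - f :=
  (exists_divDiff n qh i f).choose_spec.symm

/-- The numerator of `v_{a_i}`, i.e. `v_{a_i} = vNum / (1 - x^{a_i})`, where
`v_β = (1 - t_β t_{β/2} x^{β/2}) (1 + t_β t_{β/2}⁻¹ x^{β/2}) / (1 - x^β)`; if `β/2 ∉ S` (that is,
`β = a_i` with `0 < i < n`) then `t_{β/2} = 1` and `v_β = (1 - t_β² x^β) / (1 - x^β)`. Note that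
`a_i/2 = a_i^∨` for `i = 0, n`. -/
def vNum {n : ℕ} (t : Multiplicity n) (qh : ℂˣ) (i : Fin (n + 1)) : A n :=
  if (i : ℕ) = 0 ∨ (i : ℕ) = n then
    (1 - ((t.k i * t.kHalf i : ℂˣ) : ℂ) • xpow qh (corootExp n i)) *
      (1 + ((t.k i * (t.kHalf i)⁻¹ : ℂˣ) : ℂ) • xpow qh (corootExp n i))
  else 1 - ((t.k i ^ 2 : ℂˣ) : ℂ) • xpow qh (rootExp n i)

/-- Multiplication by an element of `𝒜`, as an operator on `𝒜`. -/
def mulOp {n : ℕ} (f : A n) : Module.End ℂ (A n) := LinearMap.mulLeft ℂ f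

/-- The difference-reflection operator `T_i = t_i + t_i⁻¹ v_{a_i}(x) (s_i - id)` on `𝒜`. -/
def T {n : ℕ} (hn : 2 ≤ n) (t : Multiplicity n) (qh : ℂˣ) (i : Fin (n + 1)) :
    Module.End ℂ (A n) :=
  (t.k i : ℂ) • 1 + (((t.k i)⁻¹ : ℂˣ) : ℂ) • (mulOp (vNum t qh i) * divDiff hn qh i)

/-- The double affine Hecke algebra `ℋ(S; t; q)`: the subalgebra of `End_ℂ(𝒜)` generated by
`T_0, …, T_n` and the multiplication operators by elements of `𝒜`. -/
def DAHA {n : ℕ} (hn : 2 ≤ n) (t : Multiplicity n) (qh : ℂˣ) : Subalgebra ℂ (Module.End ℂ (A n)) :=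
  Algebra.adjoin ℂ (Set.range (T hn t qh) ∪ Set.range mulOp)

/-! ### The algebra `ℱ(t; q)` -/

/-- The defining relations of the affine Hecke algebra of type `C̃_n` with parameters
`k_0, …, k_n`, for an `(n+1)`-tuple of elements of an algebra. -/
inductive HeckeRel {n : ℕ} {B : Type} [Ring B] [Algebra ℂ B] (k : Fin (n + 1) → ℂˣ)
    (X : Fin (n + 1) → B) : B → B → Prop
  | quadratic (i : Fin (n + 1)) :
      HeckeRel k X ((X i - algebraMap ℂ B (k i)) * (X i + algebraMap ℂ B ((k i)⁻¹ : ℂˣ))) 0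
  | braid_four (i j : Fin (n + 1)) (hj : (j : ℕ) = i + 1) (hi : (i : ℕ) = 0 ∨ (i : ℕ) + 1 = n) :
      HeckeRel k X (X i * X j * X i * X j) (X j * X i * X j * X i)
  | braid_three (i j : Fin (n + 1)) (hj : (j : ℕ) = i + 1) (hi : 1 ≤ (i : ℕ))
      (hi' : (i : ℕ) + 2 ≤ n) :
      HeckeRel k X (X i * X j * X i) (X j * X i * X j)
  | comm (i j : Fin (n + 1)) (hij : (i : ℕ) + 2 ≤ j) : HeckeRel k X (X i * X j) (X j * X i)

/-- The generators `V_0, …, V_n`, `V_0^∨` and `V_n^∨`. -/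
inductive Gen (n : ℕ) : Type
  | V (i : Fin (n + 1)) : Gen n
  | V0dual : Gen n
  | Vndual : Gen n

/-- The tuple `(V_0, V_1, …, V_n)`. -/
def tuple (n : ℕ) (i : Fin (n + 1)) : FreeAlgebra ℂ (Gen n) := FreeAlgebra.ι ℂ (Gen.V i)

/-- The tuple `(V_0^∨, V_1, …, V_{n-1}, V_n^∨)`. -/
def tupleDual (n : ℕ) (i : Fin (n + 1)) : FreeAlgebra ℂ (Gen n) :=
  FreeAlgebra.ι ℂ (if (i : ℕ) = 0 then Gen.V0dual else if (i : ℕ) = n then Gen.Vndual else Gen.V i)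

/-- The product `V_n^∨ (V_n V_{n-1} ⋯ V_0) V_0^∨ (V_1 V_2 ⋯ V_{n-1})`. -/
def cyclicProduct (n : ℕ) : FreeAlgebra ℂ (Gen n) :=
  FreeAlgebra.ι ℂ Gen.Vndual * ((List.finRange (n + 1)).reverse.map (tuple n)).prod *
    FreeAlgebra.ι ℂ Gen.V0dual *
    ((List.finRange (n - 1)).map fun i : Fin (n - 1) => tuple n ⟨(i : ℕ) + 1, by omega⟩).prod

/-- The defining relations of `ℱ(t; q)`. -/
inductive FRel {n : ℕ} (t : Multiplicity n) (qh : ℂˣ) :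
    FreeAlgebra ℂ (Gen n) → FreeAlgebra ℂ (Gen n) → Prop
  | hecke (a b : FreeAlgebra ℂ (Gen n)) (h : HeckeRel t.k (tuple n) a b) : FRel t qh a b
  | heckeDual (a b : FreeAlgebra ℂ (Gen n)) (h : HeckeRel t.kDual (tupleDual n) a b) :
      FRel t qh a b
  | cyclic : FRel t qh (cyclicProduct n) (algebraMap ℂ _ ((qh⁻¹ : ℂˣ) : ℂ))
  | comm_zero : FRel t qh (FreeAlgebra.ι ℂ (Gen.V 0) * FreeAlgebra.ι ℂ Gen.Vndual)
      (FreeAlgebra.ι ℂ Gen.Vndual * FreeAlgebra.ι ℂ (Gen.V 0))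
  | comm_last : FRel t qh (FreeAlgebra.ι ℂ Gen.V0dual * FreeAlgebra.ι ℂ (Gen.V (Fin.last n)))
      (FreeAlgebra.ι ℂ (Gen.V (Fin.last n)) * FreeAlgebra.ι ℂ Gen.V0dual)

/-- The algebra `ℱ(t; q)` given by generators and relations. -/
abbrev F {n : ℕ} (t : Multiplicity n) (qh : ℂˣ) : Type := RingQuot (FRel t qh)

/-- The image of a generator in `ℱ(t; q)`. -/
def gen {n : ℕ} (t : Multiplicity n) (qh : ℂˣ) (g : Gen n) : F t qh :=
  RingQuot.mkAlgHom ℂ (FRel t qh) (FreeAlgebra.ι ℂ g)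

end CCn

end

open CCn

noncomputable section

namespace CCn

/-! The map is the polynomial representation `polyRep`. It exists because the operators `T_i`,
`T_0⁻¹x^{-a_0^∨}` and `x^{-a_n^∨}T_n⁻¹` satisfy the relations of `F` (`isFTuple_T`), and its image
is the double affine Hecke algebra (`polyRep_range`). The substance is injectivity, which is a
Poincaré–Birkhoff–Witt argument: a spanning set of `F` indexed by `x^μ` and affine Weyl group
elements `w` is carried to a linearly independent family.

Spanning (`pbw_surjective`). Put `z_1 = q^{1/2}V_0V_0^∨` and `z_{k+1} = V_k z_k V_k`. The cyclic
relation says that `V_n^∨ V_n z_n = 1`, so each `z_k` is a word in the generators on its left and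
also a word in the inverses of those on its right. Having both words makes the `z_k` commute with
each other and with the distant `V_i`. The quadratic relations give cross relations `V_i f(z) = (s_i
f)(z)V_i + g(z)`, which move every `z` to the left, so the products `z^μ V_w` span.

Independence (`pbw_operators_independent`). In the field of fractions, `T_i = t_i - c_i + c_i s_i`
with a nonzero rational function `c_i`. Hence `T_w` is a combination of group elements, triangular
for the length, with nonzero leading coefficient. The group elements act through pairwise distinct
characters of `𝒜`, because `q` is not a root of unity, and distinct characters are independent over
the field.

The affine Weyl group is never built as a Coxeter group. Its elements are represented by integer
points `P` in regular position, and `V_w` is defined by walking from `P` to the fundamental alcove.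
That the path does not matter (`walk_of_neg`) replaces the theorem on reduced words. -/

/-! ### Rank-two braid relations reduced to one scalar identity -/

/-- Here `T = t - b + b s` and `U = u - c + c r`, with coefficients transported by the dihedral
group of order 8. For an end node with short co-root `α` and its neighbour with co-root `β`, the
values `b, b', c, c'` belong to `α`, `α+β`, `β`, `2α+β`. Replacing a co-root by its negative turns
`b` into `t + t' - b`, where `t' = t⁻¹`. All that the braid relation asks of these values is the
identity `R`. -/
theorem braid_four_of_eval {M K : Type*} [Field K] [CharZero K] (T U s r : M → M) (ι : M → K)
    (t t' u u' b b' c c' : K)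
    (hs : ∀ f, s (s f) = f) (hr : ∀ f, r (r f) = f)
    (hsr : ∀ f, s (r (s (r f))) = r (s (r (s f))))
    (T1 : ∀ f, ι (T f) = (t - b) * ι f + b * ι (s f))
    (Ts : ∀ f, ι (s (T f)) = (t - (t + t' - b)) * ι (s f) + (t + t' - b) * ι (s (s f)))
    (Tr : ∀ f, ι (r (T f)) = (t - b') * ι (r f) + b' * ι (r (s f)))
    (Tsr : ∀ f, ι (s (r (T f))) = (t - b') * ι (s (r f)) + b' * ι (s (r (s f))))
    (Trs : ∀ f, ι (r (s (T f))) =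
      (t - (t + t' - b')) * ι (r (s f)) + (t + t' - b') * ι (r (s (s f))))
    (Trsr : ∀ f, ι (r (s (r (T f)))) = (t - b) * ι (r (s (r f))) + b * ι (r (s (r (s f)))))
    (U1 : ∀ f, ι (U f) = (u - c) * ι f + c * ι (r f))
    (Us : ∀ f, ι (s (U f)) = (u - c') * ι (s f) + c' * ι (s (r f)))
    (Ur : ∀ f, ι (r (U f)) = (u - (u + u' - c)) * ι (r f) + (u + u' - c) * ι (r (r f)))
    (Usr : ∀ f, ι (s (r (U f))) =
      (u - (u + u' - c')) * ι (s (r f)) + (u + u' - c') * ι (s (r (r f))))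
    (Urs : ∀ f, ι (r (s (U f))) = (u - c') * ι (r (s f)) + c' * ι (r (s (r f))))
    (Usrs : ∀ f, ι (s (r (s (U f)))) = (u - c) * ι (s (r (s f))) + c * ι (s (r (s (r f)))))
    (R : (2 * b - (t + t')) * (c - c') - (2 * b' - (t + t')) * (c + c' - (u + u')) +
      (u' - u) * (t' - t) = 0) (f : M) :
    ι (T (U (T (U f)))) = ι (U (T (U (T f)))) := by
  -- Both sides become combinations of the values of `ι` at the dihedral translates of `f`; the
  -- difference is a multiple of `R`. The factor `1/2` is why characteristic zero is assumed.
  simp only [T1, Ts, Tr, Tsr, Trs, Trsr, U1, Us, Ur, Usr, Urs, Usrs, hs, hr, hsr]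
  linear_combination (1 / 2) * ((b' * c - b * c) * ι (r f) + (b * c - b * c') * ι (s f)
    - b' * c * ι (r (s f)) + b * c' * ι (s (r f))) * R

/-- The same reduction for a simple edge: `b`, `c`, `d` are the coefficients at `α`, `β`, `α+β`,
with a common parameter `u` and `u' = u⁻¹`. -/
theorem braid_three_of_eval {M K : Type*} [Field K] (T U s r : M → M) (ι : M → K)
    (u u' b c d : K)
    (hs : ∀ f, s (s f) = f) (hr : ∀ f, r (r f) = f)
    (hsr : ∀ f, s (r (s f)) = r (s (r f)))
    (T1 : ∀ f, ι (T f) = (u - b) * ι f + b * ι (s f))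
    (Ts : ∀ f, ι (s (T f)) = (u - (u + u' - b)) * ι (s f) + (u + u' - b) * ι (s (s f)))
    (Tr : ∀ f, ι (r (T f)) = (u - d) * ι (r f) + d * ι (r (s f)))
    (Tsr : ∀ f, ι (s (r (T f))) = (u - c) * ι (s (r f)) + c * ι (s (r (s f))))
    (U1 : ∀ f, ι (U f) = (u - c) * ι f + c * ι (r f))
    (Us : ∀ f, ι (s (U f)) = (u - d) * ι (s f) + d * ι (s (r f)))
    (Ur : ∀ f, ι (r (U f)) = (u - (u + u' - c)) * ι (r f) + (u + u' - c) * ι (r (r f)))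
    (Urs : ∀ f, ι (r (s (U f))) = (u - b) * ι (r (s f)) + b * ι (r (s (r f))))
    (R : b * c - d * (b + c - (u + u')) - u * u' = 0) (f : M) :
    ι (T (U (T f))) = ι (U (T (U f))) := by
  simp only [T1, Ts, Tr, Tsr, U1, Us, Ur, Urs, hs, hr, hsr]
  linear_combination ((c - b) * ι f - c * ι (r f) + b * ι (s f)) * R

/-! ### Simple roots, co-roots and reflections in `Λ ⊕ ℤ(δ/2)` -/

theorem eps_succ (n : ℕ) (j : Fin n) : eps n (j + 1) = Pi.single j 1 := by
  ext k
  simp [eps, Pi.single_apply, Fin.ext_iff]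

theorem corootExp_zero {n : ℕ} (hn : 2 ≤ n) :
    corootExp n 0 = (-Pi.single ⟨0, by omega⟩ 1, 1) := by
  simp [corootExp, ← eps_succ]

theorem corootExp_last {n : ℕ} (hn : 2 ≤ n) :
    corootExp n (Fin.last n) = (Pi.single ⟨n - 1, by omega⟩ 1, 0) := by
  have : n - 1 + 1 = n := by omega
  simp [corootExp, ← eps_succ, this, show n ≠ 0 by omega]

theorem corootExp_mid {n : ℕ} (i : Fin (n + 1)) (h0 : 0 < (i : ℕ)) (h1 : (i : ℕ) < n) :
    corootExp n i = (Pi.single ⟨i - 1, by omega⟩ 1 - Pi.single ⟨i, h1⟩ 1, 0) := by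
  have : (i : ℕ) - 1 + 1 = i := by omega
  simp [corootExp, ← eps_succ, this, h0.ne', h1.ne]

theorem rootExp_eq_two_smul {n : ℕ} (i : Fin (n + 1)) (h : (i : ℕ) = 0 ∨ (i : ℕ) = n) :
    rootExp n i = (2 : ℤ) • corootExp n i := by
  unfold rootExp corootExp
  split_ifs <;> simp_all

theorem rootExp_zero (n : ℕ) : rootExp n 0 = (2 : ℤ) • corootExp n 0 :=
  rootExp_eq_two_smul 0 (by simp)

theorem rootExp_last (n : ℕ) : rootExp n (Fin.last n) = (2 : ℤ) • corootExp n (Fin.last n) :=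
  rootExp_eq_two_smul _ (by simp)

theorem rootExp_mid {n : ℕ} (i : Fin (n + 1)) (h0 : 0 < (i : ℕ)) (h1 : (i : ℕ) < n) :
    rootExp n i = corootExp n i := by
  simp [rootExp, corootExp, h0.ne', h1.ne]

theorem pairing_zero {n : ℕ} (hn : 2 ≤ n) (μ : Fin n → ℤ) :
    pairing n 0 μ = -μ ⟨0, by omega⟩ := by
  simp [pairing, corootExp_zero hn]

theorem pairing_last {n : ℕ} (hn : 2 ≤ n) (μ : Fin n → ℤ) :
    pairing n (Fin.last n) μ = μ ⟨n - 1, by omega⟩ := by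
  simp [pairing, corootExp_last hn]

theorem pairing_mid {n : ℕ} (i : Fin (n + 1)) (h0 : 0 < (i : ℕ)) (h1 : (i : ℕ) < n)
    (μ : Fin n → ℤ) : pairing n i μ = μ ⟨i - 1, by omega⟩ - μ ⟨i, h1⟩ := by
  simp [pairing, corootExp_mid i h0 h1, dotProduct_sub]

theorem simple_index_cases {n : ℕ} (i : Fin (n + 1)) :
    i = 0 ∨ i = Fin.last n ∨ (0 < (i : ℕ) ∧ (i : ℕ) < n) := by
  have := i.2
  simp only [Fin.ext_iff, Fin.val_zero, Fin.val_last]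
  omega

theorem pairing_add {n : ℕ} (i : Fin (n + 1)) (μ ν : Fin n → ℤ) :
    pairing n i (μ + ν) = pairing n i μ + pairing n i ν := by
  simp [pairing, add_dotProduct]

theorem pairing_zsmul {n : ℕ} (i : Fin (n + 1)) (m : ℤ) (μ : Fin n → ℤ) :
    pairing n i (m • μ) = m * pairing n i μ := by
  rw [pairing, smul_dotProduct, smul_eq_mul, pairing]

theorem pairing_sub {n : ℕ} (i : Fin (n + 1)) (μ ν : Fin n → ℤ) :
    pairing n i (μ - ν) = pairing n i μ - pairing n i ν := by
  simp [pairing, sub_dotProduct]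

/-- The integer `⟨a_i, a_j^∨⟩`. -/
def cartan (n : ℕ) (i j : Fin (n + 1)) : ℤ := pairing n j (rootExp n i).1

theorem cartan_self {n : ℕ} (hn : 2 ≤ n) (i : Fin (n + 1)) : cartan n i i = 2 := by
  rcases simple_index_cases i with rfl | rfl | ⟨h0, h1⟩
  · simp [cartan, rootExp_zero, pairing_zero hn, corootExp_zero hn]
  · simp [cartan, rootExp_last, pairing_last hn, corootExp_last hn]
  · have : (i : ℕ) - 1 ≠ i := by omega
    simp [cartan, rootExp_mid i h0 h1, pairing_mid i h0 h1, corootExp_mid i h0 h1,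
      this, this.symm]

theorem cartan_far {n : ℕ} (hn : 2 ≤ n) {i j : Fin (n + 1)} (hij : (i : ℕ) + 2 ≤ j) :
    cartan n i j = 0 ∧ cartan n j i = 0 := by
  rcases simple_index_cases i with rfl | rfl | ⟨h0, h1⟩
  · rcases simple_index_cases j with rfl | rfl | ⟨h2, h3⟩
    · simp at hij
    · have : n - 1 ≠ 0 := by omega
      simp [cartan, rootExp_zero, rootExp_last, pairing_last hn, pairing_zero hn, corootExp_last hn,
        corootExp_zero hn, this, this.symm]
    · have a1 : (j : ℕ) - 1 ≠ 0 := by simp at hij; omega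
      have a2 : (j : ℕ) ≠ 0 := by omega
      simp [cartan, rootExp_zero, pairing_mid j h2 h3, pairing_zero hn,
        corootExp_mid j h2 h3, rootExp_mid j h2 h3,
        corootExp_zero hn, a1, a2, a1.symm, a2.symm]
  · have := j.2
    simp at hij; omega
  · rcases simple_index_cases j with rfl | rfl | ⟨h2, h3⟩
    · simp at hij
    · simp only [Fin.val_last] at hij
      have a1 : (i : ℕ) - 1 ≠ n - 1 := by omega
      have a2 : (i : ℕ) ≠ n - 1 := by omega
      simp [cartan, rootExp_last, pairing_mid i h0 h1, pairing_last hn,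
        corootExp_mid i h0 h1, rootExp_mid i h0 h1,
        corootExp_last hn, a1, a2, a1.symm, a2.symm]
    · have a1 : (i : ℕ) - 1 ≠ j - 1 := by omega
      have a2 : (i : ℕ) ≠ j - 1 := by omega
      have a3 : (i : ℕ) - 1 ≠ j := by omega
      have a4 : (i : ℕ) ≠ j := by omega
      simp [cartan, pairing_mid i h0 h1, pairing_mid j h2 h3,
        corootExp_mid i h0 h1, rootExp_mid i h0 h1, corootExp_mid j h2 h3, rootExp_mid j h2 h3,
        a1, a2, a1.symm, a2.symm, a3, a3.symm, a4, a4.symm]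

theorem cartan_three {n : ℕ} {i j : Fin (n + 1)} (hij : (j : ℕ) = i + 1) (hi : 1 ≤ (i : ℕ))
    (hi' : (i : ℕ) + 2 ≤ n) : cartan n i j = -1 ∧ cartan n j i = -1 := by
  have h0 : 0 < (i : ℕ) := hi
  have h1 : (i : ℕ) < n := by omega
  have h2 : 0 < (j : ℕ) := by omega
  have h3 : (j : ℕ) < n := by omega
  have a1 : (i : ℕ) - 1 ≠ j - 1 := by omega
  have a2 : (i : ℕ) = j - 1 := by omega
  have a3 : (i : ℕ) - 1 ≠ j := by omega
  have a4 : (i : ℕ) ≠ j := by omega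
  simp [cartan, pairing_mid i h0 h1, pairing_mid j h2 h3,
    corootExp_mid i h0 h1, rootExp_mid i h0 h1, corootExp_mid j h2 h3, rootExp_mid j h2 h3,
    Pi.single_apply, ← a2, a3, a3.symm, a4, a4.symm]
  omega

theorem cartan_zero_one {n : ℕ} (hn : 2 ≤ n) {j : Fin (n + 1)} (hj : (j : ℕ) = 1) :
    cartan n 0 j = -2 ∧ cartan n j 0 = -1 := by
  have h2 : 0 < (j : ℕ) := by omega
  have h3 : (j : ℕ) < n := by omega
  simp [cartan, pairing_zero hn, pairing_mid j h2 h3, rootExp_zero,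
    corootExp_zero hn, corootExp_mid j h2 h3, rootExp_mid j h2 h3, hj]

theorem cartan_last {n : ℕ} (hn : 2 ≤ n) {i : Fin (n + 1)} (hi : (i : ℕ) + 1 = n) :
    cartan n (Fin.last n) i = -2 ∧ cartan n i (Fin.last n) = -1 := by
  have h2 : 0 < (i : ℕ) := by omega
  have h3 : (i : ℕ) < n := by omega
  have a1 : (i : ℕ) = n - 1 := by omega
  have a2 : n - 1 - 1 ≠ n - 1 := by omega
  simp [cartan, pairing_last hn, pairing_mid i h2 h3, rootExp_last,
    corootExp_last hn, corootExp_mid i h2 h3, rootExp_mid i h2 h3, a1, a2, a2.symm]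

/-- The pairs of nodes joined by a double edge of the affine Dynkin diagram of type `C̃_n`, with
the end node first. -/
def IsDoubleEdge (n : ℕ) (i j : Fin (n + 1)) : Prop :=
  (i = 0 ∧ (j : ℕ) = 1) ∨ (i = Fin.last n ∧ (j : ℕ) + 1 = n)

/-- The pairs of nodes joined by a simple edge of the affine Dynkin diagram of type `C̃_n`. -/
def IsSimpleEdge (n : ℕ) (i j : Fin (n + 1)) : Prop :=
  (j : ℕ) = i + 1 ∧ 1 ≤ (i : ℕ) ∧ (i : ℕ) + 2 ≤ n

theorem IsDoubleEdge.end_node {n : ℕ} {i j : Fin (n + 1)} (h : IsDoubleEdge n i j) :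
    (i : ℕ) = 0 ∨ (i : ℕ) = n := by
  rcases h with ⟨rfl, -⟩ | ⟨rfl, -⟩ <;> simp

theorem IsDoubleEdge.mid_node {n : ℕ} (hn : 2 ≤ n) {i j : Fin (n + 1)} (h : IsDoubleEdge n i j) :
    0 < (j : ℕ) ∧ (j : ℕ) < n := by
  rcases h with ⟨-, h⟩ | ⟨-, h⟩ <;> omega

theorem IsDoubleEdge.cartan {n : ℕ} (hn : 2 ≤ n) {i j : Fin (n + 1)} (h : IsDoubleEdge n i j) :
    cartan n i j = -2 ∧ cartan n j i = -1 := by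
  rcases h with ⟨rfl, h⟩ | ⟨rfl, h⟩
  · exact cartan_zero_one hn h
  · exact cartan_last hn h

theorem IsSimpleEdge.cartan {n : ℕ} {i j : Fin (n + 1)} (h : IsSimpleEdge n i j) :
    cartan n i j = -1 ∧ cartan n j i = -1 :=
  cartan_three h.1 h.2.1 h.2.2

theorem node_pair_cases {n : ℕ} {i j : Fin (n + 1)} (hij : (i : ℕ) < j) :
    (i : ℕ) + 2 ≤ j ∨ IsSimpleEdge n i j ∨ IsDoubleEdge n i j ∨ IsDoubleEdge n j i := by
  have := j.2
  simp only [IsSimpleEdge, IsDoubleEdge, Fin.ext_iff, Fin.val_zero, Fin.val_last]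
  omega

/-- The simple reflection `s_i` on `Λ ⊕ ℤ(δ/2)`. -/
def reflExp (n : ℕ) (i : Fin (n + 1)) : (Fin n → ℤ) × ℤ →+ (Fin n → ℤ) × ℤ where
  toFun f := f - pairing n i f.1 • rootExp n i
  map_zero' := by simp [pairing]
  map_add' f g := by
    simp only [Prod.fst_add, pairing_add, add_smul]; abel

theorem reflExp_apply {n : ℕ} (i : Fin (n + 1)) (f : (Fin n → ℤ) × ℤ) :
    reflExp n i f = f - pairing n i f.1 • rootExp n i := rfl

theorem reflExp_rootExp {n : ℕ} (i j : Fin (n + 1)) :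
    reflExp n i (rootExp n j) = rootExp n j - cartan n j i • rootExp n i := rfl

theorem pairing_reflExp {n : ℕ} (i j : Fin (n + 1)) (f : (Fin n → ℤ) × ℤ) :
    pairing n j (reflExp n i f).1 = pairing n j f.1 - pairing n i f.1 * cartan n i j := by
  simp only [reflExp_apply, Prod.fst_sub, Prod.smul_fst, pairing_sub, pairing_zsmul, cartan]

theorem reflExp_reflExp {n : ℕ} (hn : 2 ≤ n) (i : Fin (n + 1)) (f : (Fin n → ℤ) × ℤ) :
    reflExp n i (reflExp n i f) = f := by
  rw [reflExp_apply, pairing_reflExp, cartan_self hn, reflExp_apply]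
  module

theorem reflExp_comm {n : ℕ} (hn : 2 ≤ n) {i j : Fin (n + 1)} (hij : (i : ℕ) + 2 ≤ j)
    (f : (Fin n → ℤ) × ℤ) : reflExp n i (reflExp n j f) = reflExp n j (reflExp n i f) := by
  obtain ⟨h1, h2⟩ := cartan_far hn hij
  rw [cartan] at h1 h2
  simp only [reflExp_apply, Prod.fst_sub, Prod.smul_fst, pairing_sub, pairing_zsmul, h1, h2]
  module

/-- Only the Cartan integers enter: once they are substituted, both sides are the same combination
of `f`, `a_i`, `a_j`. -/
theorem reflExp_braid_three {n : ℕ} (hn : 2 ≤ n) {i j : Fin (n + 1)} (hij : IsSimpleEdge n i j)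
    (f : (Fin n → ℤ) × ℤ) :
    reflExp n i (reflExp n j (reflExp n i f)) = reflExp n j (reflExp n i (reflExp n j f)) := by
  obtain ⟨h1, h2⟩ := hij.cartan
  have h3 := cartan_self hn i
  have h4 := cartan_self hn j
  rw [cartan] at h1 h2 h3 h4
  simp only [reflExp_apply, Prod.fst_sub, Prod.smul_fst, pairing_sub, pairing_zsmul, h1, h2, h3,
    h4]
  module

theorem reflExp_braid_four {n : ℕ} (hn : 2 ≤ n) {i j : Fin (n + 1)} (hij : IsDoubleEdge n i j)
    (f : (Fin n → ℤ) × ℤ) :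
    reflExp n i (reflExp n j (reflExp n i (reflExp n j f))) =
      reflExp n j (reflExp n i (reflExp n j (reflExp n i f))) := by
  obtain ⟨h1, h2⟩ := hij.cartan hn
  have h3 := cartan_self hn i
  have h4 := cartan_self hn j
  rw [cartan] at h1 h2 h3 h4
  simp only [reflExp_apply, Prod.fst_sub, Prod.smul_fst, pairing_sub, pairing_zsmul, h1, h2, h3,
    h4]
  module

/-! ### Points, and their reduction to the fundamental alcove -/

/-- The value of `(n + 1)(2μ + mδ)` at the point `P / (2n + 2)` of `V`. -/
def evalAt {n : ℕ} (P : Fin n → ℤ) (f : (Fin n → ℤ) × ℤ) : ℤ := f.1 ⬝ᵥ P + f.2 * (n + 1)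

/-- The simple reflection `s_i` on points. -/
def reflPt (n : ℕ) (i : Fin (n + 1)) (P : Fin n → ℤ) : Fin n → ℤ :=
  P - evalAt P (rootExp n i) • (corootExp n i).1

/-- The interior point `(n, …, 1) / (2n + 2)` of the fundamental alcove. -/
def basePt (n : ℕ) (k : Fin n) : ℤ := n - k

theorem evalAt_zsmul {n : ℕ} (P : Fin n → ℤ) (m : ℤ) (f : (Fin n → ℤ) × ℤ) :
    evalAt P (m • f) = m * evalAt P f := by
  simp only [evalAt, Prod.smul_fst, Prod.smul_snd, smul_dotProduct, smul_eq_mul]; ring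

theorem evalAt_sub {n : ℕ} (P : Fin n → ℤ) (f g : (Fin n → ℤ) × ℤ) :
    evalAt P (f - g) = evalAt P f - evalAt P g := by
  simp only [evalAt, Prod.fst_sub, Prod.snd_sub, sub_dotProduct]; ring

/-- The actions on points and on affine functions are adjoint. Since a point is determined by its
evaluations, involutivity and braid relations pass from `reflExp` to `reflPt`; the order of
composition is reversed, which leaves these relations unchanged. -/
theorem evalAt_reflPt {n : ℕ} (i : Fin (n + 1)) (P : Fin n → ℤ) (f : (Fin n → ℤ) × ℤ) :
    evalAt (reflPt n i P) f = evalAt P (reflExp n i f) := by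
  rw [reflExp_apply, evalAt_sub, evalAt_zsmul]
  simp only [evalAt, reflPt, dotProduct_sub, dotProduct_smul, pairing, smul_eq_mul]
  ring

theorem evalAt_single {n : ℕ} (P : Fin n → ℤ) (k : Fin n) :
    evalAt P (Pi.single k 1, 0) = P k := by
  simp [evalAt]

theorem evalAt_injective {n : ℕ} {P Q : Fin n → ℤ} (h : ∀ f, evalAt P f = evalAt Q f) :
    P = Q := by
  ext k
  simpa only [evalAt_single] using h (Pi.single k 1, 0)

theorem evalAt_reflPt_rootExp {n : ℕ} (i j : Fin (n + 1)) (P : Fin n → ℤ) :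
    evalAt (reflPt n i P) (rootExp n j) =
      evalAt P (rootExp n j) - cartan n j i * evalAt P (rootExp n i) := by
  rw [evalAt_reflPt, reflExp_rootExp, evalAt_sub, evalAt_zsmul]

theorem reflPt_reflPt {n : ℕ} (hn : 2 ≤ n) (i : Fin (n + 1)) (P : Fin n → ℤ) :
    reflPt n i (reflPt n i P) = P :=
  evalAt_injective fun f => by simp only [evalAt_reflPt, reflExp_reflExp hn]

theorem reflPt_comm {n : ℕ} (hn : 2 ≤ n) {i j : Fin (n + 1)} (hij : (i : ℕ) + 2 ≤ j)
    (P : Fin n → ℤ) : reflPt n i (reflPt n j P) = reflPt n j (reflPt n i P) :=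
  evalAt_injective fun f => by simp only [evalAt_reflPt, reflExp_comm hn hij]

theorem reflPt_braid_three {n : ℕ} (hn : 2 ≤ n) {i j : Fin (n + 1)} (hij : IsSimpleEdge n i j)
    (P : Fin n → ℤ) :
    reflPt n i (reflPt n j (reflPt n i P)) = reflPt n j (reflPt n i (reflPt n j P)) :=
  evalAt_injective fun f => by simp only [evalAt_reflPt, reflExp_braid_three hn hij]

theorem reflPt_braid_four {n : ℕ} (hn : 2 ≤ n) {i j : Fin (n + 1)} (hij : IsDoubleEdge n i j)
    (P : Fin n → ℤ) :
    reflPt n i (reflPt n j (reflPt n i (reflPt n j P))) =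
      reflPt n j (reflPt n i (reflPt n j (reflPt n i P))) :=
  evalAt_injective fun f => by simp only [evalAt_reflPt, reflExp_braid_four hn hij]

theorem evalAt_corootExp_zero {n : ℕ} (hn : 2 ≤ n) (P : Fin n → ℤ) :
    evalAt P (corootExp n 0) = n + 1 - P ⟨0, by omega⟩ := by
  simp [evalAt, corootExp_zero hn]; ring

theorem evalAt_corootExp_last {n : ℕ} (hn : 2 ≤ n) (P : Fin n → ℤ) :
    evalAt P (corootExp n (Fin.last n)) = P ⟨n - 1, by omega⟩ := by
  simp [evalAt, corootExp_last hn]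

theorem evalAt_corootExp_mid {n : ℕ} (i : Fin (n + 1)) (h0 : 0 < (i : ℕ)) (h1 : (i : ℕ) < n)
    (P : Fin n → ℤ) :
    evalAt P (corootExp n i) = P ⟨i - 1, by omega⟩ - P ⟨i, h1⟩ := by
  simp [evalAt, corootExp_mid i h0 h1, sub_dotProduct]

theorem exists_rootExp_eq {n : ℕ} (i : Fin (n + 1)) :
    ∃ c : ℤ, 0 < c ∧ rootExp n i = c • corootExp n i := by
  by_cases h : (i : ℕ) = 0 ∨ (i : ℕ) = n
  · exact ⟨2, by norm_num, rootExp_eq_two_smul i h⟩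
  · have := i.2
    exact ⟨1, by norm_num, by rw [rootExp_mid i (by omega) (by omega), one_smul]⟩

theorem evalAt_basePt_pos {n : ℕ} (hn : 2 ≤ n) (i : Fin (n + 1)) :
    0 < evalAt (basePt n) (rootExp n i) := by
  obtain ⟨c, hc, h⟩ := exists_rootExp_eq i
  rw [h, evalAt_zsmul]
  refine mul_pos hc ?_
  rcases simple_index_cases i with rfl | rfl | ⟨h0, h1⟩
  · simp [evalAt_corootExp_zero hn, basePt]
  · rw [evalAt_corootExp_last hn, basePt]
    simp; omega
  · rw [evalAt_corootExp_mid i h0 h1, basePt, basePt]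
    dsimp only
    omega

/-- The squared distance of `P` to `basePt n`. -/
def distBase {n : ℕ} (P : Fin n → ℤ) : ℕ := ((P - basePt n) ⬝ᵥ (P - basePt n)).toNat

/-- Reflecting `P` in a wall that separates it from `basePt n` brings it closer: the squared
distance changes by `⟨v, v⟩ x y`, where `x < 0 < y` are the values of the root at the two points.
This gives termination of the walk to the fundamental alcove. -/
theorem distBase_reflPt_lt {n : ℕ} (hn : 2 ≤ n) {i : Fin (n + 1)} {P : Fin n → ℤ}
    (h : evalAt P (rootExp n i) < 0) : distBase (reflPt n i P) < distBase P := by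
  obtain ⟨c, hc, hroot⟩ := exists_rootExp_eq i
  have hb := evalAt_basePt_pos hn i
  have hself := cartan_self hn i
  set x := evalAt P (rootExp n i) with hx
  set y := evalAt (basePt n) (rootExp n i) with hy
  set v := (corootExp n i).1 with hv
  have hc1 : c * (v ⬝ᵥ v) = 2 := by
    rwa [cartan, pairing, hroot, Prod.smul_fst, smul_dotProduct, smul_eq_mul] at hself
  have hvv : 0 < v ⬝ᵥ v := by nlinarith
  have hdiff : x - y = c * ((P - basePt n) ⬝ᵥ v) := by
    rw [hx, hy]
    simp only [evalAt, hroot, Prod.smul_fst, Prod.smul_snd, smul_dotProduct, sub_dotProduct,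
      smul_eq_mul, dotProduct_comm P, dotProduct_comm (basePt n), ← hv]
    ring
  have key : (reflPt n i P - basePt n) ⬝ᵥ (reflPt n i P - basePt n) =
      (P - basePt n) ⬝ᵥ (P - basePt n) + (v ⬝ᵥ v) * (x * y) := by
    have : reflPt n i P - basePt n = (P - basePt n) - x • v := by
      rw [reflPt]; abel
    rw [this]
    generalize P - basePt n = D at *
    simp only [sub_dotProduct, dotProduct_sub, smul_dotProduct, dotProduct_smul, smul_eq_mul,
      dotProduct_comm v D]
    linear_combination x * (v ⬝ᵥ v) * hdiff + x * (D ⬝ᵥ v) * hc1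
  have hneg : (v ⬝ᵥ v) * (x * y) < 0 := mul_neg_of_pos_of_neg hvv (mul_neg_of_neg_of_pos h hb)
  have hnonneg : 0 ≤ (reflPt n i P - basePt n) ⬝ᵥ (reflPt n i P - basePt n) :=
    Finset.sum_nonneg fun _ _ => mul_self_nonneg _
  unfold distBase
  omega

/-- The points in the interior of an alcove whose coordinates are as in the orbit of
`basePt n`. -/
def IsRegular {n : ℕ} (P : Fin n → ℤ) : Prop :=
  (∀ k, ¬ ((n : ℤ) + 1) ∣ P k) ∧
    ∀ k l, k ≠ l → ¬ (2 * ((n : ℤ) + 1)) ∣ P k - P l ∧ ¬ (2 * ((n : ℤ) + 1)) ∣ P k + P l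

theorem isRegular_basePt (n : ℕ) : IsRegular (basePt n) := by
  refine ⟨fun k h => ?_, fun k l hkl => ⟨fun h => ?_, fun h => ?_⟩⟩
  · have := Int.le_of_dvd (by simp [basePt]) h
    simp only [basePt] at this
    omega
  · have h1 : (k : ℕ) ≠ l := fun h => hkl (Fin.ext h)
    have := Int.eq_zero_of_abs_lt_dvd h (by simp only [basePt]; rw [abs_lt]; omega)
    simp only [basePt] at this
    omega
  · have := Int.le_of_dvd (by simp only [basePt]; omega) h
    simp only [basePt] at this
    omega

theorem reflPt_mid {n : ℕ} (i : Fin (n + 1)) (h0 : 0 < (i : ℕ)) (h1 : (i : ℕ) < n)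
    (P : Fin n → ℤ) :
    reflPt n i P = P ∘ Equiv.swap ⟨i - 1, by omega⟩ ⟨i, h1⟩ := by
  ext k
  have a : (i : ℕ) - 1 ≠ i := by omega
  rw [reflPt, rootExp_mid i h0 h1, evalAt_corootExp_mid i h0 h1, corootExp_mid i h0 h1]
  simp only [Pi.sub_apply, Pi.smul_apply, smul_eq_mul, Function.comp, Equiv.swap_apply_def,
    Pi.single_apply]
  split_ifs with h2 h3 h3
  · exact absurd (h2.symm.trans h3) (by simp [Fin.ext_iff, a])
  · rw [h2]; ring
  · rw [h3]; ring
  · ring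

theorem reflPt_zero {n : ℕ} (hn : 2 ≤ n) (P : Fin n → ℤ) :
    reflPt n 0 P = Function.update P ⟨0, by omega⟩ (2 * (n + 1) - P ⟨0, by omega⟩) := by
  ext k
  rw [reflPt, rootExp_eq_two_smul _ (by simp), evalAt_zsmul, evalAt_corootExp_zero hn,
    corootExp_zero hn, Function.update_apply]
  split_ifs with h
  · subst h; simp; ring
  · simp [h]

theorem reflPt_last {n : ℕ} (hn : 2 ≤ n) (P : Fin n → ℤ) :
    reflPt n (Fin.last n) P =
      Function.update P ⟨n - 1, by omega⟩ (-P ⟨n - 1, by omega⟩) := by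
  ext k
  rw [reflPt, rootExp_eq_two_smul _ (by simp), evalAt_zsmul, evalAt_corootExp_last hn,
    corootExp_last hn, Function.update_apply]
  split_ifs with h
  · subst h; simp; ring
  · simp [h]

/-- The reflections at the two end nodes are the cases `m = 1` and `m = 0`. Modulo `2(n+1)` the
update is a sign change of one coordinate, which at most exchanges the conditions on differences and
on sums. -/
theorem IsRegular.update {n : ℕ} {P : Fin n → ℤ} (h : IsRegular P) (k : Fin n) (m : ℤ) :
    IsRegular (Function.update P k (2 * (n + 1) * m - P k)) := by
  have e1 : ∀ a b : ℤ, (2 * ((n : ℤ) + 1)) ∣ 2 * (n + 1) * m - a - b ↔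
      (2 * ((n : ℤ) + 1)) ∣ a + b := fun a b => by
    rw [sub_sub, dvd_sub_right (dvd_mul_right _ _)]
  have e2 : ∀ a b : ℤ, (2 * ((n : ℤ) + 1)) ∣ 2 * (n + 1) * m - a + b ↔
      (2 * ((n : ℤ) + 1)) ∣ a - b := fun a b => by
    rw [sub_add, dvd_sub_right (dvd_mul_right _ _)]
  have e3 : ∀ a b : ℤ, (2 * ((n : ℤ) + 1)) ∣ a - (2 * (n + 1) * m - b) ↔
      (2 * ((n : ℤ) + 1)) ∣ b + a := fun a b => by
    rw [← e1, ← dvd_neg]; ring_nf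
  have e4 : ∀ a b : ℤ, (2 * ((n : ℤ) + 1)) ∣ a + (2 * (n + 1) * m - b) ↔
      (2 * ((n : ℤ) + 1)) ∣ b - a := fun a b => by
    rw [← e2]; ring_nf
  refine ⟨fun l => ?_, fun l l' hl => ?_⟩
  · rw [Function.update_apply]
    split_ifs
    · have : ((n : ℤ) + 1) ∣ 2 * (n + 1) * m := ⟨2 * m, by ring⟩
      rw [dvd_sub_right this]
      exact h.1 k
    · exact h.1 l
  · simp only [Function.update_apply]
    split_ifs with h1 h2 h2
    · exact absurd (h1.trans h2.symm) hl
    · rw [e1, e2]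
      exact (h.2 k l' (fun h3 => h2 h3.symm)).symm
    · rw [e3, e4]
      exact (h.2 k l (fun h3 => h1 h3.symm)).symm
    · exact h.2 l l' hl

theorem IsRegular.map_reflPt {n : ℕ} (hn : 2 ≤ n) {P : Fin n → ℤ} (h : IsRegular P)
    (i : Fin (n + 1)) : IsRegular (reflPt n i P) := by
  rcases simple_index_cases i with rfl | rfl | ⟨h0, h1⟩
  · rw [reflPt_zero hn]
    simpa using h.update ⟨0, by omega⟩ 1
  · rw [reflPt_last hn]
    simpa using h.update ⟨n - 1, by omega⟩ 0
  · rw [reflPt_mid i h0 h1]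
    exact ⟨fun k => h.1 _, fun k l hkl => h.2 _ _ fun e => hkl (Equiv.injective _ e)⟩

theorem IsRegular.evalAt_ne_zero {n : ℕ} (hn : 2 ≤ n) {P : Fin n → ℤ} (h : IsRegular P)
    (i : Fin (n + 1)) : evalAt P (rootExp n i) ≠ 0 := by
  obtain ⟨c, hc, hr⟩ := exists_rootExp_eq i
  rw [hr, evalAt_zsmul]
  refine mul_ne_zero hc.ne' fun h2 => ?_
  rcases simple_index_cases i with rfl | rfl | ⟨h0, h1⟩
  · rw [evalAt_corootExp_zero hn] at h2
    exact h.1 ⟨0, by omega⟩ ⟨1, by omega⟩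
  · rw [evalAt_corootExp_last hn] at h2
    exact h.1 ⟨n - 1, by omega⟩ (h2 ▸ dvd_zero _)
  · rw [evalAt_corootExp_mid i h0 h1] at h2
    refine (h.2 ⟨i - 1, by omega⟩ ⟨i, h1⟩ ?_).1 (h2 ▸ dvd_zero _)
    simp only [ne_eq, Fin.mk.injEq]
    omega

/-- A point all of whose simple roots are positive is `basePt n`. -/
theorem eq_basePt {n : ℕ} (hn : 2 ≤ n) {P : Fin n → ℤ}
    (h : ∀ i, 0 < evalAt P (rootExp n i)) : P = basePt n := by
  have h' : ∀ i, 0 < evalAt P (corootExp n i) := fun i => by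
    obtain ⟨c, hc, hr⟩ := exists_rootExp_eq i
    have := h i
    rw [hr, evalAt_zsmul] at this
    exact pos_of_mul_pos_right this hc.le
  -- The inequalities read `n + 1 > P_1 > ⋯ > P_n > 0`. The scaling by `n + 1` was chosen so that
  -- integers leave only `(n, …, 1)`: bounding the coordinates from both ends pins each of them.
  have hmid : ∀ k (hk : k + 1 < n), P ⟨k + 1, hk⟩ < P ⟨k, by omega⟩ := fun k hk => by
    have := h' ⟨k + 1, by omega⟩
    rw [evalAt_corootExp_mid _ (by simp) hk] at this
    simpa using this
  have h0 : P ⟨0, by omega⟩ ≤ n := by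
    have := h' 0
    rw [evalAt_corootExp_zero hn] at this
    omega
  have hl : 0 < P ⟨n - 1, by omega⟩ := by
    simpa [evalAt_corootExp_last hn] using h' (Fin.last n)
  have hup : ∀ k (hk : k < n), P ⟨k, hk⟩ ≤ n - k := fun k => by
    induction k with
    | zero => intro hk; simpa using h0
    | succ k ih =>
      intro hk
      have := ih (by omega)
      have := hmid k hk
      push_cast
      omega
  have hlow : ∀ m (hm : m < n), (m : ℤ) + 1 ≤ P ⟨n - 1 - m, by omega⟩ := fun m => by
    induction m with
    | zero => intro _; simpa using Int.add_one_le_of_lt hl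
    | succ m ih =>
      intro hk
      have h1 := ih (by omega)
      have h2 := hmid (n - 1 - (m + 1)) (by omega)
      have h3 : n - 1 - (m + 1) + 1 = n - 1 - m := by omega
      simp only [h3] at h2
      push_cast
      omega
  ext k
  have h1 := hup k k.2
  have h2 := hlow (n - 1 - k) (by omega)
  have h3 : (⟨n - 1 - (n - 1 - k), by omega⟩ : Fin n) = k := Fin.ext (by simp only; omega)
  rw [h3] at h2
  rw [Fin.eta] at h1
  simp only [basePt]
  have := k.2
  omega

/-! ### Independence of the reduction path -/

/-- The braid relations of type `C̃_n` for self-maps of a set. -/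
structure IsBraidFamily {n : ℕ} {X : Type*} (R : Fin (n + 1) → X → X) : Prop where
  comm : ∀ i j : Fin (n + 1), (i : ℕ) + 2 ≤ j → ∀ x, R i (R j x) = R j (R i x)
  three : ∀ i j, IsSimpleEdge n i j → ∀ x, R i (R j (R i x)) = R j (R i (R j x))
  four : ∀ i j, IsDoubleEdge n i j →
    ∀ x, R i (R j (R i (R j x))) = R j (R i (R j (R i x)))

open Classical in
/-- The element obtained from `x₀` by applying the maps `R i` along a path of simple reflections
from `P` to the fundamental alcove. -/
def walk {n : ℕ} (hn : 2 ≤ n) {X : Type*} (x₀ : X) (R : Fin (n + 1) → X → X)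
    (P : Fin n → ℤ) : X :=
  if h : ∃ i, evalAt P (rootExp n i) < 0 then
    R h.choose (walk hn x₀ R (reflPt n h.choose P))
  else x₀
termination_by distBase P
decreasing_by exact distBase_reflPt_lt hn h.choose_spec

section walk

variable {n : ℕ} (hn : 2 ≤ n) {X : Type*} (x₀ : X) {R : Fin (n + 1) → X → X}

theorem walk_basePt : walk hn x₀ R (basePt n) = x₀ := by
  rw [walk, dif_neg]
  push Not
  exact fun i => (evalAt_basePt_pos hn i).le

/-- The definition of `walk` picks some descent by choice; the braid relations make every descent
equally good. The induction is on the distance to `basePt n`, and only pairs of descents at the same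
point have to be compared. -/
theorem walk_of_neg (hR : IsBraidFamily R) {P : Fin n → ℤ} {i : Fin (n + 1)}
    (hi : evalAt P (rootExp n i) < 0) :
    walk hn x₀ R P = R i (walk hn x₀ R (reflPt n i P)) := by
  induction hd : distBase P using Nat.strong_induction_on generalizing P i with
  | _ d ih =>
  subst hd
  have step : ∀ {Q : Fin n → ℤ} {j : Fin (n + 1)}, distBase Q < distBase P →
      evalAt Q (rootExp n j) < 0 → walk hn x₀ R Q = R j (walk hn x₀ R (reflPt n j Q)) :=
    fun hQ hj => ih _ hQ hj rfl
  suffices H : ∀ i j : Fin (n + 1), evalAt P (rootExp n i) < 0 → evalAt P (rootExp n j) < 0 →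
      R i (walk hn x₀ R (reflPt n i P)) = R j (walk hn x₀ R (reflPt n j P)) by
    have hex : ∃ i, evalAt P (rootExp n i) < 0 := ⟨i, hi⟩
    rw [walk, dif_pos hex]
    exact H _ _ hex.choose_spec hi
  -- If `i` and `j` are both descents at `P`, then every alternating path from `P` keeps descending
  -- until it reaches the end of its rank-two orbit, where the two paths meet. The signs are read
  -- off from the Cartan integers, and the braid relation for `R` identifies the two results. The
  -- next two cases follow the same pattern with longer paths.
  have far : ∀ i j : Fin (n + 1), (i : ℕ) + 2 ≤ j →
      evalAt P (rootExp n i) < 0 → evalAt P (rootExp n j) < 0 →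
      R i (walk hn x₀ R (reflPt n i P)) = R j (walk hn x₀ R (reflPt n j P)) := by
    intro i j hij hi hj
    obtain ⟨c1, c2⟩ := cartan_far hn hij
    rw [step (j := j) (distBase_reflPt_lt hn hi) (by rw [evalAt_reflPt_rootExp, c2]; linarith),
      step (j := i) (distBase_reflPt_lt hn hj) (by rw [evalAt_reflPt_rootExp, c1]; linarith),
      hR.comm i j hij, reflPt_comm hn hij]
  have three : ∀ i j : Fin (n + 1), IsSimpleEdge n i j →
      evalAt P (rootExp n i) < 0 → evalAt P (rootExp n j) < 0 →
      R i (walk hn x₀ R (reflPt n i P)) = R j (walk hn x₀ R (reflPt n j P)) := by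
    intro i j hij hi hj
    obtain ⟨c1, c2⟩ := hij.cartan
    have li := distBase_reflPt_lt hn hi
    have lj := distBase_reflPt_lt hn hj
    have hij1 : evalAt (reflPt n i P) (rootExp n j) < 0 := by
      rw [evalAt_reflPt_rootExp, c2]; linarith
    have hji1 : evalAt (reflPt n j P) (rootExp n i) < 0 := by
      rw [evalAt_reflPt_rootExp, c1]; linarith
    have hij2 : evalAt (reflPt n j (reflPt n i P)) (rootExp n i) < 0 := by
      simp only [evalAt_reflPt_rootExp, c1, c2, cartan_self hn]; linarith
    have hji2 : evalAt (reflPt n i (reflPt n j P)) (rootExp n j) < 0 := by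
      simp only [evalAt_reflPt_rootExp, c1, c2, cartan_self hn]; linarith
    have lij := distBase_reflPt_lt hn hij1
    have lji := distBase_reflPt_lt hn hji1
    rw [step li hij1, step (lij.trans li) hij2, step lj hji1, step (lji.trans lj) hji2,
      hR.three i j hij, reflPt_braid_three hn hij]
  have four : ∀ i j : Fin (n + 1), IsDoubleEdge n i j →
      evalAt P (rootExp n i) < 0 → evalAt P (rootExp n j) < 0 →
      R i (walk hn x₀ R (reflPt n i P)) = R j (walk hn x₀ R (reflPt n j P)) := by
    intro i j hij hi hj
    obtain ⟨c1, c2⟩ := hij.cartan hn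
    have li := distBase_reflPt_lt hn hi
    have lj := distBase_reflPt_lt hn hj
    have hij1 : evalAt (reflPt n i P) (rootExp n j) < 0 := by
      rw [evalAt_reflPt_rootExp, c2]; linarith
    have hji1 : evalAt (reflPt n j P) (rootExp n i) < 0 := by
      rw [evalAt_reflPt_rootExp, c1]; linarith
    have hij2 : evalAt (reflPt n j (reflPt n i P)) (rootExp n i) < 0 := by
      simp only [evalAt_reflPt_rootExp, c1, c2, cartan_self hn]; linarith
    have hji2 : evalAt (reflPt n i (reflPt n j P)) (rootExp n j) < 0 := by
      simp only [evalAt_reflPt_rootExp, c1, c2, cartan_self hn]; linarith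
    have hij3 : evalAt (reflPt n i (reflPt n j (reflPt n i P))) (rootExp n j) < 0 := by
      simp only [evalAt_reflPt_rootExp, c1, c2, cartan_self hn]; linarith
    have hji3 : evalAt (reflPt n j (reflPt n i (reflPt n j P))) (rootExp n i) < 0 := by
      simp only [evalAt_reflPt_rootExp, c1, c2, cartan_self hn]; linarith
    have lij := (distBase_reflPt_lt hn hij1).trans li
    have lji := (distBase_reflPt_lt hn hji1).trans lj
    have lij2 := (distBase_reflPt_lt hn hij2).trans lij
    have lji2 := (distBase_reflPt_lt hn hji2).trans lji
    rw [step li hij1, step lij hij2, step lij2 hij3, step lj hji1, step lji hji2, step lji2 hji3,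
      hR.four i j hij, reflPt_braid_four hn hij]
  have ordered : ∀ i j : Fin (n + 1), (i : ℕ) < j →
      evalAt P (rootExp n i) < 0 → evalAt P (rootExp n j) < 0 →
      R i (walk hn x₀ R (reflPt n i P)) = R j (walk hn x₀ R (reflPt n j P)) := by
    intro i j hij hi hj
    rcases node_pair_cases hij with h | h | h | h
    · exact far i j h hi hj
    · exact three i j h hi hj
    · exact four i j h hi hj
    · exact (four j i h hj hi).symm
  intro i j hi hj
  rcases lt_trichotomy (i : ℕ) j with h | h | h
  · exact ordered i j h hi hj
  · rw [Fin.ext h]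
  · exact (ordered j i h hj hi).symm

theorem walk_reflPt_of_pos (hR : IsBraidFamily R) {P : Fin n → ℤ} {i : Fin (n + 1)}
    (hi : 0 < evalAt P (rootExp n i)) :
    walk hn x₀ R (reflPt n i P) = R i (walk hn x₀ R P) := by
  rw [walk_of_neg hn x₀ hR (i := i), reflPt_reflPt hn]
  rw [evalAt_reflPt_rootExp, cartan_self hn]
  linarith

end walk

theorem IsRegular.eq_basePt_or {n : ℕ} (hn : 2 ≤ n) {P : Fin n → ℤ} (h : IsRegular P) :
    P = basePt n ∨ ∃ i, evalAt P (rootExp n i) < 0 := by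
  by_contra! hP
  exact hP.1 (eq_basePt hn fun i => lt_of_le_of_ne (hP.2 i) (h.evalAt_ne_zero hn i).symm)

/-- Induction on regular points along simple reflections leading away from the fundamental
alcove. -/
theorem IsRegular.induction {n : ℕ} (hn : 2 ≤ n) {motive : (Fin n → ℤ) → Prop}
    (base : motive (basePt n))
    (step : ∀ P i, IsRegular P → 0 < evalAt P (rootExp n i) → motive P → motive (reflPt n i P))
    {P : Fin n → ℤ} (h : IsRegular P) : motive P := by
  induction hd : distBase P using Nat.strong_induction_on generalizing P with
  | _ d ih =>
  subst hd
  obtain rfl | ⟨i, hi⟩ := h.eq_basePt_or hn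
  · exact base
  · have h1 := ih _ (distBase_reflPt_lt hn hi) (h.map_reflPt hn i) rfl
    have h2 := step _ i (h.map_reflPt hn i)
      (by rw [evalAt_reflPt_rootExp, cartan_self hn]; linarith) h1
    rwa [reflPt_reflPt hn] at h2

/-! ### Length and affine Weyl group elements attached to regular points -/

/-- The length of the affine Weyl group element which maps `P` into the fundamental alcove. -/
def len {n : ℕ} (hn : 2 ≤ n) (P : Fin n → ℤ) : ℕ :=
  walk hn 0 (fun _ : Fin (n + 1) => Nat.succ) P

theorem isBraidFamily_succ (n : ℕ) : IsBraidFamily (fun _ : Fin (n + 1) => Nat.succ) :=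
  ⟨fun _ _ _ _ => rfl, fun _ _ _ _ => rfl, fun _ _ _ _ => rfl⟩

theorem len_reflPt_of_pos {n : ℕ} (hn : 2 ≤ n) {P : Fin n → ℤ} {i : Fin (n + 1)}
    (hi : 0 < evalAt P (rootExp n i)) : len hn (reflPt n i P) = len hn P + 1 :=
  walk_reflPt_of_pos hn 0 (isBraidFamily_succ n) hi

theorem IsRegular.len_reflPt_le {n : ℕ} (hn : 2 ≤ n) {P : Fin n → ℤ} (h : IsRegular P)
    (i : Fin (n + 1)) : len hn (reflPt n i P) ≤ len hn P + 1 := by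
  rcases lt_or_gt_of_ne (h.evalAt_ne_zero hn i) with h1 | h1
  · have := len_reflPt_of_pos hn (P := reflPt n i P) (i := i)
      (by rw [evalAt_reflPt_rootExp, cartan_self hn]; linarith)
    rw [reflPt_reflPt hn] at this
    omega
  · exact (len_reflPt_of_pos hn h1).le

/-- The automorphism of `Λ ⊕ ℤ(δ/2)` given by the affine Weyl group element `w` for which
`P = w⁻¹ (basePt n)`. -/
def weylExp {n : ℕ} (hn : 2 ≤ n) (P : Fin n → ℤ) : (Fin n → ℤ) × ℤ →+ (Fin n → ℤ) × ℤ :=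
  walk hn (AddMonoidHom.id _) (fun i w => w.comp (reflExp n i)) P

theorem isBraidFamily_comp_reflExp {n : ℕ} (hn : 2 ≤ n) :
    IsBraidFamily (fun (i : Fin (n + 1)) (w : (Fin n → ℤ) × ℤ →+ (Fin n → ℤ) × ℤ) =>
      w.comp (reflExp n i)) where
  comm i j h w := by
    refine AddMonoidHom.ext fun f => ?_
    simp only [AddMonoidHom.comp_apply, reflExp_comm hn h]
  three i j h w := by
    refine AddMonoidHom.ext fun f => ?_
    simp only [AddMonoidHom.comp_apply, reflExp_braid_three hn h]
  four i j h w := by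
    refine AddMonoidHom.ext fun f => ?_
    simp only [AddMonoidHom.comp_apply, reflExp_braid_four hn h]

theorem weylExp_basePt {n : ℕ} (hn : 2 ≤ n) (f : (Fin n → ℤ) × ℤ) :
    weylExp hn (basePt n) f = f := by
  rw [weylExp, walk_basePt]; rfl

theorem IsRegular.weylExp_reflPt {n : ℕ} (hn : 2 ≤ n) {P : Fin n → ℤ} (h : IsRegular P)
    (i : Fin (n + 1)) (f : (Fin n → ℤ) × ℤ) :
    weylExp hn (reflPt n i P) f = weylExp hn P (reflExp n i f) := by
  have hR := isBraidFamily_comp_reflExp hn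
  rcases lt_or_gt_of_ne (h.evalAt_ne_zero hn i) with h1 | h1
  · rw [weylExp, weylExp, walk_of_neg hn (P := P) _ hR h1, AddMonoidHom.comp_apply,
      reflExp_reflExp hn]
  · rw [weylExp, walk_reflPt_of_pos hn _ hR h1, AddMonoidHom.comp_apply]; rfl

/-- This recovers `P` from the automorphism `w`, so distinct regular points give distinct group
elements. -/
theorem IsRegular.evalAt_weylExp {n : ℕ} (hn : 2 ≤ n) {P : Fin n → ℤ} (h : IsRegular P)
    (f : (Fin n → ℤ) × ℤ) : evalAt (basePt n) (weylExp hn P f) = evalAt P f := by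
  revert f
  refine h.induction hn (motive := fun P => ∀ f, evalAt (basePt n) (weylExp hn P f) = evalAt P f)
    (fun f => by rw [weylExp_basePt]) fun P i hP _ ih f => ?_
  rw [hP.weylExp_reflPt hn, ih, evalAt_reflPt]

theorem weylExp_delta {n : ℕ} (hn : 2 ≤ n) {P : Fin n → ℤ} (h : IsRegular P) (m : ℤ) :
    weylExp hn P (0, m) = (0, m) := by
  refine h.induction hn (motive := fun P => weylExp hn P (0, m) = (0, m))
    (by rw [weylExp_basePt]) fun P i hP _ ih => ?_
  rw [hP.weylExp_reflPt hn, reflExp_apply]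
  simpa [pairing] using ih

/-! ### Invariance of the multiplicity function -/

theorem form_toVHat {n : ℕ} (f g : (Fin n → ℤ) × ℤ) :
    form (toVHat f) (toVHat g) = ((f.1 ⬝ᵥ g.1 : ℤ) : ℝ) := by
  simp [form, toVHat, dotProduct]

theorem rootExp_dotProduct_self_end {n : ℕ} (hn : 2 ≤ n) (i : Fin (n + 1))
    (h : (i : ℕ) = 0 ∨ (i : ℕ) = n) : (rootExp n i).1 ⬝ᵥ (rootExp n i).1 = 4 := by
  have h1 := cartan_self hn i
  rw [cartan, pairing] at h1
  have h2 : (rootExp n i).1 = (2 : ℤ) • (corootExp n i).1 := by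
    rw [rootExp_eq_two_smul i h, Prod.smul_fst]
  rw [h2] at h1 ⊢
  rw [dotProduct_smul, h1]
  norm_num

theorem rootExp_dotProduct_mid {n : ℕ} (i j : Fin (n + 1)) (h0 : 0 < (j : ℕ))
    (h1 : (j : ℕ) < n) : (rootExp n i).1 ⬝ᵥ (rootExp n j).1 = cartan n i j := by
  rw [cartan, pairing, rootExp_mid j h0 h1]

theorem coroot_simpleRoot_mid {n : ℕ} (hn : 2 ≤ n) (i : Fin (n + 1)) (h0 : 0 < (i : ℕ))
    (h1 : (i : ℕ) < n) : coroot (simpleRoot n i) = simpleRoot n i := by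
  rw [coroot, simpleRoot, form_toVHat, rootExp_dotProduct_mid i i h0 h1, cartan_self hn]
  norm_num

theorem coroot_simpleRoot_end {n : ℕ} (hn : 2 ≤ n) (i : Fin (n + 1))
    (h : (i : ℕ) = 0 ∨ (i : ℕ) = n) : coroot (simpleRoot n i) = (1 / 2 : ℝ) • simpleRoot n i := by
  rw [coroot, simpleRoot, form_toVHat, rootExp_dotProduct_self_end hn i h]
  norm_num

theorem Multiplicity.kDual_mid {n : ℕ} (hn : 2 ≤ n) (t : Multiplicity n) (i : Fin (n + 1))
    (h0 : 0 < (i : ℕ)) (h1 : (i : ℕ) < n) : t.kDual i = t.k i := by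
  rw [Multiplicity.kDual, coroot_simpleRoot_mid hn i h0 h1, Multiplicity.k]

theorem Multiplicity.kDual_end {n : ℕ} (hn : 2 ≤ n) (t : Multiplicity n) (i : Fin (n + 1))
    (h : (i : ℕ) = 0 ∨ (i : ℕ) = n) : t.kDual i = t.kHalf i := by
  rw [Multiplicity.kDual, coroot_simpleRoot_end hn i h, Multiplicity.kHalf]

theorem simpleRoot_mem_S_mid {n : ℕ} (i : Fin (n + 1)) (h0 : 0 < (i : ℕ))
    (h1 : (i : ℕ) < n) : simpleRoot n i ∈ S n := by
  refine Or.inr ⟨i, i + 1, 1, -1, 0, h0, by omega, h1, Or.inl rfl, Or.inr rfl, ?_⟩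
  simp [simpleRoot, rootExp, h0.ne', h1.ne, sub_eq_add_neg]

theorem IsSimpleEdge.mid_left {n : ℕ} {i j : Fin (n + 1)} (h : IsSimpleEdge n i j) :
    0 < (i : ℕ) ∧ (i : ℕ) < n := by
  have := h.2; omega

theorem IsSimpleEdge.mid_right {n : ℕ} {i j : Fin (n + 1)} (h : IsSimpleEdge n i j) :
    0 < (j : ℕ) ∧ (j : ℕ) < n := by
  have := h.1; have := h.2; omega

theorem reflection_simpleRoot {n : ℕ} (hn : 2 ≤ n) {i j : Fin (n + 1)} (h0 : 0 < (i : ℕ))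
    (h1 : (i : ℕ) < n) (hc : cartan n j i = -1) :
    reflection (simpleRoot n i) (simpleRoot n j) = simpleRoot n j + simpleRoot n i := by
  change simpleRoot n j - form (simpleRoot n j) (coroot (simpleRoot n i)) • simpleRoot n i = _
  rw [coroot_simpleRoot_mid hn i h0 h1]
  conv_lhs => rw [simpleRoot, simpleRoot, form_toVHat, rootExp_dotProduct_mid j i h0 h1, hc]
  simp [simpleRoot]

/-- Both `s_i(a_j)` and `s_j(a_i)` equal `a_i + a_j`, so `a_i` and `a_j` lie in one orbit. -/
theorem Multiplicity.k_eq_of_isSimpleEdge {n : ℕ} (hn : 2 ≤ n) (t : Multiplicity n)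
    {i j : Fin (n + 1)} (h : IsSimpleEdge n i j) : t.k i = t.k j := by
  have hi := h.mid_left
  have hj := h.mid_right
  have mi := simpleRoot_mem_S_mid i hi.1 hi.2
  have mj := simpleRoot_mem_S_mid j hj.1 hj.2
  have h1 := t.invariant _ (Subgroup.subset_closure (Set.mem_image_of_mem reflection mi)) _ mj
  have h2 := t.invariant _ (Subgroup.subset_closure (Set.mem_image_of_mem reflection mj)) _ mi
  rw [reflection_simpleRoot hn hi.1 hi.2 h.cartan.2] at h1
  rw [reflection_simpleRoot hn hj.1 hj.2 h.cartan.1, add_comm] at h2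
  exact h2.symm.trans h1

/-! ### Evaluation of the difference-reflection operators -/

theorem sAct_xpow {n : ℕ} (qh : ℂˣ) (i : Fin (n + 1)) (f : (Fin n → ℤ) × ℤ) :
    sAct n qh i (xpow qh f) = xpow qh (reflExp n i f) := by
  rw [xpow, sAct_single]
  have h1 : reflExp n i f = (0, f.2) + simpleReflExp n i f.1 := by
    rw [reflExp_apply, simpleReflExp]
    ext <;> simp
    ring
  have h2 : xpow qh ((0, f.2) : (Fin n → ℤ) × ℤ) = algebraMap ℂ (A n) ((qh ^ f.2 : ℂˣ) : ℂ) := by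
    simp [xpow, AddMonoidAlgebra.coe_algebraMap]
  rw [h1, xpow_add, h2, Algebra.smul_def]

theorem xpow_neg_mul {n : ℕ} (qh : ℂˣ) (f : (Fin n → ℤ) × ℤ) :
    xpow qh (-f) * xpow qh f = 1 := by
  rw [← xpow_add, neg_add_cancel, xpow_zero]

theorem one_sub_xpow_ne {n : ℕ} (qh : ℂˣ) {f : (Fin n → ℤ) × ℤ} (hf : f.1 ≠ 0) :
    1 - xpow qh f ≠ 0 := by
  intro h
  have h1 := congrArg (fun g : A n => g.coeff f.1) h
  simp [xpow, AddMonoidAlgebra.one_def, hf.symm] at h1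
  exact (qh ^ f.2).ne_zero (by simpa using h1)

theorem algHom_ext_xpow {n : ℕ} (qh : ℂˣ) {B : Type*} [Semiring B] [Algebra ℂ B]
    {g h : A n →ₐ[ℂ] B} (H : ∀ μ, g (xpow qh (μ, 0)) = h (xpow qh (μ, 0))) : g = h :=
  AddMonoidAlgebra.algHom_ext (fun μ => by simpa [xpow] using H μ) (by ext)

/-- The rational function `t⁻¹ v_{a_i}` of `X = x^{a_i^∨}`. -/
def opCoef {n : ℕ} (t : Multiplicity n) {K : Type*} [Field K] [Algebra ℂ K] (i : Fin (n + 1))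
    (X : K) : K :=
  if (i : ℕ) = 0 ∨ (i : ℕ) = n then
    (algebraMap ℂ K (t.k i))⁻¹ * ((1 - algebraMap ℂ K (t.k i) * algebraMap ℂ K (t.kHalf i) * X) *
      (1 + algebraMap ℂ K (t.k i) * (algebraMap ℂ K (t.kHalf i))⁻¹ * X)) / (1 - X ^ 2)
  else (algebraMap ℂ K (t.k i))⁻¹ * (1 - algebraMap ℂ K (t.k i) ^ 2 * X) / (1 - X)

theorem algebraMap_units_ne_zero {K : Type*} [Field K] [Algebra ℂ K] (c : ℂˣ) :
    algebraMap ℂ K c ≠ 0 := by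
  simp

section eval

variable {n : ℕ} (hn : 2 ≤ n) (t : Multiplicity n) (qh : ℂˣ) {K : Type*} [Field K] [Algebra ℂ K]

theorem opCoef_eq (g : A n →ₐ[ℂ] K) (i : Fin (n + 1)) :
    opCoef t i (g (xpow qh (corootExp n i))) =
      algebraMap ℂ K ((t.k i)⁻¹ : ℂˣ) * g (vNum t qh i) / (1 - g (xpow qh (rootExp n i))) := by
  unfold opCoef vNum
  split_ifs with h
  · rw [rootExp_eq_two_smul i h, two_smul, xpow_add]
    simp only [Algebra.smul_def, map_mul, map_sub, map_add, map_one, AlgHom.commutes,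
      Units.val_mul, Units.val_inv_eq_inv_val, map_inv₀, pow_two]
  · have := i.2
    rw [rootExp_mid i (by omega) (by omega)]
    simp only [Algebra.smul_def, map_mul, map_sub, map_one, AlgHom.commutes,
      Units.val_pow_eq_pow_val, map_pow, Units.val_inv_eq_inv_val, map_inv₀]

theorem eval_divDiff (g : A n →ₐ[ℂ] K) (i : Fin (n + 1))
    (hg : g (1 - xpow qh (rootExp n i)) ≠ 0) (f : A n) :
    g (divDiff hn qh i f) = (g (sAct n qh i f) - g f) / (1 - g (xpow qh (rootExp n i))) := by
  have h := congrArg g (divDiff_spec hn qh i f)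
  rw [map_mul, map_sub g (sAct n qh i f)] at h
  rw [map_sub, map_one] at h hg
  rw [eq_div_iff hg, mul_comm, h]

theorem eval_T (g : A n →ₐ[ℂ] K) (i : Fin (n + 1))
    (hg : g (1 - xpow qh (rootExp n i)) ≠ 0) (f : A n) :
    g (T hn t qh i f) =
      (algebraMap ℂ K (t.k i) - opCoef t i (g (xpow qh (corootExp n i)))) * g f +
        opCoef t i (g (xpow qh (corootExp n i))) * g (sAct n qh i f) := by
  have h : T hn t qh i f = (t.k i : ℂ) • f +
      (((t.k i)⁻¹ : ℂˣ) : ℂ) • (vNum t qh i * divDiff hn qh i f) := rfl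
  rw [opCoef_eq, h, map_add, map_smul, map_smul, map_mul, eval_divDiff hn qh g i hg,
    Algebra.smul_def, Algebra.smul_def]
  ring

/-- The rank-one identity `c(X) + c(X⁻¹) = t + t⁻¹`, on which the quadratic relation rests. -/
theorem opCoef_inv {i : Fin (n + 1)} {X : K} (h0 : X ≠ 0) (h1 : X ^ 2 ≠ 1) :
    opCoef t i X⁻¹ = algebraMap ℂ K (t.k i) + (algebraMap ℂ K (t.k i))⁻¹ - opCoef t i X := by
  have ht := algebraMap_units_ne_zero (K := K) (t.k i)
  have hv := algebraMap_units_ne_zero (K := K) (t.kHalf i)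
  unfold opCoef
  generalize algebraMap ℂ K (t.k i) = u at *
  generalize algebraMap ℂ K (t.kHalf i) = v at *
  have h2 : (1 - X ^ 2) ≠ 0 := sub_ne_zero.2 h1.symm
  have h3 : 1 - X⁻¹ ^ 2 ≠ 0 := by
    rw [inv_pow]
    exact sub_ne_zero.2 fun h => h1 (by rw [← inv_inv (X ^ 2), ← h, inv_one])
  have h4 : 1 - X ≠ 0 := fun h => h2 (by linear_combination (1 + X) * h)
  have h5 : 1 - X⁻¹ ≠ 0 := fun h => h3 (by linear_combination (1 + X⁻¹) * h)
  have e1 : 1 - X⁻¹ ^ 2 = -(1 - X ^ 2) / X ^ 2 := by field_simp; ring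
  have e2 : 1 - X⁻¹ = -(1 - X) / X := by field_simp; ring
  split_ifs
  · rw [e1]
    field_simp
    ring
  · rw [e2]
    field_simp
    ring

end eval

/-- The inclusion of `𝒜` in its field of fractions. -/
def fracHom (n : ℕ) : A n →ₐ[ℂ] FractionRing (A n) :=
  IsScalarTower.toAlgHom ℂ (A n) (FractionRing (A n))

theorem fracHom_injective (n : ℕ) : Function.Injective (fracHom n) :=
  IsFractionRing.injective (A n) (FractionRing (A n))

theorem sAct_sAct {n : ℕ} (hn : 2 ≤ n) (qh : ℂˣ) (i : Fin (n + 1)) (f : A n) :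
    sAct n qh i (sAct n qh i f) = f := by
  have : (sAct n qh i).comp (sAct n qh i) = AlgHom.id ℂ _ :=
    algHom_ext_xpow qh fun μ => by simp [sAct_xpow, reflExp_reflExp hn]
  exact DFunLike.congr_fun this f

theorem sAct_comm {n : ℕ} (hn : 2 ≤ n) (qh : ℂˣ) {i j : Fin (n + 1)} (h : (i : ℕ) + 2 ≤ j)
    (f : A n) : sAct n qh i (sAct n qh j f) = sAct n qh j (sAct n qh i f) := by
  have : (sAct n qh i).comp (sAct n qh j) = (sAct n qh j).comp (sAct n qh i) :=
    algHom_ext_xpow qh fun μ => by simp [sAct_xpow, reflExp_comm hn h]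
  exact DFunLike.congr_fun this f

theorem sAct_braid_three {n : ℕ} (hn : 2 ≤ n) (qh : ℂˣ) {i j : Fin (n + 1)}
    (h : IsSimpleEdge n i j) (f : A n) :
    sAct n qh i (sAct n qh j (sAct n qh i f)) = sAct n qh j (sAct n qh i (sAct n qh j f)) := by
  have : (sAct n qh i).comp ((sAct n qh j).comp (sAct n qh i)) =
      (sAct n qh j).comp ((sAct n qh i).comp (sAct n qh j)) :=
    algHom_ext_xpow qh fun μ => by simp [sAct_xpow, reflExp_braid_three hn h]
  exact DFunLike.congr_fun this f

theorem sAct_braid_four {n : ℕ} (hn : 2 ≤ n) (qh : ℂˣ) {i j : Fin (n + 1)}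
    (h : IsDoubleEdge n i j) (f : A n) :
    sAct n qh i (sAct n qh j (sAct n qh i (sAct n qh j f))) =
      sAct n qh j (sAct n qh i (sAct n qh j (sAct n qh i f))) := by
  have : (sAct n qh i).comp ((sAct n qh j).comp ((sAct n qh i).comp (sAct n qh j))) =
      (sAct n qh j).comp ((sAct n qh i).comp ((sAct n qh j).comp (sAct n qh i))) :=
    algHom_ext_xpow qh fun μ => by simp [sAct_xpow, reflExp_braid_four hn h]
  exact DFunLike.congr_fun this f

theorem pairing_corootExp_self {n : ℕ} (hn : 2 ≤ n) (i : Fin (n + 1)) :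
    0 < pairing n i (corootExp n i).1 := by
  obtain ⟨c, hc, h⟩ := exists_rootExp_eq i
  have h1 := cartan_self hn i
  rw [cartan, h, Prod.smul_fst, pairing_zsmul] at h1
  exact pos_of_mul_pos_right (h1 ▸ two_pos) hc.le

theorem reflExp_corootExp {n : ℕ} (hn : 2 ≤ n) (i : Fin (n + 1)) :
    reflExp n i (corootExp n i) = -corootExp n i := by
  obtain ⟨c, hc, h⟩ := exists_rootExp_eq i
  have h1 := cartan_self hn i
  rw [cartan, h, Prod.smul_fst, pairing_zsmul] at h1
  rw [reflExp_apply, h, smul_smul, mul_comm, h1]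
  module

theorem fst_ne_zero_of_pairing {n : ℕ} {i : Fin (n + 1)} {f : (Fin n → ℤ) × ℤ}
    (h : pairing n i f.1 ≠ 0) : f.1 ≠ 0 := by
  intro h0
  rw [h0] at h
  exact h (by simp [pairing])

theorem corootExp_fst_ne_zero {n : ℕ} (hn : 2 ≤ n) (i : Fin (n + 1)) : (corootExp n i).1 ≠ 0 :=
  fst_ne_zero_of_pairing (pairing_corootExp_self hn i).ne'

/-! ### Hecke relations for the operators `T_i` -/

section relations

variable {n : ℕ} (hn : 2 ≤ n) (t : Multiplicity n) (qh : ℂˣ)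

/-- The element `x^f` of the field of fractions of `𝒜`. -/
def fracPow (f : (Fin n → ℤ) × ℤ) : FractionRing (A n) := fracHom n (xpow qh f)

theorem fracPow_add (f g : (Fin n → ℤ) × ℤ) :
    fracPow qh (f + g) = fracPow qh f * fracPow qh g := by
  rw [fracPow, xpow_add, map_mul, fracPow, fracPow]

theorem fracPow_neg_mul (f : (Fin n → ℤ) × ℤ) : fracPow qh (-f) * fracPow qh f = 1 := by
  rw [fracPow, fracPow, ← map_mul, xpow_neg_mul, map_one]

theorem fracPow_ne_zero (f : (Fin n → ℤ) × ℤ) : fracPow qh f ≠ 0 :=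
  right_ne_zero_of_mul_eq_one (fracPow_neg_mul qh f)

theorem fracPow_neg (f : (Fin n → ℤ) × ℤ) : fracPow qh (-f) = (fracPow qh f)⁻¹ :=
  eq_inv_of_mul_eq_one_left (fracPow_neg_mul qh f)

theorem fracPow_ne_one {f : (Fin n → ℤ) × ℤ} (hf : f.1 ≠ 0) : fracPow qh f ≠ 1 := by
  intro h
  apply one_sub_xpow_ne qh hf
  apply fracHom_injective
  rw [map_sub, map_one, map_zero, sub_eq_zero]
  exact h.symm

theorem fracPow_sq_ne_one {f : (Fin n → ℤ) × ℤ} (hf : f.1 ≠ 0) : fracPow qh f ^ 2 ≠ 1 := by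
  rw [pow_two, ← fracPow_add, ← two_smul ℤ]
  exact fracPow_ne_one qh (smul_ne_zero two_ne_zero hf)

/-- After twisting by `w`, the coefficient of `T_i` is evaluated at `γ = w(a_i^∨)`. Taking `w` among
the products of two simple reflections supplies the hypotheses of `braid_three_of_eval` and
`braid_four_of_eval`. -/
theorem frac_T (w : A n →ₐ[ℂ] A n) (i : Fin (n + 1)) {γ : (Fin n → ℤ) × ℤ}
    (hw : w (xpow qh (corootExp n i)) = xpow qh γ) (hγ : γ.1 ≠ 0) (f : A n) :
    fracHom n (w (T hn t qh i f)) =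
      (algebraMap ℂ _ (t.k i : ℂ) - opCoef t i (fracPow qh γ)) * fracHom n (w f) +
        opCoef t i (fracPow qh γ) * fracHom n (w (sAct n qh i f)) := by
  have hg : ((fracHom n).comp w) (1 - xpow qh (rootExp n i)) ≠ 0 := by
    rw [map_sub, map_one, AlgHom.comp_apply]
    refine sub_ne_zero.2 (Ne.symm ?_)
    by_cases h : (i : ℕ) = 0 ∨ (i : ℕ) = n
    · rw [rootExp_eq_two_smul i h, two_smul, xpow_add, map_mul, map_mul, hw, ← pow_two]
      exact fracPow_sq_ne_one qh hγ
    · have := i.2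
      rw [rootExp_mid i (by omega) (by omega), hw]
      exact fracPow_ne_one qh hγ
  have h := eval_T hn t qh ((fracHom n).comp w) i hg f
  simpa only [AlgHom.comp_apply, hw, fracPow] using h

theorem opCoef_neg (i : Fin (n + 1)) {γ : (Fin n → ℤ) × ℤ} (hγ : γ.1 ≠ 0) :
    opCoef t i (fracPow qh (-γ)) = algebraMap ℂ (FractionRing (A n)) (t.k i) +
      (algebraMap ℂ (FractionRing (A n)) (t.k i))⁻¹ - opCoef t i (fracPow qh γ) := by
  rw [fracPow_neg, opCoef_inv t (fracPow_ne_zero qh γ) (fracPow_sq_ne_one qh hγ)]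

theorem T_quadratic (i : Fin (n + 1)) :
    (T hn t qh i - algebraMap ℂ _ (t.k i : ℂ)) *
      (T hn t qh i + algebraMap ℂ _ (((t.k i)⁻¹ : ℂˣ) : ℂ)) = 0 := by
  refine LinearMap.ext fun f => fracHom_injective n ?_
  have hα := corootExp_fst_ne_zero hn i
  have T1 := frac_T hn t qh (AlgHom.id ℂ _) i rfl hα
  have Ts := frac_T hn t qh (sAct n qh i) i (by rw [sAct_xpow, reflExp_corootExp hn])
    (γ := -corootExp n i) (by simpa using hα)
  simp only [AlgHom.id_apply, sAct_sAct hn, opCoef_neg t qh i hα] at T1 Ts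
  have hk := algebraMap_units_ne_zero (K := FractionRing (A n)) (t.k i)
  simp only [Module.End.mul_apply, LinearMap.sub_apply, LinearMap.add_apply,
    Module.algebraMap_end_apply, map_add, map_sub, map_smul, T1, Ts,
    LinearMap.zero_apply, map_zero]
  simp only [Algebra.smul_def, Units.val_inv_eq_inv_val, map_inv₀]
  field_simp
  ring

theorem T_comm {i j : Fin (n + 1)} (h : (i : ℕ) + 2 ≤ j) :
    T hn t qh i * T hn t qh j = T hn t qh j * T hn t qh i := by
  refine LinearMap.ext fun f => fracHom_injective n ?_
  have hα := corootExp_fst_ne_zero hn i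
  have hβ := corootExp_fst_ne_zero hn j
  have fix : ∀ i j : Fin (n + 1), cartan n j i = 0 →
      reflExp n i (corootExp n j) = corootExp n j := fun i j h0 => by
    obtain ⟨c, hc, hr⟩ := exists_rootExp_eq j
    rw [cartan, hr, Prod.smul_fst, pairing_zsmul] at h0
    rw [reflExp_apply, (mul_eq_zero.1 h0).resolve_left hc.ne', zero_smul, sub_zero]
  obtain ⟨c1, c2⟩ := cartan_far hn h
  have T1 := frac_T hn t qh (AlgHom.id ℂ _) i rfl hα
  have U1 := frac_T hn t qh (AlgHom.id ℂ _) j rfl hβ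
  have Tr := frac_T hn t qh (sAct n qh j) i (by rw [sAct_xpow, fix j i c1]) hα
  have Us := frac_T hn t qh (sAct n qh i) j (by rw [sAct_xpow, fix i j c2]) hβ
  simp only [AlgHom.id_apply] at T1 U1
  simp only [Module.End.mul_apply, T1, U1, Tr, Us, sAct_comm hn qh h]
  ring

theorem T_braid_three {i j : Fin (n + 1)} (h : IsSimpleEdge n i j) :
    T hn t qh i * T hn t qh j * T hn t qh i = T hn t qh j * T hn t qh i * T hn t qh j := by
  refine LinearMap.ext fun f => fracHom_injective n ?_
  have hi := h.mid_left
  have hj := h.mid_right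
  obtain ⟨c1, c2⟩ := h.cartan
  have hα := corootExp_fst_ne_zero hn i
  have hβ := corootExp_fst_ne_zero hn j
  set α := corootExp n i with hαd
  set β := corootExp n j with hβd
  have pi : pairing n i α.1 = 2 := by
    rw [hαd, ← rootExp_mid i hi.1 hi.2]; exact cartan_self hn i
  have pij : pairing n i β.1 = -1 := by
    rw [hβd, ← rootExp_mid j hj.1 hj.2]; exact c2
  have pji : pairing n j α.1 = -1 := by
    rw [hαd, ← rootExp_mid i hi.1 hi.2]; exact c1
  have hαβ : (α + β).1 ≠ 0 :=
    fst_ne_zero_of_pairing (i := i) (by rw [Prod.fst_add, pairing_add, pi, pij]; norm_num)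
  have sα : reflExp n i α = -α := reflExp_corootExp hn i
  have rβ : reflExp n j β = -β := reflExp_corootExp hn j
  have sβ : reflExp n i β = α + β := by
    rw [reflExp_apply, pij, rootExp_mid i hi.1 hi.2, ← hαd]; module
  have rα : reflExp n j α = α + β := by
    rw [reflExp_apply, pji, rootExp_mid j hj.1 hj.2, ← hβd]; module
  have kk : t.k j = t.k i := (t.k_eq_of_isSimpleEdge hn h).symm
  have cc : ∀ X : FractionRing (A n), opCoef t j X = opCoef t i X := fun X => by
    unfold opCoef
    rw [if_neg (by omega), if_neg (by omega), kk]
  have hx1 := fracPow_ne_one qh hα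
  have hy1 := fracPow_ne_one qh hβ
  have hxy1 := fracPow_ne_one qh hαβ
  have T1 := frac_T hn t qh (AlgHom.id ℂ _) i rfl hα
  have Ts := frac_T hn t qh (sAct n qh i) i (γ := -α) (by rw [sAct_xpow, ← hαd, sα])
    (by simpa using hα)
  have Tr := frac_T hn t qh (sAct n qh j) i (γ := α + β) (by rw [sAct_xpow, ← hαd, rα]) hαβ
  have Tsr := frac_T hn t qh ((sAct n qh i).comp (sAct n qh j)) i (γ := β)
    (by rw [AlgHom.comp_apply, sAct_xpow, ← hαd, rα, sAct_xpow, map_add, sα, sβ]; abel_nf) hβ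
  have U1 := frac_T hn t qh (AlgHom.id ℂ _) j rfl hβ
  have Us := frac_T hn t qh (sAct n qh i) j (γ := α + β) (by rw [sAct_xpow, ← hβd, sβ]) hαβ
  have Ur := frac_T hn t qh (sAct n qh j) j (γ := -β) (by rw [sAct_xpow, ← hβd, rβ])
    (by simpa using hβ)
  have Urs := frac_T hn t qh ((sAct n qh j).comp (sAct n qh i)) j (γ := α)
    (by rw [AlgHom.comp_apply, sAct_xpow, ← hβd, sβ, sAct_xpow, map_add, rα, rβ]; abel_nf) hα
  simp only [opCoef_neg t qh j hβ, cc, kk] at U1 Us Ur Urs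
  simp only [opCoef_neg t qh i hα] at T1 Ts Tr Tsr
  refine braid_three_of_eval (T hn t qh i) (T hn t qh j) (sAct n qh i) (sAct n qh j) (fracHom n)
    _ _ _ _ _ (sAct_sAct hn qh i) (sAct_sAct hn qh j) (sAct_braid_three hn qh h)
    T1 Ts Tr Tsr U1 Us Ur Urs ?_ f
  have hk := algebraMap_units_ne_zero (K := FractionRing (A n)) (t.k i)
  have e : ∀ X : FractionRing (A n), opCoef t i X = (algebraMap ℂ _ (t.k i : ℂ))⁻¹ *
      (1 - algebraMap ℂ _ (t.k i : ℂ) ^ 2 * X) / (1 - X) := fun X => by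
    rw [opCoef, if_neg (by omega)]
  rw [fracPow_add] at hxy1 ⊢
  simp only [e]
  generalize algebraMap ℂ (FractionRing (A n)) (t.k i : ℂ) = u at *
  generalize fracPow qh α = x at *
  generalize fracPow qh β = y at *
  have n1 : 1 - x ≠ 0 := sub_ne_zero.2 hx1.symm
  have n2 : 1 - y ≠ 0 := sub_ne_zero.2 hy1.symm
  have n3 : 1 - x * y ≠ 0 := sub_ne_zero.2 hxy1.symm
  field_simp
  ring

theorem T_braid_four {i j : Fin (n + 1)} (h : IsDoubleEdge n i j) :
    T hn t qh i * T hn t qh j * T hn t qh i * T hn t qh j =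
      T hn t qh j * T hn t qh i * T hn t qh j * T hn t qh i := by
  refine LinearMap.ext fun f => fracHom_injective n ?_
  have hi := h.end_node
  have hj := h.mid_node hn
  obtain ⟨c1, c2⟩ := h.cartan hn
  have c3 := cartan_self hn i
  have c4 := cartan_self hn j
  have hα := corootExp_fst_ne_zero hn i
  have hβ := corootExp_fst_ne_zero hn j
  have hri := rootExp_eq_two_smul i hi
  have hrj := rootExp_mid j hj.1 hj.2
  rw [cartan, hri, Prod.smul_fst, pairing_zsmul] at c1 c3
  rw [cartan, hrj] at c2 c4
  set α := corootExp n i with hαd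
  set β := corootExp n j with hβd
  have pij : pairing n j α.1 = -1 := by linarith
  have pii : pairing n i α.1 = 1 := by linarith
  have hαβ : (α + β).1 ≠ 0 :=
    fst_ne_zero_of_pairing (i := j) (by rw [Prod.fst_add, pairing_add, pij, c4]; norm_num)
  have hααβ : (α + (α + β)).1 ≠ 0 :=
    fst_ne_zero_of_pairing (i := i)
      (by rw [Prod.fst_add, Prod.fst_add, pairing_add, pairing_add, pii, c2]; norm_num)
  have sα : reflExp n i α = -α := reflExp_corootExp hn i
  have rβ : reflExp n j β = -β := reflExp_corootExp hn j
  have sβ : reflExp n i β = α + (α + β) := by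
    rw [reflExp_apply, c2, hri]; module
  have rα : reflExp n j α = α + β := by
    rw [reflExp_apply, pij, hrj]; module
  have sαβ : reflExp n i (α + β) = α + β := by rw [map_add, sα, sβ]; abel
  have rαβ : reflExp n j (α + β) = α := by rw [map_add, rα, rβ]; abel
  have rααβ : reflExp n j (α + (α + β)) = α + (α + β) := by rw [map_add, rα, rαβ]; abel
  have nα : (-α).1 ≠ 0 := by simpa using hα
  have nβ : (-β).1 ≠ 0 := by simpa using hβ
  have nαβ : (-(α + β)).1 ≠ 0 := neg_ne_zero.2 hαβ
  have nααβ : (-(α + (α + β))).1 ≠ 0 := neg_ne_zero.2 hααβ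
  have T1 := frac_T hn t qh (AlgHom.id ℂ _) i rfl hα
  have Ts := frac_T hn t qh (sAct n qh i) i (by rw [sAct_xpow, ← hαd, sα]) nα
  have Tr := frac_T hn t qh (sAct n qh j) i (by rw [sAct_xpow, ← hαd, rα]) hαβ
  have Tsr := frac_T hn t qh ((sAct n qh i).comp (sAct n qh j)) i
    (by rw [AlgHom.comp_apply, sAct_xpow, ← hαd, rα, sAct_xpow, sαβ]) hαβ
  have Trs := frac_T hn t qh ((sAct n qh j).comp (sAct n qh i)) i
    (by rw [AlgHom.comp_apply, sAct_xpow, ← hαd, sα, sAct_xpow, map_neg, rα]) nαβ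
  have Trsr := frac_T hn t qh ((sAct n qh j).comp ((sAct n qh i).comp (sAct n qh j))) i
    (by rw [AlgHom.comp_apply, AlgHom.comp_apply, sAct_xpow, ← hαd, rα, sAct_xpow, sαβ,
      sAct_xpow, rαβ]) hα
  have U1 := frac_T hn t qh (AlgHom.id ℂ _) j rfl hβ
  have Us := frac_T hn t qh (sAct n qh i) j (by rw [sAct_xpow, ← hβd, sβ]) hααβ
  have Ur := frac_T hn t qh (sAct n qh j) j (by rw [sAct_xpow, ← hβd, rβ]) nβ
  have Usr := frac_T hn t qh ((sAct n qh i).comp (sAct n qh j)) j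
    (by rw [AlgHom.comp_apply, sAct_xpow, ← hβd, rβ, sAct_xpow, map_neg, sβ]) nααβ
  have Urs := frac_T hn t qh ((sAct n qh j).comp (sAct n qh i)) j
    (by rw [AlgHom.comp_apply, sAct_xpow, ← hβd, sβ, sAct_xpow, rααβ]) hααβ
  have Usrs := frac_T hn t qh ((sAct n qh i).comp ((sAct n qh j).comp (sAct n qh i))) j
    (γ := β) (by rw [AlgHom.comp_apply, AlgHom.comp_apply, sAct_xpow, ← hβd, sβ, sAct_xpow, rααβ,
      sAct_xpow, map_add, sα, sαβ, neg_add_cancel_left]) hβ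
  rw [opCoef_neg t qh _ hα] at Ts
  rw [opCoef_neg t qh _ hαβ] at Trs
  rw [opCoef_neg t qh _ hβ] at Ur
  rw [opCoef_neg t qh _ hααβ] at Usr
  have : CharZero (FractionRing (A n)) :=
    charZero_of_injective_algebraMap (algebraMap ℂ (FractionRing (A n))).injective
  refine braid_four_of_eval (T hn t qh i) (T hn t qh j) (sAct n qh i) (sAct n qh j) (fracHom n)
    _ _ _ _ _ _ _ _ (sAct_sAct hn qh i) (sAct_sAct hn qh j) (sAct_braid_four hn qh h)
    T1 Ts Tr Tsr Trs Trsr U1 Us Ur Usr Urs Usrs ?_ f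
  have hx1 := fracPow_sq_ne_one qh hα
  have hy1 := fracPow_sq_ne_one qh hαβ
  have hz1 := fracPow_ne_one qh hβ
  have hxy1 := fracPow_ne_one qh hααβ
  have hx := fracPow_ne_zero qh α
  -- Coordinates are `x = x^α` and `y = x^{α+β}`, for the two short co-roots; then `β` and `2α+β`
  -- give `y/x` and `xy`, and the identity `R` becomes one between rational functions of `x` and
  -- `y`.
  have ez : fracPow qh β = fracPow qh (α + β) / fracPow qh α := by
    rw [eq_div_iff hx, fracPow_add, mul_comm]
  rw [fracPow_add qh α (α + β)] at hxy1 ⊢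
  rw [ez] at hz1 ⊢
  have ht := algebraMap_units_ne_zero (K := FractionRing (A n)) (t.k i)
  have hv := algebraMap_units_ne_zero (K := FractionRing (A n)) (t.kHalf i)
  have hu := algebraMap_units_ne_zero (K := FractionRing (A n)) (t.k j)
  unfold opCoef
  simp only [if_pos hi, if_neg (show ¬((j : ℕ) = 0 ∨ (j : ℕ) = n) by omega)]
  generalize algebraMap ℂ (FractionRing (A n)) (t.k i : ℂ) = a at *
  generalize algebraMap ℂ (FractionRing (A n)) (t.kHalf i : ℂ) = v at *
  generalize algebraMap ℂ (FractionRing (A n)) (t.k j : ℂ) = u at *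
  generalize fracPow qh α = x at *
  generalize fracPow qh (α + β) = y at *
  have n1 : 1 - x ^ 2 ≠ 0 := sub_ne_zero.2 hx1.symm
  have n2 : 1 - y ^ 2 ≠ 0 := sub_ne_zero.2 hy1.symm
  have n3 : 1 - x * y ≠ 0 := sub_ne_zero.2 hxy1.symm
  have n4 : x - y ≠ 0 := fun h0 => hz1 (by rw [div_eq_one_iff_eq hx]; linear_combination -h0)
  have e4 : 1 - y / x = (x - y) / x := by field_simp
  rw [e4]
  field_simp
  ring

end relations

/-! ### The defining relations of `ℱ(t; q)` in an arbitrary algebra -/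

/-- Elements `V_0, …, V_n`, `V_0^∨`, `V_n^∨` of an algebra satisfying the relations of
`ℱ(t; q)`. -/
structure IsFTuple {n : ℕ} (t : Multiplicity n) (qh : ℂˣ) {B : Type*} [Ring B] [Algebra ℂ B]
    (V : Fin (n + 1) → B) (D₀ Dₙ : B) : Prop where
  quadratic : ∀ i, (V i - algebraMap ℂ B (t.k i)) * (V i + algebraMap ℂ B ((t.k i)⁻¹ : ℂˣ)) = 0
  comm : ∀ i j : Fin (n + 1), (i : ℕ) + 2 ≤ j → V i * V j = V j * V i
  three : ∀ i j, IsSimpleEdge n i j → V i * V j * V i = V j * V i * V j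
  four : ∀ i j, IsDoubleEdge n i j → V i * V j * V i * V j = V j * V i * V j * V i
  quadratic_zero : (D₀ - algebraMap ℂ B (t.kDual 0)) *
    (D₀ + algebraMap ℂ B ((t.kDual 0)⁻¹ : ℂˣ)) = 0
  quadratic_last : (Dₙ - algebraMap ℂ B (t.kDual (Fin.last n))) *
    (Dₙ + algebraMap ℂ B ((t.kDual (Fin.last n))⁻¹ : ℂˣ)) = 0
  comm_zero : ∀ j : Fin (n + 1), 2 ≤ (j : ℕ) → D₀ * V j = V j * D₀
  comm_last : ∀ j : Fin (n + 1), (j : ℕ) + 2 ≤ n → Dₙ * V j = V j * Dₙ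
  comm_zero_last : D₀ * Dₙ = Dₙ * D₀
  four_zero : ∀ j : Fin (n + 1), (j : ℕ) = 1 → D₀ * V j * D₀ * V j = V j * D₀ * V j * D₀
  four_last : ∀ j : Fin (n + 1), (j : ℕ) + 1 = n → Dₙ * V j * Dₙ * V j = V j * Dₙ * V j * Dₙ
  cyclic : Dₙ * ((List.finRange (n + 1)).reverse.map V).prod * D₀ *
    ((List.finRange (n - 1)).map fun i : Fin (n - 1) => V ⟨(i : ℕ) + 1, by omega⟩).prod =
      algebraMap ℂ B ((qh⁻¹ : ℂˣ) : ℂ)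

section presentation

variable {n : ℕ} (hn : 2 ≤ n) {t : Multiplicity n} {qh : ℂˣ}

/-- The values on the generators of a homomorphism from `ℱ(t; q)`. -/
def genValue {B : Type*} (V : Fin (n + 1) → B) (D₀ Dₙ : B) : Gen n → B
  | Gen.V i => V i
  | Gen.V0dual => D₀
  | Gen.Vndual => Dₙ

theorem tupleDual_zero : tupleDual n 0 = FreeAlgebra.ι ℂ Gen.V0dual := by simp [tupleDual]

include hn in
theorem tupleDual_last : tupleDual n (Fin.last n) = FreeAlgebra.ι ℂ Gen.Vndual := by
  simp [tupleDual, show n ≠ 0 by omega]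

theorem tupleDual_mid (i : Fin (n + 1)) (h0 : 0 < (i : ℕ)) (h1 : (i : ℕ) < n) :
    tupleDual n i = tuple n i := by
  simp [tupleDual, tuple, h0.ne', h1.ne]

/-- Together with `isFTuple_gen` this says that `F` is universal among tuples satisfying `IsFTuple`.
The relations among the middle generators occur in both Hecke families but are kept once, since
`t_i^∨ = t_i` there; the two extra commutators of relation 3 are absorbed in `comm_zero` and
`comm_last`. -/
theorem IsFTuple.lift_eq {B : Type*} [Ring B] [Algebra ℂ B] {V : Fin (n + 1) → B}
    {D₀ Dₙ : B} (hn : 2 ≤ n) (h : IsFTuple t qh V D₀ Dₙ) ⦃a b : FreeAlgebra ℂ (Gen n)⦄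
    (hab : FRel t qh a b) :
    FreeAlgebra.lift ℂ (genValue V D₀ Dₙ) a = FreeAlgebra.lift ℂ (genValue V D₀ Dₙ) b := by
  set g := FreeAlgebra.lift ℂ (genValue V D₀ Dₙ) with hg
  have gV : ∀ i, g (FreeAlgebra.ι ℂ (Gen.V i)) = V i := fun i => by simp [hg, genValue]
  have gt : ∀ i, g (tuple n i) = V i := gV
  have g0 : g (FreeAlgebra.ι ℂ Gen.V0dual) = D₀ := by simp [hg, genValue]
  have gn : g (FreeAlgebra.ι ℂ Gen.Vndual) = Dₙ := by simp [hg, genValue]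
  have gd0 : g (tupleDual n 0) = D₀ := by rw [tupleDual_zero, g0]
  have gdn : g (tupleDual n (Fin.last n)) = Dₙ := by rw [tupleDual_last hn, gn]
  have gd : ∀ i : Fin (n + 1), 0 < (i : ℕ) → (i : ℕ) < n → g (tupleDual n i) = V i :=
    fun i h0 h1 => by rw [tupleDual_mid i h0 h1, gt]
  cases hab with
  | hecke _ _ hab =>
    cases hab with
    | quadratic i => simpa [gt] using h.quadratic i
    | braid_four i j hj hi =>
      simp only [map_mul, gt]
      rcases hi with hi | hi
      · exact h.four i j (Or.inl ⟨Fin.ext hi, by omega⟩)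
      · exact (h.four j i (Or.inr ⟨Fin.ext (by simp; omega), hi⟩)).symm
    | braid_three i j hj hi hi' =>
      simp only [map_mul, gt]
      exact h.three i j ⟨hj, hi, hi'⟩
    | comm i j hij =>
      simp only [map_mul, gt]
      exact h.comm i j hij
  | heckeDual _ _ hab =>
    cases hab with
    | quadratic i =>
      rcases simple_index_cases i with rfl | rfl | ⟨h0, h1⟩
      · simpa [gd0] using h.quadratic_zero
      · simpa [gdn] using h.quadratic_last
      · simpa [gd i h0 h1, t.kDual_mid hn i h0 h1] using h.quadratic i
    | braid_four i j hj hi =>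
      simp only [map_mul]
      rcases hi with hi | hi
      · obtain rfl : i = 0 := Fin.ext hi
        rw [gd0, gd j (by omega) (by omega)]
        exact h.four_zero j (by omega)
      · obtain rfl : j = Fin.last n := Fin.ext (by simp; omega)
        rw [gdn, gd i (by omega) (by omega)]
        exact (h.four_last i hi).symm
    | braid_three i j hj hi hi' =>
      simp only [map_mul]
      rw [gd i (by omega) (by omega), gd j (by omega) (by omega)]
      exact h.three i j ⟨hj, hi, hi'⟩
    | comm i j hij =>
      simp only [map_mul]
      rcases simple_index_cases i with rfl | rfl | ⟨h0, h1⟩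
      · rcases simple_index_cases j with rfl | rfl | ⟨h2, h3⟩
        · simp at hij
        · rw [gd0, gdn, h.comm_zero_last]
        · rw [gd0, gd j h2 h3, h.comm_zero j (by simpa using hij)]
      · have := j.2
        simp at hij; omega
      · rcases simple_index_cases j with rfl | rfl | ⟨h2, h3⟩
        · simp at hij
        · rw [gd i h0 h1, gdn, h.comm_last i (by simpa using hij)]
        · rw [gd i h0 h1, gd j h2 h3, h.comm i j hij]
  | cyclic =>
    have e1 : g ∘ tuple n = V := funext gt
    have e2 : (g ∘ fun i : Fin (n - 1) => tuple n ⟨(i : ℕ) + 1, by omega⟩) =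
        fun i : Fin (n - 1) => V ⟨(i : ℕ) + 1, by omega⟩ := funext fun i => gt _
    rw [cyclicProduct, AlgHom.commutes, map_mul, map_mul, map_mul, g0, gn, map_list_prod,
      map_list_prod, List.map_map, List.map_map, e1, e2, ← h.cyclic]
  | comm_zero => rw [map_mul, map_mul, gV, gn, h.comm_last 0 (by simpa using hn)]
  | comm_last => rw [map_mul, map_mul, gV, g0, h.comm_zero _ (by simpa using hn)]

/-- The homomorphism from `ℱ(t; q)` given by elements which satisfy the defining relations. -/
def IsFTuple.hom {B : Type} [Ring B] [Algebra ℂ B] {V : Fin (n + 1) → B}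
    {D₀ Dₙ : B} (hn : 2 ≤ n) (h : IsFTuple t qh V D₀ Dₙ) : F t qh →ₐ[ℂ] B :=
  RingQuot.liftAlgHom ℂ ⟨FreeAlgebra.lift ℂ (genValue V D₀ Dₙ), h.lift_eq hn⟩

theorem IsFTuple.hom_gen {B : Type} [Ring B] [Algebra ℂ B] {V : Fin (n + 1) → B}
    {D₀ Dₙ : B} (hn : 2 ≤ n) (h : IsFTuple t qh V D₀ Dₙ) (g : Gen n) :
    h.hom hn (gen t qh g) = genValue V D₀ Dₙ g := by
  rw [IsFTuple.hom, gen, RingQuot.liftAlgHom_mkAlgHom_apply, FreeAlgebra.lift_ι_apply]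

variable (t qh) in
include hn in
theorem isFTuple_gen : IsFTuple t qh (fun i => gen t qh (Gen.V i)) (gen t qh Gen.V0dual)
    (gen t qh Gen.Vndual) := by
  set g := RingQuot.mkAlgHom ℂ (FRel t qh) with hg
  have gt : ∀ i, g (tuple n i) = gen t qh (Gen.V i) := fun i => rfl
  have g0 : g (FreeAlgebra.ι ℂ Gen.V0dual) = gen t qh Gen.V0dual := rfl
  have gn : g (FreeAlgebra.ι ℂ Gen.Vndual) = gen t qh Gen.Vndual := rfl
  have gV : ∀ i, g (FreeAlgebra.ι ℂ (Gen.V i)) = gen t qh (Gen.V i) := fun i => rfl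
  have gd0 : g (tupleDual n 0) = gen t qh Gen.V0dual := by rw [tupleDual_zero, g0]
  have gdn : g (tupleDual n (Fin.last n)) = gen t qh Gen.Vndual := by rw [tupleDual_last hn, gn]
  have gd : ∀ i : Fin (n + 1), 0 < (i : ℕ) → (i : ℕ) < n →
      g (tupleDual n i) = gen t qh (Gen.V i) :=
    fun i h0 h1 => by rw [tupleDual_mid i h0 h1, gt]
  have rel : ∀ {a b}, FRel t qh a b → g a = g b := fun h => RingQuot.mkAlgHom_rel ℂ h
  have r1 : ∀ {a b}, HeckeRel t.k (tuple n) a b → g a = g b := fun h => rel (FRel.hecke _ _ h)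
  have r2 : ∀ {a b}, HeckeRel t.kDual (tupleDual n) a b → g a = g b :=
    fun h => rel (FRel.heckeDual _ _ h)
  refine ⟨fun i => ?_, fun i j h => ?_, fun i j h => ?_, fun i j h => ?_, ?_, ?_, fun j h => ?_,
    fun j h => ?_, ?_, fun j h => ?_, fun j h => ?_, ?_⟩
  · simpa only [map_mul, map_sub, map_add, AlgHom.commutes, map_zero, gt] using
      r1 (HeckeRel.quadratic i)
  · simpa only [map_mul, gt] using r1 (HeckeRel.comm i j h)
  · simpa only [map_mul, gt] using r1 (HeckeRel.braid_three i j h.1 h.2.1 h.2.2)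
  · rcases h with ⟨rfl, hj⟩ | ⟨rfl, hj⟩
    · simpa only [map_mul, gt] using r1 (HeckeRel.braid_four 0 j (by simpa using hj) (by simp))
    · simpa only [map_mul, gt] using
        (r1 (HeckeRel.braid_four j (Fin.last n) (by simp; omega) (Or.inr hj))).symm
  · simpa only [map_mul, map_sub, map_add, AlgHom.commutes, map_zero, gd0] using
      r2 (HeckeRel.quadratic 0)
  · simpa only [map_mul, map_sub, map_add, AlgHom.commutes, map_zero, gdn] using
      r2 (HeckeRel.quadratic (Fin.last n))
  · rcases simple_index_cases j with rfl | rfl | ⟨h2, h3⟩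
    · simp at h
    · simpa only [map_mul, g0, gV] using rel FRel.comm_last
    · simpa only [map_mul, gd0, gd j h2 h3] using r2 (HeckeRel.comm 0 j (by simpa using h))
  · rcases simple_index_cases j with rfl | rfl | ⟨h2, h3⟩
    · simpa only [map_mul, gn, gV] using (rel FRel.comm_zero).symm
    · simp at h
    · simpa only [map_mul, gdn, gd j h2 h3] using
        (r2 (HeckeRel.comm j (Fin.last n) (by simpa using h))).symm
  · simpa only [map_mul, gdn, gd0] using r2 (HeckeRel.comm 0 (Fin.last n) (by simpa using hn))
  · simpa only [map_mul, gd0, gd j (by omega) (by omega)] using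
      r2 (HeckeRel.braid_four 0 j (by simpa using h) (by simp))
  · simpa only [map_mul, gdn, gd j (by omega) (by omega)] using
      (r2 (HeckeRel.braid_four j (Fin.last n) (by simp; omega) (Or.inr h))).symm
  · have h := rel (FRel.cyclic (t := t) (qh := qh))
    rw [cyclicProduct, AlgHom.commutes, map_mul, map_mul, map_mul, g0, gn, map_list_prod,
      map_list_prod, List.map_map, List.map_map] at h
    exact h

end presentation

/-! ### Quadratic relations -/

section quadratic

variable {B : Type*} [Ring B] [Algebra ℂ B]

/-- An element satisfying a quadratic Hecke relation, as a unit. -/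
def heckeUnit (c : ℂˣ) (X : B)
    (h : (X - algebraMap ℂ B c) * (X + algebraMap ℂ B (c⁻¹ : ℂˣ)) = 0) : Bˣ :=
  have hc : algebraMap ℂ B c * algebraMap ℂ B (c⁻¹ : ℂˣ) = 1 := by
    rw [← map_mul, Units.mul_inv, map_one]
  { val := X
    inv := X - algebraMap ℂ B c + algebraMap ℂ B (c⁻¹ : ℂˣ)
    val_inv := by
      rw [sub_mul, mul_add, mul_add, hc] at h
      rw [mul_add, mul_sub, ← Algebra.commutes (c : ℂ) X]
      rw [← sub_eq_zero]
      refine Eq.trans ?_ h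
      abel
    inv_val := by
      rw [sub_mul, mul_add, mul_add, hc, ← Algebra.commutes ((c⁻¹ : ℂˣ) : ℂ) X] at h
      rw [add_mul, sub_mul]
      rw [← sub_eq_zero]
      refine Eq.trans ?_ h
      abel }

/-- The quadratic relation amounts to the formula `X⁻¹ = X - c + c⁻¹`, so for an explicit unit it
can be checked by computing its inverse. -/
theorem quadratic_iff (c : ℂˣ) (X : B) :
    (X - algebraMap ℂ B c) * (X + algebraMap ℂ B (c⁻¹ : ℂˣ)) = 0 ↔
      X * (X - algebraMap ℂ B c + algebraMap ℂ B (c⁻¹ : ℂˣ)) = 1 := by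
  have hc : algebraMap ℂ B c * algebraMap ℂ B (c⁻¹ : ℂˣ) = 1 := by
    rw [← map_mul, Units.mul_inv, map_one]
  rw [sub_mul, mul_add, mul_add, hc, mul_add, mul_sub, ← Algebra.commutes (c : ℂ) X,
    ← sub_eq_zero (b := (1 : B))]
  refine Eq.congr ?_ rfl
  abel

end quadratic

/-! ### Products of generators -/

/-- Extension of a tuple by `1` to all natural indices. -/
def extendNat {n : ℕ} {B : Type*} [One B] (V : Fin (n + 1) → B) (i : ℕ) : B :=
  if h : i < n + 1 then V ⟨i, h⟩ else 1

theorem extendNat_of_lt {n : ℕ} {B : Type*} [One B] (V : Fin (n + 1) → B) {i : ℕ}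
    (h : i < n + 1) : extendNat V i = V ⟨i, h⟩ := dif_pos h

/-- The palindromic part of the cyclic word is built from the inside out by `Z ↦ X Z X`, the
recursion that defines the `z_k`. -/
theorem prod_descending_ascending {B : Type*} [Monoid B] (X : ℕ → B) (D : B) (Z : ℕ → B)
    (h0 : Z 0 = X 0 * D) (hs : ∀ k, Z (k + 1) = X (k + 1) * Z k * X (k + 1)) (k : ℕ) :
    ((List.range (k + 1)).reverse.map X).prod * D *
      ((List.range k).map fun i => X (i + 1)).prod = Z k := by
  induction k with
  | zero => simp [h0]
  | succ k ih =>
    rw [hs, ← ih, List.range_succ (n := k + 1), List.range_succ (n := k)]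
    simp [mul_assoc]

theorem cyclic_prod_eq {n : ℕ} (hn : 2 ≤ n) {B : Type*} [Monoid B] (V : Fin (n + 1) → B)
    (D₀ Dₙ : B) (Z : ℕ → B) (h0 : Z 0 = V 0 * D₀)
    (hs : ∀ k (hk : k + 1 < n), Z (k + 1) = V ⟨k + 1, by omega⟩ * Z k * V ⟨k + 1, by omega⟩) :
    Dₙ * ((List.finRange (n + 1)).reverse.map V).prod * D₀ *
      ((List.finRange (n - 1)).map fun i : Fin (n - 1) => V ⟨(i : ℕ) + 1, by omega⟩).prod =
      Dₙ * V (Fin.last n) * Z (n - 1) := by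
  obtain ⟨m, rfl⟩ : ∃ m, n = m + 1 := ⟨n - 1, by omega⟩
  -- The recursion for `Z` is known only below `n`; `Z'` satisfies it at every index, with missing
  -- generators replaced by `1`.
  set Z' : ℕ → B := fun k => Nat.rec (V 0 * D₀)
    (fun k z => extendNat V (k + 1) * z * extendNat V (k + 1)) k with hZ'
  have eZ : ∀ k, k < m + 1 → Z k = Z' k := fun k => by
    induction k with
    | zero => exact fun _ => h0
    | succ k ih =>
      intro hk
      rw [hs k hk, ih (by omega), ← extendNat_of_lt V (by omega : k + 1 < m + 1 + 1)]
  have e1 : (List.finRange (m + 1 + 1)).reverse.map V =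
      (List.range (m + 1 + 1)).reverse.map (extendNat V) := by
    rw [← List.map_coe_finRange_eq_range, ← List.map_reverse, List.map_map]
    exact List.map_congr_left fun i _ => (extendNat_of_lt V i.2).symm
  have e2 : ((List.finRange (m + 1 - 1)).map
      fun i : Fin (m + 1 - 1) => V ⟨(i : ℕ) + 1, by omega⟩) =
      (List.range m).map fun i => extendNat V (i + 1) := by
    rw [← List.map_coe_finRange_eq_range, List.map_map]
    exact List.map_congr_left fun i _ => (extendNat_of_lt V _).symm
  have h := prod_descending_ascending (extendNat V) D₀ Z'
    (by rw [extendNat_of_lt V (by omega : 0 < m + 1 + 1)]; rfl) (fun k => rfl) m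
  have hl : extendNat V (m + 1) = V (Fin.last (m + 1)) := extendNat_of_lt V (by omega)
  rw [e1, e2, eZ _ (by omega), Nat.add_sub_cancel, ← h, List.range_succ, List.reverse_append,
    List.map_append, List.prod_append]
  simp [hl, mul_assoc]

/-! ### Cross relations for the difference-reflection operators -/

theorem mulOp_apply {n : ℕ} (f g : A n) : mulOp f g = f * g := rfl

theorem mulOp_mul {n : ℕ} (f g : A n) : mulOp (f * g) = mulOp f * mulOp g :=
  LinearMap.ext fun h => by simp [mulOp_apply, mul_assoc]

theorem mulOp_one (n : ℕ) : mulOp (1 : A n) = 1 :=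
  LinearMap.ext fun h => by simp [mulOp_apply]

section cross

variable {n : ℕ} (hn : 2 ≤ n) (t : Multiplicity n) (qh : ℂˣ)

theorem divDiff_mul (i : Fin (n + 1)) (f g : A n) :
    divDiff hn qh i (f * g) = divDiff hn qh i f * g + sAct n qh i f * divDiff hn qh i g := by
  apply mul_left_cancel₀ (one_sub_xpow_ne_zero hn qh i)
  have h1 := divDiff_spec hn qh i f
  have h2 := divDiff_spec hn qh i g
  rw [divDiff_spec, map_mul]
  linear_combination -g * h1 - sAct n qh i f * h2

/-- The polynomial `t⁻¹ v_{a_i} (1 - x^{a_i}) - t (1 - x^{a_i})`. -/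
def crossNum (i : Fin (n + 1)) : A n :=
  (((t.k i)⁻¹ : ℂˣ) : ℂ) • vNum t qh i - (t.k i : ℂ) • (1 - xpow qh (rootExp n i))

/-- The cross relation of Bernstein and Lusztig at operator level. It comes from the twisted Leibniz
rule `divDiff_mul`. -/
theorem T_mul_mulOp (i : Fin (n + 1)) (f : A n) :
    T hn t qh i * mulOp f =
      mulOp (sAct n qh i f) * T hn t qh i + mulOp (crossNum t qh i * divDiff hn qh i f) := by
  refine LinearMap.ext fun g => ?_
  have hT : ∀ f, T hn t qh i f = (t.k i : ℂ) • f +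
      (((t.k i)⁻¹ : ℂˣ) : ℂ) • (vNum t qh i * divDiff hn qh i f) := fun f => rfl
  have h1 := divDiff_spec hn qh i f
  simp only [Module.End.mul_apply, LinearMap.add_apply, mulOp_apply, hT, divDiff_mul, crossNum,
    Algebra.smul_def]
  linear_combination algebraMap ℂ (A n) (t.k i) * g * h1

theorem divDiff_eq_zero {i : Fin (n + 1)} {f : A n} (h : sAct n qh i f = f) :
    divDiff hn qh i f = 0 := by
  apply mul_left_cancel₀ (one_sub_xpow_ne_zero hn qh i)
  rw [divDiff_spec, h, sub_self, mul_zero]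

theorem commute_T_mulOp {i : Fin (n + 1)} {f : A n} (h : sAct n qh i f = f) :
    Commute (T hn t qh i) (mulOp f) := by
  have := T_mul_mulOp hn t qh i f
  rw [h, divDiff_eq_zero hn qh h, mul_zero] at this
  rw [Commute, SemiconjBy, this, show mulOp (0 : A n) = 0 from LinearMap.ext fun g => zero_mul g,
    add_zero]

theorem commute_T_xpow {i : Fin (n + 1)} {f : (Fin n → ℤ) × ℤ} (h : pairing n i f.1 = 0) :
    Commute (T hn t qh i) (mulOp (xpow qh f)) :=
  commute_T_mulOp hn t qh (by rw [sAct_xpow, reflExp_apply, h, zero_smul, sub_zero])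

/-- The operator `T_i` as a unit. -/
def TUnit (i : Fin (n + 1)) : (Module.End ℂ (A n))ˣ :=
  heckeUnit (t.k i) (T hn t qh i) (T_quadratic hn t qh i)

theorem coe_TUnit (i : Fin (n + 1)) : (TUnit hn t qh i : Module.End ℂ (A n)) = T hn t qh i := rfl

theorem coe_inv_TUnit (i : Fin (n + 1)) :
    (↑(TUnit hn t qh i)⁻¹ : Module.End ℂ (A n)) = T hn t qh i - algebraMap ℂ _ (t.k i : ℂ) +
      algebraMap ℂ _ (((t.k i)⁻¹ : ℂˣ) : ℂ) := rfl

/-- Multiplication by `x^f` as a unit. -/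
def xUnit (f : (Fin n → ℤ) × ℤ) : (Module.End ℂ (A n))ˣ where
  val := mulOp (xpow qh f)
  inv := mulOp (xpow qh (-f))
  val_inv := by rw [← mulOp_mul, mul_comm, xpow_neg_mul, mulOp_one]
  inv_val := by rw [← mulOp_mul, xpow_neg_mul, mulOp_one]

theorem coe_xUnit (f : (Fin n → ℤ) × ℤ) :
    (xUnit qh f : Module.End ℂ (A n)) = mulOp (xpow qh f) := rfl

theorem coe_inv_xUnit (f : (Fin n → ℤ) × ℤ) :
    (↑(xUnit qh f)⁻¹ : Module.End ℂ (A n)) = mulOp (xpow qh (-f)) := rfl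

/-- At a middle node the correction factor `crossNum` is the constant `t⁻¹ - t`, and the divided
difference of `x^f` is `x^{s_i f}`. The cross relation then becomes `T_i x^f = x^{s_i f} T_i⁻¹`. -/
theorem T_xpow_T_mid {i : Fin (n + 1)} (h0 : 0 < (i : ℕ)) (h1 : (i : ℕ) < n)
    {f : (Fin n → ℤ) × ℤ} (hf : pairing n i f.1 = 1) :
    TUnit hn t qh i * xUnit qh f * TUnit hn t qh i = xUnit qh (reflExp n i f) := by
  rw [← eq_mul_inv_iff_mul_eq]
  ext1
  have hr : f = reflExp n i f + rootExp n i := by rw [reflExp_apply, hf]; module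
  have hd : divDiff hn qh i (xpow qh f) = xpow qh (reflExp n i f) := by
    apply mul_left_cancel₀ (one_sub_xpow_ne_zero hn qh i)
    rw [divDiff_spec, sAct_xpow, sub_mul, ← xpow_add, one_mul, add_comm, ← hr]
  have hc : crossNum t qh i = algebraMap ℂ (A n) (((t.k i)⁻¹ : ℂˣ) : ℂ) -
      algebraMap ℂ (A n) (t.k i : ℂ) := by
    have hk : algebraMap ℂ (A n) (((t.k i)⁻¹ : ℂˣ) : ℂ) * algebraMap ℂ (A n) (t.k i : ℂ) = 1 := by
      rw [← map_mul, Units.inv_mul, map_one]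
    rw [crossNum, vNum, if_neg (by omega)]
    simp only [Algebra.smul_def, Units.val_pow_eq_pow_val, map_pow]
    linear_combination (-algebraMap ℂ (A n) (t.k i : ℂ)) * xpow qh (rootExp n i) * hk
  rw [Units.val_mul, Units.val_mul, coe_TUnit, coe_xUnit, T_mul_mulOp, sAct_xpow, hd, hc,
    coe_xUnit, coe_inv_TUnit, mul_comm _ (xpow qh _), mulOp_mul]
  have : mulOp (algebraMap ℂ (A n) (((t.k i)⁻¹ : ℂˣ) : ℂ) - algebraMap ℂ (A n) (t.k i : ℂ)) =
      algebraMap ℂ (Module.End ℂ (A n)) (((t.k i)⁻¹ : ℂˣ) : ℂ) -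
        algebraMap ℂ (Module.End ℂ (A n)) (t.k i : ℂ) := by
    refine LinearMap.ext fun g => ?_
    simp [mulOp_apply, sub_mul, Algebra.smul_def]
  rw [this]
  noncomm_ring

/-- Here the parameter `t_{a_i/2} = t_i^∨` enters. The left side is the inverse of
`x^{-a_i^∨}T_i⁻¹`, so this is the quadratic relation for that operator, in the form of
`quadratic_iff`. -/
theorem T_xpow_end {i : Fin (n + 1)} (h : (i : ℕ) = 0 ∨ (i : ℕ) = n) :
    T hn t qh i * mulOp (xpow qh (corootExp n i)) =
      mulOp (xpow qh (-corootExp n i)) * (↑(TUnit hn t qh i)⁻¹ : Module.End ℂ (A n)) +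
        (algebraMap ℂ _ (((t.kDual i)⁻¹ : ℂˣ) : ℂ) - algebraMap ℂ _ (t.kDual i : ℂ)) := by
  rw [t.kDual_end hn i h, T_mul_mulOp, sAct_xpow, reflExp_corootExp hn, coe_inv_TUnit]
  have hX := xpow_neg_mul qh (corootExp n i)
  have hr : xpow qh (rootExp n i) = xpow qh (corootExp n i) ^ 2 := by
    rw [rootExp_eq_two_smul i h, two_smul, xpow_add, pow_two]
  have hd : divDiff hn qh i (xpow qh (corootExp n i)) = xpow qh (-corootExp n i) := by
    apply mul_left_cancel₀ (one_sub_xpow_ne_zero hn qh i)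
    rw [divDiff_spec, sAct_xpow, reflExp_corootExp hn, hr]
    linear_combination xpow qh (corootExp n i) * hX
  have hk : algebraMap ℂ (A n) (((t.k i)⁻¹ : ℂˣ) : ℂ) * algebraMap ℂ (A n) (t.k i : ℂ) = 1 := by
    rw [← map_mul, Units.inv_mul, map_one]
  have hv : algebraMap ℂ (A n) (((t.kHalf i)⁻¹ : ℂˣ) : ℂ) * algebraMap ℂ (A n) (t.kHalf i : ℂ) =
      1 := by
    rw [← map_mul, Units.inv_mul, map_one]
  refine LinearMap.ext fun g => ?_
  rw [hd, crossNum, vNum, if_pos h, hr]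
  simp only [LinearMap.add_apply, LinearMap.sub_apply, Module.End.mul_apply, mulOp_apply,
    Module.algebraMap_end_apply, Algebra.smul_def, Units.val_mul, map_mul]
  generalize xpow qh (corootExp n i) = X at *
  generalize xpow qh (-corootExp n i) = Y at *
  generalize algebraMap ℂ (A n) (t.k i : ℂ) = k at *
  generalize algebraMap ℂ (A n) (((t.k i)⁻¹ : ℂˣ) : ℂ) = k' at *
  generalize algebraMap ℂ (A n) (t.kHalf i : ℂ) = v at *
  generalize algebraMap ℂ (A n) (((t.kHalf i)⁻¹ : ℂˣ) : ℂ) = v' at *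
  linear_combination (g * (v' - v) * k * k') * hX + (g * (v' - v) - X ^ 2 * Y * k * v * v' * g) * hk -
    X ^ 2 * Y * k * g * hv

/-- The operator `T_0⁻¹ x^{-a_0^∨}` as a unit. -/
def dualZeroUnit : (Module.End ℂ (A n))ˣ := (TUnit hn t qh 0)⁻¹ * (xUnit qh (corootExp n 0))⁻¹

/-- The operator `x^{-a_n^∨} T_n⁻¹` as a unit. -/
def dualLastUnit : (Module.End ℂ (A n))ˣ :=
  (xUnit qh (corootExp n (Fin.last n)))⁻¹ * (TUnit hn t qh (Fin.last n))⁻¹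

theorem dualLast_quadratic :
    ((dualLastUnit hn t qh : Module.End ℂ (A n)) - algebraMap ℂ _ (t.kDual (Fin.last n) : ℂ)) *
      (dualLastUnit hn t qh + algebraMap ℂ _ (((t.kDual (Fin.last n))⁻¹ : ℂˣ) : ℂ)) = 0 := by
  rw [quadratic_iff]
  have h := T_xpow_end hn t qh (i := Fin.last n) (by simp)
  rw [← coe_TUnit, ← coe_xUnit, ← coe_inv_xUnit, ← Units.val_mul, ← Units.val_mul] at h
  change _ = (dualLastUnit hn t qh : Module.End ℂ (A n)) + _ at h
  rw [show ∀ a b c : Module.End ℂ (A n), a - b + c = a + (c - b) by intros; abel, ← h,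
    ← Units.val_mul, dualLastUnit]
  simp

theorem dualZero_quadratic :
    ((dualZeroUnit hn t qh : Module.End ℂ (A n)) - algebraMap ℂ _ (t.kDual 0 : ℂ)) *
      (dualZeroUnit hn t qh + algebraMap ℂ _ (((t.kDual 0)⁻¹ : ℂˣ) : ℂ)) = 0 := by
  rw [quadratic_iff]
  have h := T_xpow_end hn t qh (i := 0) (by simp)
  rw [← coe_TUnit, ← coe_xUnit, ← coe_inv_xUnit, ← map_sub] at h
  set X := xUnit qh (corootExp n 0)
  set U := TUnit hn t qh 0
  set c : ℂ := (((t.kDual 0)⁻¹ : ℂˣ) : ℂ) - (t.kDual 0 : ℂ) with hc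
  -- At the node `0` the factors stand in the opposite order; conjugation by `x^{a_0^∨}` takes one
  -- order to the other.
  have h2 : (↑(X * U) : Module.End ℂ (A n)) =
      (dualZeroUnit hn t qh : Module.End ℂ (A n)) + algebraMap ℂ _ c := by
    have h3 : (↑(X * U) : Module.End ℂ (A n)) = X * (U * X) * (↑X⁻¹ : Module.End ℂ (A n)) := by
      rw [mul_assoc, mul_assoc, Units.mul_inv, mul_one, Units.val_mul]
    rw [h3, h, mul_add, add_mul, ← mul_assoc, Units.mul_inv, one_mul, ← Algebra.commutes c,
      mul_assoc, Units.mul_inv, mul_one, dualZeroUnit, Units.val_mul]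
  rw [show ∀ a b c : Module.End ℂ (A n), a - b + c = a + (c - b) by intros; abel, ← map_sub,
    ← hc, ← h2, ← Units.val_mul, dualZeroUnit]
  simp [X, U]

theorem commute_units_iff {M : Type*} [Monoid M] {u v : Mˣ} :
    Commute u v ↔ Commute (u : M) (v : M) :=
  ⟨fun h => h.units_val, fun h => h.units_of_val⟩

theorem xUnit_add (f g : (Fin n → ℤ) × ℤ) : xUnit qh (f + g) = xUnit qh f * xUnit qh g := by
  ext1
  rw [Units.val_mul, coe_xUnit, coe_xUnit, coe_xUnit, xpow_add, mulOp_mul]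

theorem commute_xUnit (f g : (Fin n → ℤ) × ℤ) : Commute (xUnit qh f) (xUnit qh g) := by
  rw [Commute, SemiconjBy, ← xUnit_add, add_comm, xUnit_add]

theorem commute_TUnit_xUnit {i : Fin (n + 1)} {f : (Fin n → ℤ) × ℤ} (h : pairing n i f.1 = 0) :
    Commute (TUnit hn t qh i) (xUnit qh f) :=
  commute_units_iff.2 (commute_T_xpow hn t qh h)

theorem commute_TUnit {i j : Fin (n + 1)} (h : (i : ℕ) + 2 ≤ j) :
    Commute (TUnit hn t qh i) (TUnit hn t qh j) :=
  commute_units_iff.2 (T_comm hn t qh h)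

end cross

/-! ### Braid relations of the dual generators as group identities -/

/-- Applied with `a = T_0`, `b = T_1`, `z = x^{-a_0^∨}`. Then `b z b` is `q^{-1/2}x_2`, which
commutes with `T_0` and with `z`; sliding it past `a⁻¹` leaves the braid relation between `a⁻¹` and
`b`. -/
theorem braid_four_inv_mul {G : Type*} [Group G] {a b z : G}
    (h1 : Commute z (b * z * b)) (h2 : Commute a (b * z * b))
    (h3 : a * b * a * b = b * a * b * a) :
    a⁻¹ * z * b * (a⁻¹ * z) * b = b * (a⁻¹ * z) * b * (a⁻¹ * z) := by
  have h4 : a⁻¹ * b⁻¹ * a⁻¹ * b = b * a⁻¹ * b⁻¹ * a⁻¹ := by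
    have h5 := congrArg (·⁻¹) h3
    simp only [mul_inv_rev] at h5
    calc a⁻¹ * b⁻¹ * a⁻¹ * b = b * (b⁻¹ * (a⁻¹ * (b⁻¹ * a⁻¹))) * b := by group
      _ = b * (a⁻¹ * (b⁻¹ * (a⁻¹ * b⁻¹))) * b := by rw [h5]
      _ = b * a⁻¹ * b⁻¹ * a⁻¹ := by group
  calc a⁻¹ * z * b * (a⁻¹ * z) * b = a⁻¹ * b⁻¹ * ((b * z * b) * a⁻¹) * (z * b) := by group
    _ = a⁻¹ * b⁻¹ * (a⁻¹ * (b * z * b)) * (z * b) := by rw [h2.inv_left.eq]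
    _ = a⁻¹ * b⁻¹ * a⁻¹ * b * (z * (b * z * b)) := by group
    _ = b * a⁻¹ * b⁻¹ * (a⁻¹ * (b * z * b)) * z := by rw [h4, h1.eq]; group
    _ = b * a⁻¹ * b⁻¹ * ((b * z * b) * a⁻¹) * z := by rw [h2.inv_left.eq]
    _ = b * (a⁻¹ * z) * b * (a⁻¹ * z) := by group

/-- Applied with `a = T_n`, `b = T_{n-1}`, `z = x_{n-1}`, so that `b z b = x_n`. The relation is
proved for the inverses `a(bzb)` and `b⁻¹`, where `z` can be moved past `a`. -/
theorem braid_four_mul_inv {G : Type*} [Group G] {a b z : G}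
    (h1 : Commute z (b * z * b)) (h2 : Commute a z)
    (h3 : a * b * a * b = b * a * b * a) :
    (b * z * b)⁻¹ * a⁻¹ * b * ((b * z * b)⁻¹ * a⁻¹) * b =
      b * ((b * z * b)⁻¹ * a⁻¹) * b * ((b * z * b)⁻¹ * a⁻¹) := by
  have h4 : a * b * a * b⁻¹ = b⁻¹ * a * b * a := by
    calc a * b * a * b⁻¹ = b⁻¹ * (b * a * b * a) * b⁻¹ := by group
      _ = b⁻¹ * (a * b * a * b) * b⁻¹ := by rw [h3]
      _ = b⁻¹ * a * b * a := by group
  have key : a * (b * z * b) * b⁻¹ * (a * (b * z * b)) * b⁻¹ =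
      b⁻¹ * (a * (b * z * b)) * b⁻¹ * (a * (b * z * b)) := by
    calc a * (b * z * b) * b⁻¹ * (a * (b * z * b)) * b⁻¹ = a * b * (z * a) * (b * z) := by group
      _ = a * b * a * b⁻¹ * ((b * z * b) * z) := by rw [← h2.eq]; group
      _ = b⁻¹ * a * b * a * (z * (b * z * b)) := by rw [h4, h1.eq]
      _ = b⁻¹ * a * b * (a * z) * (b * z * b) := by group
      _ = b⁻¹ * (a * (b * z * b)) * b⁻¹ * (a * (b * z * b)) := by rw [h2.eq]; group
  calc (b * z * b)⁻¹ * a⁻¹ * b * ((b * z * b)⁻¹ * a⁻¹) * b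
      = (b⁻¹ * (a * (b * z * b)) * b⁻¹ * (a * (b * z * b)))⁻¹ := by group
    _ = (a * (b * z * b) * b⁻¹ * (a * (b * z * b)) * b⁻¹)⁻¹ := by rw [key]
    _ = _ := by group

/-! ### The operators satisfy the relations of `F` -/

section tuple

variable {n : ℕ} (hn : 2 ≤ n) (t : Multiplicity n) (qh : ℂˣ)

/-- The operator of multiplication by `x_{k+1}`, where `k` is a natural number. -/
def coordUnit (n : ℕ) (qh : ℂˣ) (k : ℕ) : (Module.End ℂ (A n))ˣ := xUnit qh (eps n (k + 1), 0)

theorem eps_of_lt {k : ℕ} (hk : k < n) : eps n (k + 1) = Pi.single ⟨k, hk⟩ 1 :=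
  eps_succ n ⟨k, hk⟩

theorem pairing_eps_mid {i : Fin (n + 1)} (h0 : 0 < (i : ℕ)) (h1 : (i : ℕ) < n) {k : ℕ}
    (hk : k < n) : pairing n i (eps n (k + 1)) =
      (if k + 1 = i then 1 else 0) - if k = i then 1 else 0 := by
  rw [pairing_mid i h0 h1, eps_of_lt hk, Pi.single_apply, Pi.single_apply]
  simp only [Fin.mk.injEq]
  congr 2
  · exact propext (by omega)
  · exact propext (by omega)

include hn in
theorem pairing_eps_zero {k : ℕ} (hk : k < n) (h : 0 < k) :
    pairing n 0 (eps n (k + 1)) = 0 := by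
  rw [pairing_zero hn, eps_of_lt hk, Pi.single_apply]
  simp [h.ne]

include hn in
theorem pairing_eps_last {k : ℕ} (hk : k + 1 < n) :
    pairing n (Fin.last n) (eps n (k + 1)) = 0 := by
  rw [pairing_last hn, eps_of_lt (by omega), Pi.single_apply]
  simp
  omega

theorem coordUnit_succ {k : ℕ} (hk : k + 1 < n) :
    coordUnit n qh (k + 1) =
      TUnit hn t qh ⟨k + 1, by omega⟩ * coordUnit n qh k * TUnit hn t qh ⟨k + 1, by omega⟩ := by
  have hp := pairing_eps_mid (i := (⟨k + 1, by omega⟩ : Fin (n + 1))) (by simp) (by simpa)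
    (show k < n by omega)
  simp only [if_true, show k ≠ k + 1 by omega, if_false, sub_zero] at hp
  rw [coordUnit, coordUnit, T_xpow_T_mid hn t qh (by simp) (by simpa) hp, reflExp_apply, hp,
    rootExp_mid _ (by simp) (by simpa), corootExp_mid _ (by simp) (by simpa), eps_of_lt hk,
    eps_of_lt (show k < n by omega)]
  simp

include hn in
theorem neg_corootExp_zero_eq :
    (xUnit qh (corootExp n 0))⁻¹ = xUnit qh (0, -1) * coordUnit n qh 0 := by
  rw [coordUnit, ← xUnit_add, inv_eq_iff_mul_eq_one, ← xUnit_add, corootExp_zero hn,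
    eps_of_lt (by omega)]
  ext1
  rw [coe_xUnit, Units.val_one, ← mulOp_one, ← xpow_zero qh]
  congr 2
  ext <;> simp

theorem coe_xUnit_delta (m : ℤ) :
    (xUnit qh ((0, m) : (Fin n → ℤ) × ℤ) : Module.End ℂ (A n)) =
      algebraMap ℂ _ ((qh ^ m : ℂˣ) : ℂ) := by
  have h : xpow qh ((0, m) : (Fin n → ℤ) × ℤ) = algebraMap ℂ (A n) ((qh ^ m : ℂˣ) : ℂ) := by
    simp [xpow, AddMonoidAlgebra.coe_algebraMap]
  refine LinearMap.ext fun g => ?_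
  rw [coe_xUnit, mulOp_apply, h, Module.algebraMap_end_apply, Algebra.smul_def]

theorem commute_xUnit_delta (m : ℤ) (u : (Module.End ℂ (A n))ˣ) :
    Commute (xUnit qh ((0, m) : (Fin n → ℤ) × ℤ)) u := by
  rw [commute_units_iff, coe_xUnit_delta]
  exact Algebra.commutes _ _

theorem TUnit_zero_mul_dualZeroUnit :
    TUnit hn t qh 0 * dualZeroUnit hn t qh = xUnit qh (0, -1) * coordUnit n qh 0 := by
  rw [dualZeroUnit, mul_inv_cancel_left, neg_corootExp_zero_eq hn]

include hn in
theorem corootExp_last_eq :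
    xUnit qh (corootExp n (Fin.last n)) = coordUnit n qh (n - 1) := by
  rw [corootExp_last hn, coordUnit, eps_of_lt (show n - 1 < n by omega)]

theorem isFTuple_T : IsFTuple t qh (T hn t qh) (dualZeroUnit hn t qh : Module.End ℂ (A n))
    (dualLastUnit hn t qh) := by
  -- `coordUnit n qh k` is multiplication by `x_{k+1}`, on which only `s_k` and `s_{k+1}` act
  -- nontrivially.
  have hc : ∀ (i : Fin (n + 1)) (k : ℕ), k < n → (i : ℕ) ≠ k → (i : ℕ) ≠ k + 1 →
      Commute (TUnit hn t qh i) (coordUnit n qh k) := by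
    intro i k hk h1 h2
    refine commute_TUnit_xUnit hn t qh ?_
    rcases simple_index_cases i with rfl | rfl | ⟨h3, h4⟩
    · exact pairing_eps_zero hn hk (by simpa [pos_iff_ne_zero, eq_comm] using h1)
    · exact pairing_eps_last hn (by simp at h2; omega)
    · rw [pairing_eps_mid h3 h4 hk, if_neg (Ne.symm h2), if_neg (Ne.symm h1), sub_zero]
  have d0 : dualZeroUnit hn t qh =
      xUnit qh (0, -1) * ((TUnit hn t qh 0)⁻¹ * coordUnit n qh 0) := by
    rw [dualZeroUnit, neg_corootExp_zero_eq hn, ← mul_assoc, ← mul_assoc,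
      (commute_xUnit_delta qh _ _).eq]
  have dn : dualLastUnit hn t qh =
      (coordUnit n qh (n - 1))⁻¹ * (TUnit hn t qh (Fin.last n))⁻¹ := by
    rw [dualLastUnit, corootExp_last_eq hn]
  refine ⟨T_quadratic hn t qh, fun i j => T_comm hn t qh, fun i j => T_braid_three hn t qh,
    fun i j => T_braid_four hn t qh, dualZero_quadratic hn t qh, dualLast_quadratic hn t qh,
    fun j h => ?_, fun j h => ?_, ?_, fun j h => ?_, fun j h => ?_, ?_⟩
  · change Commute _ _
    rw [← coe_TUnit, ← commute_units_iff, d0]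
    exact (commute_xUnit_delta qh _ _).mul_left
      ((commute_TUnit hn t qh (by simpa using h)).inv_left.mul_left
        (hc j 0 (by omega) (by omega) (by omega)).symm)
  · change Commute _ _
    rw [← coe_TUnit, ← commute_units_iff, dn]
    exact (hc j (n - 1) (by omega) (by omega) (by omega)).symm.inv_left.mul_left
      (commute_TUnit hn t qh (by simpa using h)).symm.inv_left
  · change Commute _ _
    rw [← commute_units_iff, d0, dn]
    refine (commute_xUnit_delta qh _ _).mul_left (Commute.mul_left ?_ ?_)
    · exact (hc 0 (n - 1) (by omega) (by simp; omega) (by simp)).inv_inv.mul_right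
        (commute_TUnit hn t qh (by simpa using hn)).inv_inv
    · exact (commute_xUnit qh _ _).inv_right.mul_right
        (hc _ 0 (by omega) (by simp; omega) (by simp; omega)).symm.inv_right
  · have hj : coordUnit n qh 1 =
        TUnit hn t qh j * coordUnit n qh 0 * TUnit hn t qh j := by
      rw [show j = ⟨0 + 1, by omega⟩ from Fin.ext h]
      exact coordUnit_succ hn t qh (by omega)
    have hb : TUnit hn t qh j * (xUnit qh (corootExp n 0))⁻¹ * TUnit hn t qh j =
        xUnit qh (0, -1) * coordUnit n qh 1 := by
      rw [neg_corootExp_zero_eq hn, hj, ← mul_assoc, ← (commute_xUnit_delta qh _ _).eq]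
      simp only [mul_assoc]
    have key : dualZeroUnit hn t qh * TUnit hn t qh j * dualZeroUnit hn t qh * TUnit hn t qh j =
        TUnit hn t qh j * dualZeroUnit hn t qh * TUnit hn t qh j * dualZeroUnit hn t qh :=
      braid_four_inv_mul (a := TUnit hn t qh 0) (b := TUnit hn t qh j)
      (z := (xUnit qh (corootExp n 0))⁻¹)
      (by rw [hb]
          exact ((commute_xUnit qh _ _).mul_right (commute_xUnit qh _ _)).inv_left)
      (by rw [hb]
          exact (commute_xUnit_delta qh _ _).symm.mul_right
            (hc 0 1 (by omega) (by simp) (by simp)))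
      (Units.ext (by
        simpa only [Units.val_mul, coe_TUnit] using
          T_braid_four hn t qh (i := 0) (j := j) (Or.inl ⟨rfl, h⟩)))
    simpa only [Units.val_mul, coe_TUnit] using congrArg Units.val key
  · have hj : coordUnit n qh (n - 1) =
        TUnit hn t qh j * coordUnit n qh (n - 2) * TUnit hn t qh j := by
      have := coordUnit_succ hn t qh (k := n - 2) (by omega)
      have e1 : n - 2 + 1 = n - 1 := by omega
      have e2 : (⟨n - 2 + 1, by omega⟩ : Fin (n + 1)) = j := Fin.ext (by simp only; omega)
      rwa [e2, e1] at this
    have key := braid_four_mul_inv (a := TUnit hn t qh (Fin.last n)) (b := TUnit hn t qh j)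
      (z := coordUnit n qh (n - 2))
      (by rw [← hj]; exact commute_xUnit qh _ _)
      (hc _ _ (by omega) (by simp; omega) (by simp; omega))
      (Units.ext (by
        simpa only [Units.val_mul, coe_TUnit] using
          T_braid_four hn t qh (i := Fin.last n) (j := j) (Or.inr ⟨rfl, h⟩)))
    rw [← hj, ← dn] at key
    simpa only [Units.val_mul, coe_TUnit] using congrArg Units.val key
  -- The palindromic products are `q^{-1/2}x_{k+1}`; for `k = n - 1` the factor `x_n` cancels
  -- against `x_n⁻¹T_n⁻¹T_n`, leaving `q^{-1/2}`.
  · have := cyclic_prod_eq hn (T hn t qh) (dualZeroUnit hn t qh : Module.End ℂ (A n))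
      (dualLastUnit hn t qh) (fun k => Units.val (xUnit qh (0, -1) * coordUnit n qh k))
      (by rw [← TUnit_zero_mul_dualZeroUnit hn, Units.val_mul, coe_TUnit])
      (fun k hk => by
        rw [← coe_TUnit, ← Units.val_mul, ← Units.val_mul, coordUnit_succ hn t qh hk, mul_assoc,
          mul_assoc, mul_assoc, (commute_xUnit_delta qh _ _).left_comm])
    rw [this, ← coe_TUnit, ← Units.val_mul, ← Units.val_mul, dn, inv_mul_cancel_right,
      (commute_xUnit_delta qh _ _).eq, inv_mul_cancel_left, coe_xUnit_delta, zpow_neg_one]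

end tuple

/-! ### The commuting elements `z_i` of `ℱ(t; q)` -/

/-- A non-zero scalar as a unit of an algebra. -/
def scalarUnit (B : Type*) [Ring B] [Algebra ℂ B] (c : ℂˣ) : Bˣ := Units.map (algebraMap ℂ B) c

theorem coe_scalarUnit {B : Type*} [Ring B] [Algebra ℂ B] (c : ℂˣ) :
    (scalarUnit B c : B) = algebraMap ℂ B c := rfl

theorem commute_scalarUnit {B : Type*} [Ring B] [Algebra ℂ B] (c : ℂˣ) (u : Bˣ) :
    Commute (scalarUnit B c) u :=
  commute_units_iff.2 (Algebra.commutes _ _)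

namespace IsFTuple

variable {n : ℕ} {t : Multiplicity n} {qh : ℂˣ} {B : Type*} [Ring B] [Algebra ℂ B]
  {V : Fin (n + 1) → B} {D₀ Dₙ : B} (h : IsFTuple t qh V D₀ Dₙ)

/-- The generators `V_i` as units. -/
def vUnit (i : Fin (n + 1)) : Bˣ := heckeUnit (t.k i) (V i) (h.quadratic i)

/-- The generator `V_0^∨` as a unit. -/
def dZero : Bˣ := heckeUnit (t.kDual 0) D₀ h.quadratic_zero

/-- The generator `V_n^∨` as a unit. -/
def dLast : Bˣ := heckeUnit (t.kDual (Fin.last n)) Dₙ h.quadratic_last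

/-- The elements `z_{k+1}`, given by `z_1 = q^{1/2} V_0 V_0^∨` and `z_{k+1} = V_k z_k V_k`. -/
def zUnit : ℕ → Bˣ
  | 0 => scalarUnit B qh * (h.vUnit 0 * h.dZero)
  | k + 1 => extendNat h.vUnit (k + 1) * zUnit k * extendNat h.vUnit (k + 1)

theorem coe_vUnit (i : Fin (n + 1)) : (h.vUnit i : B) = V i := rfl

theorem coe_inv_vUnit (i : Fin (n + 1)) :
    (↑(h.vUnit i)⁻¹ : B) = V i - algebraMap ℂ B (t.k i) + algebraMap ℂ B ((t.k i)⁻¹ : ℂˣ) := rfl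

theorem coe_dZero : (h.dZero : B) = D₀ := rfl

theorem coe_inv_dZero : (↑h.dZero⁻¹ : B) =
    D₀ - algebraMap ℂ B (t.kDual 0) + algebraMap ℂ B ((t.kDual 0)⁻¹ : ℂˣ) := rfl

theorem coe_inv_dLast : (↑h.dLast⁻¹ : B) = Dₙ - algebraMap ℂ B (t.kDual (Fin.last n)) +
    algebraMap ℂ B ((t.kDual (Fin.last n))⁻¹ : ℂˣ) := rfl

theorem zUnit_succ {k : ℕ} (hk : k + 1 < n + 1) :
    h.zUnit (k + 1) = h.vUnit ⟨k + 1, hk⟩ * h.zUnit k * h.vUnit ⟨k + 1, hk⟩ := by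
  rw [zUnit, extendNat_of_lt h.vUnit hk]

include h in
theorem mul_self_eq (i : Fin (n + 1)) :
    V i * V i = (algebraMap ℂ B (t.k i) - algebraMap ℂ B ((t.k i)⁻¹ : ℂˣ)) * V i + 1 := by
  have h1 := (quadratic_iff _ _).1 (h.quadratic i)
  rw [← h1, ← map_sub, Algebra.commutes, map_sub]
  noncomm_ring

theorem commute_vUnit {i j : Fin (n + 1)} (hij : (i : ℕ) + 2 ≤ j) :
    Commute (h.vUnit i) (h.vUnit j) :=
  commute_units_iff.2 (h.comm i j hij)

theorem commute_vUnit_dZero {j : Fin (n + 1)} (hj : 2 ≤ (j : ℕ)) :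
    Commute (h.vUnit j) h.dZero :=
  commute_units_iff.2 (h.comm_zero j hj).symm

theorem commute_vUnit_dLast {j : Fin (n + 1)} (hj : (j : ℕ) + 2 ≤ n) :
    Commute (h.vUnit j) h.dLast :=
  commute_units_iff.2 (h.comm_last j hj).symm

variable (hn : 2 ≤ n)

include hn in
-- The cyclic relation rewritten. It gives `z_n = V_n⁻¹(V_n^∨)⁻¹`, a description from the right end
-- to set against `z_1 = q^{1/2}V_0V_0^∨`.
theorem dLast_mul_vUnit_mul_zUnit : h.dLast * h.vUnit (Fin.last n) * h.zUnit (n - 1) = 1 := by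
  have h1 := cyclic_prod_eq hn V D₀ Dₙ
    (fun k => Units.val ((scalarUnit B qh)⁻¹ * h.zUnit k))
    (by rw [zUnit, inv_mul_cancel_left, Units.val_mul, coe_vUnit, coe_dZero])
    (fun k hk => by
      rw [← h.coe_vUnit, ← Units.val_mul, ← Units.val_mul, zUnit_succ h (by omega), mul_assoc,
        mul_assoc, mul_assoc, (commute_scalarUnit qh _).inv_left.left_comm])
  have h2 : scalarUnit B qh⁻¹ =
      h.dLast * h.vUnit (Fin.last n) * ((scalarUnit B qh)⁻¹ * h.zUnit (n - 1)) :=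
    Units.ext (h.cyclic.symm.trans h1)
  have h3 : scalarUnit B qh⁻¹ = (scalarUnit B qh)⁻¹ := map_inv _ _
  rw [← (commute_scalarUnit qh _).inv_left.left_comm, h3] at h2
  exact (mul_eq_left.1 h2.symm)

/-- Up to a scalar, `zUnit k` is a word in `V_0^∨, V_0, …, V_k`. -/
theorem commute_zUnit_of_left {y : Bˣ} {k : ℕ} (hk : k < n) (h0 : Commute y h.dZero)
    (hy : ∀ i : Fin (n + 1), (i : ℕ) ≤ k → Commute y (h.vUnit i)) : Commute y (h.zUnit k) := by
  induction k with
  | zero =>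
    exact (commute_scalarUnit qh y).symm.mul_right ((hy 0 (by simp)).mul_right h0)
  | succ k ih =>
    have h1 := hy ⟨k + 1, by omega⟩ le_rfl
    rw [zUnit_succ h (by omega)]
    exact (h1.mul_right (ih (by omega) fun i hi => hy i (by omega))).mul_right h1

include hn in
-- By the cyclic relation, `zUnit k` is also a word in the inverses of `V_{k+1}, …, V_n, V_n^∨`; the
-- recursion is solved backwards from `z_n`.
theorem commute_zUnit_of_right {y : Bˣ} {k : ℕ} (hk : k < n) (h0 : Commute y h.dLast)
    (hy : ∀ i : Fin (n + 1), k < (i : ℕ) → Commute y (h.vUnit i)) : Commute y (h.zUnit k) := by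
  obtain ⟨m, hm⟩ : ∃ m, k + m = n - 1 := ⟨n - 1 - k, by omega⟩
  induction m generalizing k with
  | zero =>
    have h1 := h.dLast_mul_vUnit_mul_zUnit hn
    rw [add_zero] at hm
    rw [hm, ← inv_eq_of_mul_eq_one_right h1]
    exact (h0.mul_right (hy (Fin.last n) hk)).inv_right
  | succ m ih =>
    have h1 := hy ⟨k + 1, by omega⟩ (Nat.lt_succ_self k)
    have h2 := ih (by omega) (fun i hi => hy i (by omega)) (show k + 1 + m = n - 1 by omega)
    rw [zUnit_succ h (by omega)] at h2
    have h3 : h.zUnit k = (h.vUnit ⟨k + 1, by omega⟩)⁻¹ *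
        (h.vUnit ⟨k + 1, by omega⟩ * h.zUnit k * h.vUnit ⟨k + 1, by omega⟩) *
          (h.vUnit ⟨k + 1, by omega⟩)⁻¹ := by group
    rw [h3]
    exact (h1.inv_right.mul_right h2).mul_right h1.inv_right

include hn in
-- For `j < k` the right-hand word is used and for `j > k + 1` the left-hand one, so that `V_j` is
-- distant from all the letters.
theorem commute_vUnit_zUnit {j : Fin (n + 1)} {k : ℕ} (hk : k < n) (h1 : (j : ℕ) ≠ k)
    (h2 : (j : ℕ) ≠ k + 1) : Commute (h.vUnit j) (h.zUnit k) := by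
  rcases lt_or_gt_of_ne h1 with h3 | h3
  · exact h.commute_zUnit_of_right hn hk (h.commute_vUnit_dLast (by omega))
      fun i hi => h.commute_vUnit (by omega)
  · exact h.commute_zUnit_of_left hk (h.commute_vUnit_dZero (by omega))
      fun i hi => (h.commute_vUnit (by omega)).symm

include hn in
theorem commute_dZero_zUnit {k : ℕ} (hk : k < n) (h1 : 1 ≤ k) :
    Commute h.dZero (h.zUnit k) :=
  h.commute_zUnit_of_right hn hk (commute_units_iff.2 h.comm_zero_last)
    fun i hi => (h.commute_vUnit_dZero (by omega)).symm

include hn in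
-- For `k < l`, `zUnit l` commutes with every letter of the left-hand word for `zUnit k`.
theorem commute_zUnit {k l : ℕ} (hk : k < n) (hl : l < n) :
    Commute (h.zUnit k) (h.zUnit l) := by
  have key : ∀ {k l : ℕ}, k < n → l < n → k < l → Commute (h.zUnit l) (h.zUnit k) :=
    fun {k l} hk hl hkl => h.commute_zUnit_of_left hk (h.commute_dZero_zUnit hn hl (by omega)).symm
      fun i hi => (h.commute_vUnit_zUnit hn hl (by omega) (by omega)).symm
  rcases lt_trichotomy k l with h1 | rfl | h1
  · exact (key hk hl h1).symm
  · exact Commute.refl _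
  · exact key hl hk h1

/-- The homomorphism to the units given by the commuting elements `z_i`. -/
def zPiHom : (Fin n → Multiplicative ℤ) →* Bˣ :=
  MonoidHom.noncommPiCoprod (fun k : Fin n => zpowersHom Bˣ (h.zUnit k))
    fun k l _ x y => by
      simpa only [zpowersHom_apply] using
        (h.commute_zUnit hn k.2 l.2).zpow_zpow x.toAdd y.toAdd

/-- The homomorphism `μ ↦ z^μ` to the units. -/
def zHom : Multiplicative (Fin n → ℤ) →* Bˣ :=
  (h.zPiHom hn).comp
    ({ toFun := fun μ k => Multiplicative.ofAdd (μ.toAdd k)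
       map_one' := rfl
       map_mul' := fun _ _ => rfl } : Multiplicative (Fin n → ℤ) →* (Fin n → Multiplicative ℤ))

theorem zHom_single (k : Fin n) : h.zHom hn (Multiplicative.ofAdd (Pi.single k 1)) = h.zUnit k := by
  have h1 : (fun l => Multiplicative.ofAdd ((Pi.single k 1 : Fin n → ℤ) l)) =
      Pi.mulSingle k (Multiplicative.ofAdd (1 : ℤ)) := by
    ext l
    by_cases hl : l = k
    · subst hl; simp
    · simp [hl]
  change h.zPiHom hn (fun l => Multiplicative.ofAdd ((Pi.single k 1 : Fin n → ℤ) l)) = _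
  rw [h1]
  exact (MonoidHom.noncommPiCoprod_mulSingle _ k _).trans (by simp)

/-- The homomorphism from the Laurent polynomials with `x_i ↦ z_i`. -/
def zeta : A n →ₐ[ℂ] B :=
  AddMonoidAlgebra.lift ℂ B (Fin n → ℤ) ((Units.coeHom B).comp (h.zHom hn))

theorem zeta_xpow (f : (Fin n → ℤ) × ℤ) :
    h.zeta hn (xpow qh f) = (scalarUnit B (qh ^ f.2) * h.zHom hn (Multiplicative.ofAdd f.1) : Bˣ) := by
  rw [zeta, xpow, AddMonoidAlgebra.lift_single, Units.val_mul, coe_scalarUnit, Algebra.smul_def]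
  rfl

theorem zeta_eps {k : ℕ} (hk : k < n) : h.zeta hn (xpow qh (eps n (k + 1), 0)) = h.zUnit k := by
  rw [zeta_xpow, eps_of_lt hk, zHom_single, zpow_zero, scalarUnit, map_one, one_mul]

theorem zeta_neg_eps {k : ℕ} (hk : k < n) :
    h.zeta hn (xpow qh (-eps n (k + 1), 0)) = ↑(h.zUnit k)⁻¹ := by
  rw [zeta_xpow, eps_of_lt hk, ofAdd_neg, map_inv, zHom_single, zpow_zero, scalarUnit, map_one,
    one_mul]

end IsFTuple

/-! ### Cross relations in an arbitrary algebra -/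

theorem reflExp_eps_mid_left {n : ℕ} {i : Fin (n + 1)} (h1 : (i : ℕ) < n) {k : ℕ}
    (hk : k + 1 = (i : ℕ)) : reflExp n i (eps n (k + 1), 0) = (eps n (i + 1), 0) := by
  have hp : pairing n i (eps n (k + 1)) = 1 := by
    rw [pairing_eps_mid (by omega) h1 (by omega)]
    simp [hk]
    omega
  have e : (⟨k, by omega⟩ : Fin n) = ⟨i - 1, by omega⟩ := Fin.ext (by simp only; omega)
  rw [reflExp_apply, hp, rootExp_mid i (by omega) h1, corootExp_mid i (by omega) h1,
    eps_of_lt (show k < n by omega), eps_of_lt h1, e]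
  simp

theorem reflExp_eps_mid_right {n : ℕ} {i : Fin (n + 1)} (h1 : (i : ℕ) < n) {k : ℕ}
    (hk : k + 1 = (i : ℕ)) : reflExp n i (eps n (i + 1), 0) = (eps n (k + 1), 0) := by
  have hp : pairing n i (eps n (i + 1)) = -1 := by
    rw [pairing_eps_mid (by omega) h1 h1]
    simp
  have e : (⟨k, by omega⟩ : Fin n) = ⟨i - 1, by omega⟩ := Fin.ext (by simp only; omega)
  rw [reflExp_apply, hp, rootExp_mid i (by omega) h1, corootExp_mid i (by omega) h1,
    eps_of_lt (show k < n by omega), eps_of_lt h1, e]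
  simp

theorem reflExp_eps_zero {n : ℕ} (hn : 2 ≤ n) :
    reflExp n 0 (eps n (0 + 1), 0) = (-eps n (0 + 1), 2) := by
  have hk : 0 < n := by omega
  rw [reflExp_apply, pairing_zero hn, rootExp_zero, corootExp_zero hn, eps_of_lt hk]
  ext <;> simp
  ring

theorem reflExp_eps_last {n : ℕ} (hn : 2 ≤ n) :
    reflExp n (Fin.last n) (eps n (n - 1 + 1), 0) = (-eps n (n - 1 + 1), 0) := by
  have hk : n - 1 < n := by omega
  rw [reflExp_apply, pairing_last hn, rootExp_last, corootExp_last hn, eps_of_lt hk]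
  ext <;> simp
  ring

namespace IsFTuple

variable {n : ℕ} {t : Multiplicity n} {qh : ℂˣ} {B : Type*} [Ring B] [Algebra ℂ B]
  {V : Fin (n + 1) → B} {D₀ Dₙ : B} (h : IsFTuple t qh V D₀ Dₙ) (hn : 2 ≤ n)

/-- The existence of a cross relation `V_i f(z) = (s_i f)(z) V_i + g(z)`. -/
def HasCross (i : Fin (n + 1)) (f : A n) : Prop :=
  ∃ g, V i * h.zeta hn f = h.zeta hn (sAct n qh i f) * V i + h.zeta hn g

variable {h hn} {i : Fin (n + 1)}

theorem HasCross.add {f f' : A n} (hf : h.HasCross hn i f) (hf' : h.HasCross hn i f') :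
    h.HasCross hn i (f + f') := by
  obtain ⟨g, hg⟩ := hf
  obtain ⟨g', hg'⟩ := hf'
  refine ⟨g + g', ?_⟩
  simp only [map_add, mul_add, add_mul, hg, hg']
  abel

theorem HasCross.smul {f : A n} (c : ℂ) (hf : h.HasCross hn i f) : h.HasCross hn i (c • f) := by
  obtain ⟨g, hg⟩ := hf
  refine ⟨c • g, ?_⟩
  simp only [map_smul, mul_smul_comm, smul_mul_assoc, hg, smul_add]

theorem HasCross.one : h.HasCross hn i 1 := ⟨0, by simp⟩

theorem HasCross.mul {f f' : A n} (hf : h.HasCross hn i f) (hf' : h.HasCross hn i f') :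
    h.HasCross hn i (f * f') := by
  obtain ⟨g, hg⟩ := hf
  obtain ⟨g', hg'⟩ := hf'
  refine ⟨sAct n qh i f * g' + g * f', ?_⟩
  simp only [map_mul, map_add]
  rw [← mul_assoc, hg, add_mul, mul_assoc, hg', mul_add, ← mul_assoc, add_assoc]

/-- The cross relation for `f` is multiplied by the inverse of `s_i f` on the left and that of `f`
on the right. With closure under products this reduces all cross relations to those for the `x_k`.
-/
theorem HasCross.inv {f f' : A n} (hff : f * f' = 1) (hf : h.HasCross hn i f) :
    h.HasCross hn i f' := by
  obtain ⟨g, hg⟩ := hf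
  have e1 : h.zeta hn f * h.zeta hn f' = 1 := by rw [← map_mul, hff, map_one]
  have e2 : h.zeta hn (sAct n qh i f') * h.zeta hn (sAct n qh i f) = 1 := by
    rw [← map_mul, ← map_mul, mul_comm, hff, map_one, map_one]
  refine ⟨-(sAct n qh i f' * g * f'), ?_⟩
  have e3 : h.zeta hn (sAct n qh i f') * (V i * h.zeta hn f) * h.zeta hn f' =
      V i * h.zeta hn f' + h.zeta hn (sAct n qh i f' * g * f') := by
    rw [hg, mul_add, add_mul, ← mul_assoc, e2, one_mul, map_mul, map_mul]
  rw [map_neg, ← sub_eq_add_neg, eq_sub_iff_add_eq, ← e3, ← mul_assoc, mul_assoc, mul_assoc, e1,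
    mul_one]

variable (h hn)

theorem hasCross_eps (i : Fin (n + 1)) {k : ℕ} (hk : k < n) :
    h.HasCross hn i (xpow qh (eps n (k + 1), 0)) := by
  by_cases hcomm : (i : ℕ) ≠ k ∧ (i : ℕ) ≠ k + 1
  · have hp : pairing n i (eps n (k + 1)) = 0 := by
      rcases simple_index_cases i with rfl | rfl | ⟨h3, h4⟩
      · exact pairing_eps_zero hn hk (by simpa [pos_iff_ne_zero, eq_comm] using hcomm.1)
      · have := hcomm.2
        exact pairing_eps_last hn (by simp at this; omega)
      · rw [pairing_eps_mid h3 h4 hk, if_neg (Ne.symm hcomm.2), if_neg (Ne.symm hcomm.1), sub_zero]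
    refine ⟨0, ?_⟩
    rw [sAct_xpow, reflExp_apply, hp, zero_smul, sub_zero, map_zero, add_zero, zeta_eps h hn hk,
      ← coe_vUnit h]
    exact (commute_units_iff.1 (h.commute_vUnit_zUnit hn hk hcomm.1 hcomm.2)).eq
  rcases simple_index_cases i with rfl | rfl | ⟨h0, h1⟩
  · obtain rfl : k = 0 := by simp at hcomm; omega
    -- The witness comes from `V_0 z_1 = (t_0 - t_0⁻¹)z_1 + q^{1/2}V_0^∨` and `q z_1⁻¹V_0 =
    -- q^{1/2}(V_0^∨)⁻¹`, with the quadratic relation of `V_0^∨`.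
    refine ⟨((t.k 0 : ℂ) - (((t.k 0)⁻¹ : ℂˣ) : ℂ)) • xpow qh (eps n (0 + 1), 0) +
      algebraMap ℂ (A n) ((qh : ℂ) * ((t.kDual 0 : ℂ) - (((t.kDual 0)⁻¹ : ℂˣ) : ℂ))), ?_⟩
    have eZ : (h.zUnit 0 : B) = algebraMap ℂ B qh * (V 0 * D₀) := rfl
    have ez : h.zeta hn (xpow qh (-eps n (0 + 1), 2)) =
        algebraMap ℂ B ((qh ^ (2 : ℤ) : ℂˣ) : ℂ) * ↑(h.zUnit 0)⁻¹ := by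
      rw [← zeta_neg_eps h hn hk, zeta_xpow, zeta_xpow, Units.val_mul, Units.val_mul,
        coe_scalarUnit, zpow_zero, coe_scalarUnit, Units.val_one, map_one, one_mul]
    have eI : (↑(h.zUnit 0)⁻¹ : B) * V 0 =
        algebraMap ℂ B ((qh⁻¹ : ℂˣ) : ℂ) * ↑h.dZero⁻¹ := by
      have : (h.zUnit 0)⁻¹ * h.vUnit 0 = scalarUnit B qh⁻¹ * h.dZero⁻¹ := by
        have hs : scalarUnit B qh⁻¹ = (scalarUnit B qh)⁻¹ := map_inv _ _
        rw [zUnit, mul_inv_rev, mul_inv_rev, hs, mul_assoc,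
          ((commute_scalarUnit qh (h.vUnit 0)).inv_left.eq :), mul_assoc,
          inv_mul_cancel_left,
          ((commute_scalarUnit qh h.dZero).inv_inv.eq :)]
      exact congrArg Units.val this
    rw [sAct_xpow, reflExp_eps_zero hn, map_add, map_smul, zeta_eps h hn hk, ez, mul_assoc, eI,
      coe_inv_dZero, AlgHom.commutes, eZ, Algebra.smul_def, ← mul_assoc (V 0),
      ← Algebra.commutes (qh : ℂ) (V 0), mul_assoc, ← mul_assoc (V 0), h.mul_self_eq]
    have q2 : algebraMap ℂ B ((qh ^ (2 : ℤ) : ℂˣ) : ℂ) * algebraMap ℂ B ((qh⁻¹ : ℂˣ) : ℂ) =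
        algebraMap ℂ B qh := by
      rw [← map_mul, ← Units.val_mul]
      congr 2
      rw [zpow_two, mul_inv_cancel_right]
    rw [← mul_assoc (algebraMap ℂ B ((qh ^ (2 : ℤ) : ℂˣ) : ℂ)), q2, map_sub, map_mul, map_sub,
      ← map_sub, ← map_sub, ← mul_assoc (algebraMap ℂ B (_ - _)) (algebraMap ℂ B (qh : ℂ)),
      ← Algebra.commutes (qh : ℂ) (algebraMap ℂ B (_ - _)), map_sub, map_sub]
    noncomm_ring
  · obtain rfl : k = n - 1 := by simp at hcomm; omega
    -- Now `V_n z_n = (V_n^∨)⁻¹`, while `z_n⁻¹V_n = V_n^∨V_n²`; the quadratic relations of `V_n` and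
    -- `V_n^∨` give the difference.
    refine ⟨-(((t.k (Fin.last n) : ℂ) - (((t.k (Fin.last n))⁻¹ : ℂˣ) : ℂ)) •
      xpow qh (-eps n (n - 1 + 1), 0)) +
      algebraMap ℂ (A n) ((((t.kDual (Fin.last n))⁻¹ : ℂˣ) : ℂ) - (t.kDual (Fin.last n) : ℂ)), ?_⟩
    have hZ : h.zUnit (n - 1) = (h.vUnit (Fin.last n))⁻¹ * h.dLast⁻¹ := by
      rw [← inv_eq_of_mul_eq_one_right (h.dLast_mul_vUnit_mul_zUnit hn), mul_inv_rev]
    have eV : V (Fin.last n) * (h.zUnit (n - 1) : B) = ↑h.dLast⁻¹ := by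
      rw [hZ, Units.val_mul, ← coe_vUnit h, Units.mul_inv_cancel_left]
    have eI : (↑(h.zUnit (n - 1))⁻¹ : B) = Dₙ * V (Fin.last n) := by
      rw [hZ, mul_inv_rev, inv_inv, inv_inv]; rfl
    rw [sAct_xpow, reflExp_eps_last hn, map_add, map_neg, map_smul, zeta_eps h hn hk,
      zeta_neg_eps h hn hk, eV, eI, coe_inv_dLast, AlgHom.commutes, Algebra.smul_def, mul_assoc,
      h.mul_self_eq, ← map_sub, mul_add, ← mul_assoc Dₙ, ← Algebra.commutes, map_sub, map_sub]
    noncomm_ring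
  · have hsucc : ∀ m, m + 1 = (i : ℕ) →
        (h.zUnit i : B) = V i * h.zUnit m * V i := fun m hm => by
      have := h.zUnit_succ (k := m) (by omega)
      have e : (⟨m + 1, by omega⟩ : Fin (n + 1)) = i := Fin.ext hm
      rw [e, hm] at this
      exact congrArg Units.val this
    by_cases hki : (i : ℕ) = k
    · subst hki
      obtain ⟨m, hm⟩ : ∃ m, m + 1 = (i : ℕ) := ⟨i - 1, by omega⟩
      refine ⟨((t.k i : ℂ) - (((t.k i)⁻¹ : ℂˣ) : ℂ)) • xpow qh (eps n (i + 1), 0), ?_⟩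
      rw [sAct_xpow, reflExp_eps_mid_right h1 hm, map_smul, zeta_eps h hn hk,
        zeta_eps h hn (by omega), hsucc m hm, ← mul_assoc, ← mul_assoc, h.mul_self_eq,
        Algebra.smul_def, ← map_sub]
      noncomm_ring
    · have hm : k + 1 = (i : ℕ) := by omega
      refine ⟨((((t.k i)⁻¹ : ℂˣ) : ℂ) - (t.k i : ℂ)) • xpow qh (eps n (i + 1), 0), ?_⟩
      have e : V i * (h.zUnit k : B) = h.zUnit i * ↑(h.vUnit i)⁻¹ := by
        rw [hsucc k hm, ← coe_vUnit h, Units.mul_inv_cancel_right]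
      rw [sAct_xpow, reflExp_eps_mid_left h1 hm, map_smul, zeta_eps h hn hk,
        zeta_eps h hn h1, e, coe_inv_vUnit, Algebra.smul_def, map_sub,
        ← map_sub, Algebra.commutes, map_sub]
      noncomm_ring

theorem hasCross (i : Fin (n + 1)) (f : A n) : h.HasCross hn i f := by
  let G : AddSubgroup (Fin n → ℤ) :=
    { carrier := {μ | h.HasCross hn i (xpow qh (μ, 0))}
      zero_mem' := by
        have : xpow qh ((0, 0) : (Fin n → ℤ) × ℤ) = 1 := xpow_zero qh
        simpa only [Set.mem_ofPred_eq, this] using HasCross.one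
      add_mem' := fun {μ ν} hμ hν => by
        have : xpow qh ((μ + ν, 0) : (Fin n → ℤ) × ℤ) = xpow qh (μ, 0) * xpow qh (ν, 0) := by
          rw [← xpow_add]; simp
        simpa only [Set.mem_ofPred_eq, this] using HasCross.mul hμ hν
      neg_mem' := fun {μ} hμ => by
        refine HasCross.inv ?_ hμ
        rw [← xpow_add, ← xpow_zero qh, Prod.mk_add_mk, add_neg_cancel, add_zero]
        rfl }
  have hG : ∀ μ, μ ∈ G := fun μ => by
    have e : μ = ∑ k : Fin n, μ k • (Pi.single k 1 : Fin n → ℤ) := by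
      ext l
      simp [Finset.sum_apply, Pi.single_apply]
    rw [e]
    refine AddSubgroup.sum_mem _ fun k _ => AddSubgroup.zsmul_mem _ ?_ _
    have := h.hasCross_eps hn i k.2
    rwa [eps_of_lt k.2] at this
  induction f using AddMonoidAlgebra.induction_linear with
  | zero => exact ⟨0, by simp⟩
  | add f g hf hg => exact hf.add hg
  | single μ c =>
    have : (AddMonoidAlgebra.single μ c : A n) = c • xpow qh (μ, 0) := by simp [xpow]
    rw [this]
    exact HasCross.smul c (hG μ)

end IsFTuple

/-! ### The Poincaré–Birkhoff–Witt spanning set -/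

/-- The type of regular points, which parametrises the affine Weyl group. -/
abbrev RegPt (n : ℕ) : Type := {P : Fin n → ℤ // IsRegular P}

/-- The simple reflection `s_i` on regular points. -/
def RegPt.refl {n : ℕ} (hn : 2 ≤ n) (i : Fin (n + 1)) (P : RegPt n) : RegPt n :=
  ⟨reflPt n i P, P.2.map_reflPt hn i⟩

/-- The element `V_w = V_{i_1} ⋯ V_{i_l}`, for a reduced expression `w = s_{i_1} ⋯ s_{i_l}` of the
affine Weyl group element with `P = w⁻¹ (basePt n)`. -/
def vWalk {n : ℕ} {B : Type*} [Monoid B] (V : Fin (n + 1) → B) (hn : 2 ≤ n) (P : Fin n → ℤ) : B :=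
  walk hn 1 (fun i b => b * V i) P

theorem vWalk_basePt {n : ℕ} {B : Type*} [Monoid B] (V : Fin (n + 1) → B) (hn : 2 ≤ n) :
    vWalk V hn (basePt n) = 1 :=
  walk_basePt hn 1

namespace IsFTuple

variable {n : ℕ} {t : Multiplicity n} {qh : ℂˣ} {B : Type*} [Ring B] [Algebra ℂ B]
  {V : Fin (n + 1) → B} {D₀ Dₙ : B} (h : IsFTuple t qh V D₀ Dₙ) (hn : 2 ≤ n)

include h in
theorem isBraidFamily : IsBraidFamily (fun (i : Fin (n + 1)) (b : B) => b * V i) where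
  comm i j hij x := by
    simp only [mul_assoc, h.comm i j hij]
  three i j hij x := by
    have := h.three i j hij
    simp only [mul_assoc] at this ⊢
    rw [this]
  four i j hij x := by
    have := h.four i j hij
    simp only [mul_assoc] at this ⊢
    rw [this]

include h in
theorem vWalk_reflPt {P : Fin n → ℤ} {i : Fin (n + 1)} (hi : 0 < evalAt P (rootExp n i)) :
    vWalk V hn (reflPt n i P) = vWalk V hn P * V i :=
  walk_reflPt_of_pos hn 1 h.isBraidFamily hi

/-- The linear map with `x^μ ⊗ w ↦ z^μ V_w`. -/
def pbw : (RegPt n →₀ A n) →ₗ[ℂ] B :=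
  Finsupp.lsum ℂ fun P => (LinearMap.mulRight ℂ (vWalk V hn P)).comp (h.zeta hn).toLinearMap

theorem pbw_single (P : RegPt n) (f : A n) :
    h.pbw hn (Finsupp.single P f) = h.zeta hn f * vWalk V hn P := by
  simp [pbw]

theorem zeta_mul_mem_range (f : A n) {x : B} (hx : x ∈ LinearMap.range (h.pbw hn)) :
    h.zeta hn f * x ∈ LinearMap.range (h.pbw hn) := by
  obtain ⟨c, rfl⟩ := hx
  induction c using Finsupp.induction_linear with
  | zero => simp
  | add c d hc hd =>
    rw [map_add, mul_add]
    exact add_mem hc hd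
  | single P g =>
    rw [pbw_single, ← mul_assoc, ← map_mul, ← pbw_single]
    exact ⟨_, rfl⟩

/-- Either `V_w V_i` is `V_{w s_i}`, or `V_w` ends in `V_i` and the quadratic relation rewrites the
square. -/
theorem mul_V_mem_range (i : Fin (n + 1)) {x : B} (hx : x ∈ LinearMap.range (h.pbw hn)) :
    x * V i ∈ LinearMap.range (h.pbw hn) := by
  obtain ⟨c, rfl⟩ := hx
  induction c using Finsupp.induction_linear with
  | zero => simp
  | add c d hc hd =>
    rw [map_add, add_mul]
    exact add_mem hc hd
  | single P g =>
    rw [pbw_single, mul_assoc]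
    refine h.zeta_mul_mem_range hn g ?_
    have mem : ∀ Q : RegPt n, vWalk V hn Q ∈ LinearMap.range (h.pbw hn) := fun Q =>
      ⟨Finsupp.single Q 1, by rw [pbw_single, map_one, one_mul]⟩
    rcases lt_or_gt_of_ne (P.2.evalAt_ne_zero hn i) with h1 | h1
    · have h2 : vWalk V hn P = vWalk V hn (P.refl hn i) * V i := by
        rw [RegPt.refl, ← h.vWalk_reflPt hn, reflPt_reflPt hn]
        rw [evalAt_reflPt_rootExp, cartan_self hn]
        linarith
      have h3 : vWalk V hn P * V i = ((t.k i : ℂ) - (((t.k i)⁻¹ : ℂˣ) : ℂ)) • vWalk V hn P +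
          vWalk V hn (P.refl hn i) := by
        rw [h2, mul_assoc, h.mul_self_eq, ← map_sub, mul_add, mul_one, ← Algebra.smul_def,
          mul_smul_comm]
      rw [h3]
      exact add_mem (Submodule.smul_mem _ _ (mem P)) (mem _)
    · rw [← h.vWalk_reflPt hn h1]
      exact mem (P.refl hn i)

/-- The cross relations carry `f(z)` leftwards through `V_w` one letter at a time. The witness `g`
need not be known for this. -/
theorem vWalk_mul_zeta_mem_range {P : Fin n → ℤ} (hP : IsRegular P) (g : A n) :
    vWalk V hn P * h.zeta hn g ∈ LinearMap.range (h.pbw hn) := by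
  revert g
  refine hP.induction hn
    (motive := fun P => ∀ g, vWalk V hn P * h.zeta hn g ∈ LinearMap.range (h.pbw hn))
    (fun g => ?_) fun P i _ hi ih g => ?_
  · refine ⟨Finsupp.single ⟨basePt n, isRegular_basePt n⟩ g, ?_⟩
    rw [pbw_single, vWalk_basePt, one_mul, mul_one]
  · obtain ⟨g', hg'⟩ := h.hasCross hn i g
    rw [h.vWalk_reflPt hn hi, mul_assoc, hg', mul_add, ← mul_assoc]
    exact add_mem (h.mul_V_mem_range hn i (ih _)) (ih _)

theorem mul_zeta_mem_range (g : A n) {x : B} (hx : x ∈ LinearMap.range (h.pbw hn)) :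
    x * h.zeta hn g ∈ LinearMap.range (h.pbw hn) := by
  obtain ⟨c, rfl⟩ := hx
  induction c using Finsupp.induction_linear with
  | zero => simp
  | add c d hc hd =>
    rw [map_add, add_mul]
    exact add_mem hc hd
  | single P f =>
    rw [pbw_single, mul_assoc]
    exact h.zeta_mul_mem_range hn f (h.vWalk_mul_zeta_mem_range hn P.2 g)

/-- The subalgebra of elements by which the image of `pbw` is stable under right
multiplication. -/
def rightStabilizer : Subalgebra ℂ B where
  carrier := {b | ∀ x ∈ LinearMap.range (h.pbw hn), x * b ∈ LinearMap.range (h.pbw hn)}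
  mul_mem' ha hb x hx := by
    rw [← mul_assoc]
    exact hb _ (ha x hx)
  add_mem' ha hb x hx := by
    rw [mul_add]
    exact add_mem (ha x hx) (hb x hx)
  algebraMap_mem' c x hx := by
    rw [← Algebra.commutes, ← Algebra.smul_def]
    exact Submodule.smul_mem _ c hx

theorem V_mem_rightStabilizer (i : Fin (n + 1)) : V i ∈ h.rightStabilizer hn :=
  fun _ hx => h.mul_V_mem_range hn i hx

theorem zeta_mem_rightStabilizer (g : A n) : h.zeta hn g ∈ h.rightStabilizer hn :=
  fun _ hx => h.mul_zeta_mem_range hn g hx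

theorem inv_vUnit_mem_rightStabilizer (i : Fin (n + 1)) :
    (↑(h.vUnit i)⁻¹ : B) ∈ h.rightStabilizer hn := by
  rw [coe_inv_vUnit]
  exact add_mem (sub_mem (h.V_mem_rightStabilizer hn i) (algebraMap_mem _ _)) (algebraMap_mem _ _)

theorem D₀_mem_rightStabilizer : D₀ ∈ h.rightStabilizer hn := by
  have h1 : h.dZero = (h.vUnit 0)⁻¹ * ((scalarUnit B qh)⁻¹ * h.zUnit 0) := by
    rw [zUnit, inv_mul_cancel_left, inv_mul_cancel_left]
  have h2 : D₀ = ↑(h.vUnit 0)⁻¹ *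
      (algebraMap ℂ B ((qh⁻¹ : ℂˣ) : ℂ) * h.zeta hn (xpow qh (eps n (0 + 1), 0))) := by
    rw [zeta_eps h hn (by omega)]
    exact congrArg Units.val h1
  exact Set.mem_of_eq_of_mem h2 (mul_mem (h.inv_vUnit_mem_rightStabilizer hn 0)
    (mul_mem (algebraMap_mem _ _) (h.zeta_mem_rightStabilizer hn _)))

theorem Dₙ_mem_rightStabilizer : Dₙ ∈ h.rightStabilizer hn := by
  have h1 : h.dLast = (h.zUnit (n - 1))⁻¹ * (h.vUnit (Fin.last n))⁻¹ := by
    rw [eq_mul_inv_iff_mul_eq, eq_inv_iff_mul_eq_one, h.dLast_mul_vUnit_mul_zUnit hn]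
  have h2 : Dₙ = h.zeta hn (xpow qh (-eps n (n - 1 + 1), 0)) * ↑(h.vUnit (Fin.last n))⁻¹ := by
    rw [zeta_neg_eps h hn (by omega)]
    exact congrArg Units.val h1
  exact Set.mem_of_eq_of_mem h2
    (mul_mem (h.zeta_mem_rightStabilizer hn _) (h.inv_vUnit_mem_rightStabilizer hn _))

theorem mem_range_pbw {b : B} (hb : b ∈ h.rightStabilizer hn) :
    b ∈ LinearMap.range (h.pbw hn) := by
  have h1 := hb 1 ⟨Finsupp.single ⟨basePt n, isRegular_basePt n⟩ 1, by
    rw [pbw_single, vWalk_basePt, map_one, one_mul]⟩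
  rwa [one_mul] at h1

end IsFTuple

theorem adjoin_range_gen {n : ℕ} (t : Multiplicity n) (qh : ℂˣ) :
    Algebra.adjoin ℂ (Set.range (gen t qh)) = ⊤ := by
  have h1 : Set.range (gen t qh) =
      RingQuot.mkAlgHom ℂ (FRel t qh) '' Set.range (FreeAlgebra.ι ℂ) := by
    rw [← Set.range_comp]; rfl
  rw [h1, ← AlgHom.map_adjoin, FreeAlgebra.adjoin_range_ι, Algebra.map_top, AlgHom.range_eq_top]
  exact RingQuot.mkAlgHom_surjective ℂ _

/-- The span contains `1` and is stable under right multiplication by all the generators, because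
`V_0^∨` and `V_n^∨` are products of scalars, elements `f(z)` and inverses of `V_0`, `V_n`. -/
theorem pbw_surjective {n : ℕ} (hn : 2 ≤ n) (t : Multiplicity n) (qh : ℂˣ) :
    Function.Surjective ((isFTuple_gen hn t qh).pbw hn) := by
  have h := isFTuple_gen hn t qh
  have h1 : (⊤ : Subalgebra ℂ (F t qh)) ≤ h.rightStabilizer hn := by
    rw [← adjoin_range_gen, Algebra.adjoin_le_iff]
    rintro _ ⟨g, rfl⟩
    cases g with
    | V i => exact h.V_mem_rightStabilizer hn i
    | V0dual => exact h.D₀_mem_rightStabilizer hn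
    | Vndual => exact h.Dₙ_mem_rightStabilizer hn
  exact fun x => h.mem_range_pbw hn (h1 Algebra.mem_top)

/-! ### Independence of the Poincaré–Birkhoff–Witt family of operators -/

theorem weylExp_injective {n : ℕ} (hn : 2 ≤ n) {P : Fin n → ℤ} (h : IsRegular P) :
    Function.Injective (weylExp hn P) := by
  refine h.induction hn (motive := fun P => Function.Injective (weylExp hn P))
    (fun f g hfg => by rwa [weylExp_basePt, weylExp_basePt] at hfg) fun P i hP _ ih f g hfg => ?_
  rw [hP.weylExp_reflPt hn, hP.weylExp_reflPt hn] at hfg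
  rw [← reflExp_reflExp hn i f, ih hfg, reflExp_reflExp hn]

theorem weylExp_fst_ne_zero {n : ℕ} (hn : 2 ≤ n) {P : Fin n → ℤ} (h : IsRegular P)
    {f : (Fin n → ℤ) × ℤ} (hf : f.1 ≠ 0) : (weylExp hn P f).1 ≠ 0 := by
  intro h0
  have h1 : weylExp hn P f = (0, (weylExp hn P f).2) := Prod.ext h0 rfl
  rw [← weylExp_delta hn h] at h1
  exact hf (congrArg Prod.fst (weylExp_injective hn h h1))

/-- This is where the hypothesis on `q` acts: it separates exponents that differ by a multiple of
`δ`, hence separates translations in the affine Weyl group. -/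
theorem xpow_injective {n : ℕ} {qh : ℂˣ} (hq : ∀ m : ℕ, 0 < m → qh ^ m ≠ 1) :
    Function.Injective (xpow (n := n) qh) := by
  intro f g hfg
  have hz : Function.Injective fun m : ℤ => qh ^ m := by
    rw [injective_zpow_iff_not_isOfFinOrder, isOfFinOrder_iff_pow_eq_one]
    rintro ⟨m, hm, h⟩
    exact hq m hm h
  have h := congrArg AddMonoidAlgebra.coeff hfg
  rw [xpow, xpow, AddMonoidAlgebra.coeff_single, AddMonoidAlgebra.coeff_single] at h
  rcases (Finsupp.single_eq_single_iff _ _ _ _).1 h with ⟨h1, h2⟩ | ⟨h1, -⟩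
  · exact Prod.ext h1 (hz (Units.ext h2))
  · exact absurd h1 (Units.ne_zero _)

/-! ### Characters of `𝒜` and triangularity of the operators `T_w` -/

section character

variable {n : ℕ} (hn : 2 ≤ n) (t : Multiplicity n) (qh : ℂˣ)

theorem one_sub_mul_fracPow_ne_zero {f : (Fin n → ℤ) × ℤ} (hf : f.1 ≠ 0) (c : ℂ) :
    1 - algebraMap ℂ (FractionRing (A n)) c * fracPow qh f ≠ 0 := by
  have h : 1 - c • xpow qh f ≠ 0 := by
    intro h
    have h1 := congrArg (fun g : A n => g.coeff 0) h
    simp [xpow, AddMonoidAlgebra.one_def, hf] at h1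
  have h1 := (map_ne_zero_iff _ (fracHom_injective n)).2 h
  rwa [map_sub, map_one, map_smul, Algebra.smul_def] at h1

/-- Each factor `1 - c x^f` of the numerator has constant term `1`, so it is nonzero whatever the
parameters. -/
theorem opCoef_fracPow_ne_zero (i : Fin (n + 1)) {f : (Fin n → ℤ) × ℤ} (hf : f.1 ≠ 0) :
    opCoef t i (fracPow qh f) ≠ 0 := by
  have ht := algebraMap_units_ne_zero (K := FractionRing (A n)) (t.k i)
  have h1 := one_sub_mul_fracPow_ne_zero qh hf
  unfold opCoef
  split_ifs
  · refine div_ne_zero (mul_ne_zero (inv_ne_zero ht) (mul_ne_zero ?_ ?_))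
      (sub_ne_zero.2 (fracPow_sq_ne_one qh hf).symm)
    · simpa only [map_mul] using h1 (t.k i * t.kHalf i)
    · simpa only [map_mul, map_neg, map_inv₀, neg_mul, sub_neg_eq_add] using
        h1 (-(t.k i * (t.kHalf i : ℂ)⁻¹))
  · refine div_ne_zero (mul_ne_zero (inv_ne_zero ht) ?_)
      (sub_ne_zero.2 (fracPow_ne_one qh hf).symm)
    rw [← map_pow]
    exact h1 _

/-- The homomorphism `x^μ ↦ x^{w μ}` to the field of fractions, for the affine Weyl group element
`w` corresponding to a regular point. -/
def weylChar (P : RegPt n) : A n →ₐ[ℂ] FractionRing (A n) :=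
  AddMonoidAlgebra.lift ℂ (FractionRing (A n)) (Fin n → ℤ)
    { toFun := fun μ => fracPow qh (weylExp hn P (μ.toAdd, 0))
      map_one' := by
        have : ((0, 0) : (Fin n → ℤ) × ℤ) = 0 := rfl
        rw [toAdd_one, this, map_zero, fracPow, xpow_zero, map_one]
      map_mul' := fun μ ν => by
        rw [← fracPow_add, ← map_add, Prod.mk_add_mk, add_zero, toAdd_mul] }

theorem weylChar_xpow (P : RegPt n) (f : (Fin n → ℤ) × ℤ) :
    weylChar hn qh P (xpow qh f) = fracPow qh (weylExp hn P f) := by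
  have h1 : f = (0, f.2) + (f.1, 0) := by simp
  have h2 : fracPow qh ((0, f.2) : (Fin n → ℤ) × ℤ) =
      algebraMap ℂ _ ((qh ^ f.2 : ℂˣ) : ℂ) := by
    have : xpow qh ((0, f.2) : (Fin n → ℤ) × ℤ) = algebraMap ℂ (A n) ((qh ^ f.2 : ℂˣ) : ℂ) := by
      simp [xpow, AddMonoidAlgebra.coe_algebraMap]
    rw [fracPow, this, AlgHom.commutes]
  conv_rhs => rw [h1, map_add, weylExp_delta hn P.2, fracPow_add, h2, ← Algebra.smul_def]
  rw [weylChar, xpow, AddMonoidAlgebra.lift_single]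
  rfl

theorem weylChar_refl (P : RegPt n) (i : Fin (n + 1)) (f : A n) :
    weylChar hn qh (P.refl hn i) f = weylChar hn qh P (sAct n qh i f) := by
  have : weylChar hn qh (P.refl hn i) = (weylChar hn qh P).comp (sAct n qh i) :=
    algHom_ext_xpow qh fun μ => by
      rw [AlgHom.comp_apply, sAct_xpow, weylChar_xpow, weylChar_xpow, RegPt.refl,
        P.2.weylExp_reflPt hn]
  exact DFunLike.congr_fun this f

theorem weylChar_basePt (f : A n) :
    weylChar hn qh ⟨basePt n, isRegular_basePt n⟩ f = fracHom n f := by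
  have : weylChar hn qh ⟨basePt n, isRegular_basePt n⟩ = fracHom n :=
    algHom_ext_xpow qh fun μ => by rw [weylChar_xpow, weylExp_basePt, fracPow]
  exact DFunLike.congr_fun this f

/-- The coefficient of `w s_i` in the expansion of `w T_i`. -/
def walkCoef (i : Fin (n + 1)) (P : RegPt n) : FractionRing (A n) :=
  opCoef t i (fracPow qh (weylExp hn P (corootExp n i)))

theorem walkCoef_ne_zero (i : Fin (n + 1)) (P : RegPt n) : walkCoef hn t qh i P ≠ 0 :=
  opCoef_fracPow_ne_zero t qh i (weylExp_fst_ne_zero hn P.2 (corootExp_fst_ne_zero hn i))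

theorem weylChar_T (P : RegPt n) (i : Fin (n + 1)) (f : A n) :
    weylChar hn qh P (T hn t qh i f) =
      (algebraMap ℂ _ (t.k i : ℂ) - walkCoef hn t qh i P) * weylChar hn qh P f +
        walkCoef hn t qh i P * weylChar hn qh (P.refl hn i) f := by
  rw [eval_T hn t qh _ i, weylChar_xpow, weylChar_refl, walkCoef]
  rw [map_sub, map_one, weylChar_xpow]
  exact sub_ne_zero.2
    (fracPow_ne_one qh (weylExp_fst_ne_zero hn P.2 (rootExp_fst_ne_zero hn i))).symm

/-- Dedekind's independence of characters. They are distinct because `x^{w f}` determines `w f` by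
`xpow_injective`, and its values at the base point determine `P`. -/
theorem linearIndependent_weylChar (hq : ∀ m : ℕ, 0 < m → qh ^ m ≠ 1) :
    LinearIndependent (FractionRing (A n)) fun P : RegPt n => (weylChar hn qh P : A n → _) := by
  have hinj : Function.Injective fun P : RegPt n =>
      (weylChar hn qh P : A n →* FractionRing (A n)) := by
    intro P Q hPQ
    refine Subtype.ext (evalAt_injective fun f => ?_)
    have h1 : weylChar hn qh P (xpow qh f) = weylChar hn qh Q (xpow qh f) :=
      DFunLike.congr_fun hPQ (xpow qh f)
    rw [weylChar_xpow, weylChar_xpow] at h1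
    rw [← P.2.evalAt_weylExp hn, ← Q.2.evalAt_weylExp hn,
      xpow_injective hq (fracHom_injective n h1)]
  exact (linearIndependent_monoidHom (A n) (FractionRing (A n))).comp _ hinj

/-- The expansion of `∑ c_w w T_i` in the group elements. -/
def expandStep (i : Fin (n + 1)) :
    (RegPt n →₀ FractionRing (A n)) →ₗ[FractionRing (A n)] (RegPt n →₀ FractionRing (A n)) :=
  Finsupp.linearCombination _ fun P =>
    Finsupp.single P (algebraMap ℂ _ (t.k i : ℂ) - walkCoef hn t qh i P) +
      Finsupp.single (P.refl hn i) (walkCoef hn t qh i P)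

theorem RegPt.refl_refl (i : Fin (n + 1)) (P : RegPt n) : (P.refl hn i).refl hn i = P :=
  Subtype.ext (reflPt_reflPt hn i P)

theorem expandStep_apply (i : Fin (n + 1)) (c : RegPt n →₀ FractionRing (A n)) (P : RegPt n) :
    expandStep hn t qh i c P =
      c P * (algebraMap ℂ _ (t.k i : ℂ) - walkCoef hn t qh i P) +
        c (P.refl hn i) * walkCoef hn t qh i (P.refl hn i) := by
  classical
  induction c using Finsupp.induction_linear with
  | zero => simp
  | add c d hc hd =>
    rw [map_add, Finsupp.add_apply, hc, hd, Finsupp.add_apply, Finsupp.add_apply]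
    ring
  | single Q a =>
    have h1 : Q.refl hn i = P ↔ Q = P.refl hn i :=
      ⟨fun h => by rw [← h, RegPt.refl_refl], fun h => by rw [h, RegPt.refl_refl]⟩
    rw [expandStep, Finsupp.linearCombination_single, Finsupp.smul_apply, Finsupp.add_apply,
      Finsupp.single_apply, Finsupp.single_apply, Finsupp.single_apply, Finsupp.single_apply,
      if_congr h1 rfl rfl, smul_eq_mul, mul_add]
    congr 1
    · split_ifs with h2
      · rw [h2]
      · simp
    · split_ifs with h2
      · rw [h2]
      · simp

theorem linearCombination_expandStep (i : Fin (n + 1)) (c : RegPt n →₀ FractionRing (A n))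
    (f : A n) :
    Finsupp.linearCombination _ (fun P => weylChar hn qh P f) (expandStep hn t qh i c) =
      Finsupp.linearCombination _ (fun P => weylChar hn qh P (T hn t qh i f)) c := by
  induction c using Finsupp.induction_linear with
  | zero => simp
  | add c d hc hd => rw [map_add, map_add, map_add, hc, hd]
  | single Q a =>
    rw [expandStep, Finsupp.linearCombination_single, Finsupp.linearCombination_single, map_smul,
      map_add, Finsupp.linearCombination_single, Finsupp.linearCombination_single, weylChar_T]
    simp only [smul_eq_mul]

/-- The operator `T_w` is a combination of group elements, triangular with respect to length. -/
theorem exists_expansion {P : Fin n → ℤ} (hP : IsRegular P) :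
    ∃ c : RegPt n →₀ FractionRing (A n), c ⟨P, hP⟩ ≠ 0 ∧
      (∀ Q : RegPt n, c Q ≠ 0 → Q = ⟨P, hP⟩ ∨ len hn Q < len hn P) ∧
      ∀ f, fracHom n (vWalk (T hn t qh) hn P f) =
        Finsupp.linearCombination _ (fun Q => weylChar hn qh Q f) c := by
  -- The leading coefficient is required to be nonzero for every proof of regularity, so that the
  -- statement depends on `P` alone and induction along reflections applies.
  suffices H : ∃ c : RegPt n →₀ FractionRing (A n), (∀ h : IsRegular P, c ⟨P, h⟩ ≠ 0) ∧
      (∀ Q : RegPt n, c Q ≠ 0 → (Q : Fin n → ℤ) = P ∨ len hn Q < len hn P) ∧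
      ∀ f, fracHom n (vWalk (T hn t qh) hn P f) =
        Finsupp.linearCombination _ (fun Q => weylChar hn qh Q f) c by
    obtain ⟨c, h1, h2, h3⟩ := H
    exact ⟨c, h1 hP, fun Q hQ => (h2 Q hQ).imp_left Subtype.ext, h3⟩
  refine hP.induction hn (motive := fun P =>
    ∃ c : RegPt n →₀ FractionRing (A n), (∀ h : IsRegular P, c ⟨P, h⟩ ≠ 0) ∧
      (∀ Q : RegPt n, c Q ≠ 0 → (Q : Fin n → ℤ) = P ∨ len hn Q < len hn P) ∧
      ∀ f, fracHom n (vWalk (T hn t qh) hn P f) =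
        Finsupp.linearCombination _ (fun Q => weylChar hn qh Q f) c) ?_ ?_
  · refine ⟨Finsupp.single ⟨basePt n, isRegular_basePt n⟩ 1, by simp, fun Q hQ => Or.inl ?_,
      fun f => ?_⟩
    · by_contra h
      exact hQ (Finsupp.single_eq_of_ne fun h' => h (congrArg Subtype.val h'))
    · rw [Finsupp.linearCombination_single, one_smul, weylChar_basePt, vWalk_basePt]
      rfl
  · rintro P i hP hi ⟨c, h1, h2, h3⟩
    have hl := len_reflPt_of_pos hn hi
    refine ⟨expandStep hn t qh i c, fun h => ?_, fun Q hQ => ?_, fun f => ?_⟩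
    · have e : (⟨reflPt n i P, h⟩ : RegPt n) = RegPt.refl hn i ⟨P, hP⟩ := rfl
      -- The new point is longer than every term in the expansion at `P`, so its coefficient arises
      -- from the old leading term only.
      have h0 : c (RegPt.refl hn i ⟨P, hP⟩) = 0 := by
        by_contra h0
        rcases h2 _ h0 with h4 | h4
        · have h5 : len hn (reflPt n i P) = len hn P := congrArg (len hn) h4
          omega
        · have h5 : len hn (reflPt n i P) < len hn P := h4
          omega
      rw [e, expandStep_apply, RegPt.refl_refl, h0, zero_mul, zero_add]
      exact mul_ne_zero (h1 hP) (walkCoef_ne_zero hn t qh i _)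
    · rw [expandStep_apply] at hQ
      by_cases hQ1 : c Q = 0
      · rw [hQ1, zero_mul, zero_add] at hQ
        rcases h2 _ (left_ne_zero_of_mul hQ) with h4 | h4
        · left
          rw [← h4]
          exact (reflPt_reflPt hn i Q).symm
        · right
          have h5 := (Q.2.map_reflPt hn i).len_reflPt_le hn i
          rw [reflPt_reflPt hn] at h5
          have h6 : len hn (reflPt n i Q) < len hn P := h4
          omega
      · rcases h2 _ hQ1 with h4 | h4
        · right
          rw [h4]
          omega
        · right
          omega
    · rw [linearCombination_expandStep, ← h3, (isFTuple_T hn t qh).vWalk_reflPt hn hi]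
      rfl

/-- In a vanishing combination, take a point `P` of maximal length in the support. By triangularity
only the term of `P` contributes to the character of `P`, so `d_P` times a nonzero leading
coefficient vanishes. -/
theorem pbw_operators_independent (hq : ∀ m : ℕ, 0 < m → qh ^ m ≠ 1) {d : RegPt n →₀ A n}
    (hd : (d.sum fun P a => mulOp a * vWalk (T hn t qh) hn P) = 0) : d = 0 := by
  choose c hc1 hc2 hc3 using fun P : RegPt n => exists_expansion hn t qh P.2
  by_contra hd0
  obtain ⟨P, hP, hmax⟩ := Finset.exists_max_image d.support (fun P => len hn P)
    (Finsupp.support_nonempty_iff.2 hd0)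
  set e : RegPt n →₀ FractionRing (A n) := d.sum fun Q a => fracHom n a • c Q with he
  have he0 : e = 0 := by
    -- Applied to each `f` and mapped to fractions, the relation says that the combination of
    -- characters with coefficients `e` is zero.
    refine linearIndependent_iff.1 (linearIndependent_weylChar hn qh hq) e (funext fun f => ?_)
    have h1 := congrArg (fracHom n) (LinearMap.congr_fun hd f)
    rw [Finsupp.sum, LinearMap.sum_apply, map_sum, LinearMap.zero_apply, map_zero] at h1
    rw [he, Finsupp.sum, map_sum, Finset.sum_apply, Pi.zero_apply, ← h1]
    refine Finset.sum_congr rfl fun Q _ => ?_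
    rw [map_smul, Module.End.mul_apply, mulOp_apply, map_mul, hc3, Pi.smul_apply, smul_eq_mul,
      Finsupp.linearCombination_apply, Finsupp.linearCombination_apply, Finsupp.sum, Finsupp.sum,
      Finset.sum_apply]
    rfl
  have h1 : e P = fracHom n (d P) * c P P := by
    rw [he, Finsupp.sum, Finsupp.finsetSum_apply, Finset.sum_eq_single P]
    · rfl
    · intro Q hQ hQP
      rw [Finsupp.smul_apply, smul_eq_mul, mul_eq_zero]
      right
      by_contra h0
      rcases hc2 Q P h0 with h2 | h2
      · exact hQP h2.symm
      · exact absurd (hmax Q hQ) (not_le.2 h2)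
    · exact fun h => absurd hP h
  rw [he0, Finsupp.zero_apply, eq_comm, mul_eq_zero] at h1
  rcases h1 with h1 | h1
  · exact Finsupp.mem_support_iff.1 hP (fracHom_injective n (by rw [h1, map_zero]))
  · exact hc1 P h1

end character

/-! ### The homomorphism from `ℱ(t; q)` to the double affine Hecke algebra -/

section faithful

variable {n : ℕ} (hn : 2 ≤ n) (t : Multiplicity n) (qh : ℂˣ)

/-- The representation of `ℱ(t; q)` on `𝒜`. -/
def polyRep : F t qh →ₐ[ℂ] Module.End ℂ (A n) := (isFTuple_T hn t qh).hom hn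

theorem polyRep_gen (g : Gen n) : polyRep hn t qh (gen t qh g) =
    genValue (T hn t qh) (dualZeroUnit hn t qh : Module.End ℂ (A n)) (dualLastUnit hn t qh) g :=
  (isFTuple_T hn t qh).hom_gen hn g

theorem polyRep_zUnit {k : ℕ} (hk : k < n) :
    Units.map (polyRep hn t qh).toRingHom.toMonoidHom ((isFTuple_gen hn t qh).zUnit k) =
      coordUnit n qh k := by
  set Φ := Units.map (polyRep hn t qh).toRingHom.toMonoidHom with hΦ
  have hV : ∀ i, Φ ((isFTuple_gen hn t qh).vUnit i) = TUnit hn t qh i := fun i =>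
    Units.ext (polyRep_gen hn t qh (Gen.V i))
  induction k with
  | zero =>
    have hD : Φ (isFTuple_gen hn t qh).dZero = dualZeroUnit hn t qh :=
      Units.ext (polyRep_gen hn t qh Gen.V0dual)
    have hc : Φ (scalarUnit (F t qh) qh) = xUnit qh (0, 1) := by
      ext1
      rw [coe_xUnit_delta, zpow_one]
      exact (polyRep hn t qh).commutes _
    have h0 : ((0, 1) + (0, -1) : (Fin n → ℤ) × ℤ) = 0 := by simp
    have h1 : xUnit qh (0 : (Fin n → ℤ) × ℤ) = 1 :=
      Units.ext (by rw [coe_xUnit, xpow_zero, mulOp_one, Units.val_one])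
    rw [IsFTuple.zUnit, map_mul, map_mul, hV, hD, hc, TUnit_zero_mul_dualZeroUnit, ← mul_assoc,
      ← xUnit_add, h0, h1, one_mul]
  | succ k ih =>
    rw [IsFTuple.zUnit_succ _ (by omega), map_mul, map_mul, hV, ih (by omega),
      coordUnit_succ hn t qh hk]

/-- The recursion for `z_k` in `F` is matched by `x_{k+1} = T_k x_k T_k`, so `polyRep` sends `z_k`
to multiplication by `x_k`. Multiplication operators are thus in the image. -/
theorem polyRep_zeta (f : A n) :
    polyRep hn t qh ((isFTuple_gen hn t qh).zeta hn f) = mulOp f := by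
  set Φ := Units.map (polyRep hn t qh).toRingHom.toMonoidHom with hΦ
  let G : AddSubgroup (Fin n → ℤ) :=
    { carrier := {μ | Φ ((isFTuple_gen hn t qh).zHom hn (Multiplicative.ofAdd μ)) =
        xUnit qh (μ, 0)}
      zero_mem' := by
        rw [Set.mem_ofPred_eq, ofAdd_zero, map_one, map_one]
        ext1
        rw [coe_xUnit, show ((0, 0) : (Fin n → ℤ) × ℤ) = 0 from rfl, xpow_zero, mulOp_one,
          Units.val_one]
      add_mem' := fun {μ ν} hμ hν => by
        rw [Set.mem_ofPred_eq] at hμ hν ⊢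
        rw [ofAdd_add, map_mul, map_mul, hμ, hν, ← xUnit_add, Prod.mk_add_mk, add_zero]
      neg_mem' := fun {μ} hμ => by
        rw [Set.mem_ofPred_eq] at hμ ⊢
        rw [ofAdd_neg, map_inv, map_inv, hμ]
        ext1
        rw [coe_inv_xUnit, coe_xUnit, Prod.neg_mk, neg_zero] }
  have hG : ∀ μ, μ ∈ G := fun μ => by
    have e : μ = ∑ k : Fin n, μ k • (Pi.single k 1 : Fin n → ℤ) := by
      ext l
      simp [Finset.sum_apply, Pi.single_apply]
    rw [e]
    refine AddSubgroup.sum_mem _ fun k _ => AddSubgroup.zsmul_mem _ ?_ _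
    change Φ _ = _
    rw [IsFTuple.zHom_single, hΦ, polyRep_zUnit hn t qh k.2, coordUnit, eps_of_lt k.2]
  have h : (polyRep hn t qh).comp ((isFTuple_gen hn t qh).zeta hn) = Algebra.lmul ℂ (A n) :=
    algHom_ext_xpow qh fun μ => by
      have h1 : Φ _ = _ := hG μ
      rw [AlgHom.comp_apply, IsFTuple.zeta_xpow, zpow_zero, scalarUnit, map_one, one_mul]
      exact congrArg Units.val h1
  exact DFunLike.congr_fun h f

theorem polyRep_vWalk {P : Fin n → ℤ} (hP : IsRegular P) :
    polyRep hn t qh (vWalk (fun i => gen t qh (Gen.V i)) hn P) = vWalk (T hn t qh) hn P := by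
  refine hP.induction hn (motive := fun P =>
    polyRep hn t qh (vWalk (fun i => gen t qh (Gen.V i)) hn P) = vWalk (T hn t qh) hn P)
    (by rw [vWalk_basePt, vWalk_basePt, map_one]) fun P i _ hi ih => ?_
  rw [(isFTuple_gen hn t qh).vWalk_reflPt hn hi, (isFTuple_T hn t qh).vWalk_reflPt hn hi, map_mul,
    ih, polyRep_gen, genValue]

/-- The spanning set `z^μ V_w` is carried to the independent family `x^μ T_w`. -/
theorem polyRep_injective (hq : ∀ m : ℕ, 0 < m → qh ^ m ≠ 1) :
    Function.Injective (polyRep hn t qh) := by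
  rw [injective_iff_map_eq_zero]
  intro x hx
  obtain ⟨d, rfl⟩ := pbw_surjective hn t qh x
  have h : d = 0 := by
    refine pbw_operators_independent hn t qh hq ?_
    rw [← hx, IsFTuple.pbw, Finsupp.lsum_apply, Finsupp.sum, Finsupp.sum, map_sum]
    refine Finset.sum_congr rfl fun P _ => ?_
    rw [LinearMap.comp_apply, LinearMap.mulRight_apply, map_mul, polyRep_vWalk hn t qh P.2]
    exact congrArg (· * _) (polyRep_zeta hn t qh (d P)).symm
  rw [h, map_zero]

theorem T_mem_DAHA (i : Fin (n + 1)) : T hn t qh i ∈ DAHA hn t qh :=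
  Algebra.subset_adjoin (Or.inl ⟨i, rfl⟩)

theorem mulOp_mem_DAHA (f : A n) : mulOp f ∈ DAHA hn t qh :=
  Algebra.subset_adjoin (Or.inr ⟨f, rfl⟩)

theorem inv_TUnit_mem_DAHA (i : Fin (n + 1)) :
    (↑(TUnit hn t qh i)⁻¹ : Module.End ℂ (A n)) ∈ DAHA hn t qh := by
  rw [coe_inv_TUnit]
  exact add_mem (sub_mem (T_mem_DAHA hn t qh i) (algebraMap_mem _ _)) (algebraMap_mem _ _)

theorem coe_dualZeroUnit : (dualZeroUnit hn t qh : Module.End ℂ (A n)) =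
    ↑(TUnit hn t qh 0)⁻¹ * mulOp (xpow qh (-corootExp n 0)) := by
  rw [dualZeroUnit, Units.val_mul, coe_inv_xUnit]

theorem coe_dualLastUnit : (dualLastUnit hn t qh : Module.End ℂ (A n)) =
    mulOp (xpow qh (-corootExp n (Fin.last n))) * ↑(TUnit hn t qh (Fin.last n))⁻¹ := by
  rw [dualLastUnit, Units.val_mul, coe_inv_xUnit]

theorem polyRep_range : (polyRep hn t qh).range = DAHA hn t qh := by
  apply le_antisymm
  · rw [← Algebra.map_top, ← adjoin_range_gen, AlgHom.map_adjoin, Algebra.adjoin_le_iff]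
    rintro _ ⟨_, ⟨g, rfl⟩, rfl⟩
    change polyRep hn t qh (gen t qh g) ∈ DAHA hn t qh
    rw [polyRep_gen]
    cases g with
    | V i => exact T_mem_DAHA hn t qh i
    | V0dual =>
      rw [genValue, coe_dualZeroUnit]
      exact mul_mem (inv_TUnit_mem_DAHA hn t qh _) (mulOp_mem_DAHA hn t qh _)
    | Vndual =>
      rw [genValue, coe_dualLastUnit]
      exact mul_mem (mulOp_mem_DAHA hn t qh _) (inv_TUnit_mem_DAHA hn t qh _)
  · rw [DAHA, Algebra.adjoin_le_iff]
    rintro _ (⟨i, rfl⟩ | ⟨f, rfl⟩)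
    · exact ⟨gen t qh (Gen.V i), polyRep_gen hn t qh (Gen.V i)⟩
    · exact ⟨_, polyRep_zeta hn t qh f⟩

end faithful

end CCn
end

/-! ### The isomorphism -/

open CCn
theorem mainTheorem8 (n : ℕ) (hn : 2 ≤ n) (q qh : ℂˣ) (hqh : qh ^ 2 = q)
    (hq : ∀ m : ℕ, 0 < m → q ^ m ≠ 1) (t : Multiplicity n) :
    ∃ (U₀ Uₙ : (Module.End ℂ (A n))ˣ) (φ : F t qh ≃ₐ[ℂ] DAHA hn t qh),
      (U₀ : Module.End ℂ (A n)) = T hn t qh 0 ∧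
      (Uₙ : Module.End ℂ (A n)) = T hn t qh (Fin.last n) ∧
      (∀ i : Fin (n + 1), (φ (gen t qh (Gen.V i)) : Module.End ℂ (A n)) = T hn t qh i) ∧
      (φ (gen t qh Gen.V0dual) : Module.End ℂ (A n)) =
        (↑(U₀⁻¹) : Module.End ℂ (A n)) * mulOp (xpow qh (-corootExp n 0)) ∧
      (φ (gen t qh Gen.V0dual) : Module.End ℂ (A n)) =
        ((qh⁻¹ : ℂˣ) : ℂ) •
          ((↑(U₀⁻¹) : Module.End ℂ (A n)) * mulOp (xpow qh (eps n 1, 0))) ∧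
      (φ (gen t qh Gen.Vndual) : Module.End ℂ (A n)) =
        mulOp (xpow qh (-corootExp n (Fin.last n))) * (↑(Uₙ⁻¹) : Module.End ℂ (A n)) ∧
      (φ (gen t qh Gen.Vndual) : Module.End ℂ (A n)) =
        mulOp (xpow qh (-eps n n, 0)) * (↑(Uₙ⁻¹) : Module.End ℂ (A n)) := by
  -- If `q^{1/2}` were a root of unity, so would be its square `q`.
  have hq' : ∀ m : ℕ, 0 < m → qh ^ m ≠ 1 := fun m hm h => hq m hm (by
    rw [← hqh, ← pow_mul, mul_comm, pow_mul, h, one_pow])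
  let φ : F t qh ≃ₐ[ℂ] DAHA hn t qh :=
    (AlgEquiv.ofInjective _ (polyRep_injective hn t qh hq')).trans
      (Subalgebra.equivOfEq _ _ (polyRep_range hn t qh))
  have hφ : ∀ x, (φ x : Module.End ℂ (A n)) = polyRep hn t qh x := fun x => rfl
  refine ⟨TUnit hn t qh 0, TUnit hn t qh (Fin.last n), φ, coe_TUnit hn t qh 0, coe_TUnit hn t qh _,
    fun i => ?_, ?_, ?_, ?_, ?_⟩
  · rw [hφ, polyRep_gen, genValue]
  · rw [hφ, polyRep_gen, genValue, coe_dualZeroUnit]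
  -- Since `a_0^∨ = δ/2 - ε_1`, `x^{-a_0^∨} = q^{-1/2}x_1`, and the scalar is moved to the front.
  · rw [hφ, polyRep_gen, genValue, dualZeroUnit, neg_corootExp_zero_eq hn, ← mul_assoc,
      ← (commute_xUnit_delta qh _ _).eq, mul_assoc, Units.val_mul, coe_xUnit_delta, zpow_neg_one,
      Units.val_mul, coordUnit, coe_xUnit, ← Algebra.smul_def]
  · rw [hφ, polyRep_gen, genValue, coe_dualLastUnit]
  · have h : -corootExp n (Fin.last n) = (-eps n n, 0) := by
      simp [corootExp, show n ≠ 0 by omega]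
    rw [hφ, polyRep_gen, genValue, coe_dualLastUnit, h]
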